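/- Let $Q=Q^s\times Q^f$ with $Q^s\subseteq\mathbb R^{n^s}$ and $Q^f\subseteq\mathbb R^{n^f}$ open, and write $q=(q^s,q^f)$. Consider the multirate Lagrangian $$L(q,\dot q)=\tfrac12(\dot q^s)^{T}M^s\dot q^s+\tfrac12(\dot q^f)^{T}M^f\dot q^f-V(q^s,q^f)-W(q^f),$$ with $M^s,M^f$ symmetric positive definite and $V:Q\to\mathbb R$, $W:Q^f\to\mathbb R$ of class $C^\infty$. Let $l\ge 1$. Let $(b_i,c_i)_{i=1}^r$ be a quadrature rule with $c_i\in[0,1]$, $b_i\in\mathbb R$, $\sum_i b_i=1$, of order $u$, i.e. $\int_0^{h}f(t)\,dt-h\sum_i b_i f(hc_i)=\mathcal O(h^{u+1})$ as $h\to0^+$ for every smooth $f$. Assume that the rule is sufficiently accurate for degree $l$ in the following sense: $u\ge 2l-2$, and $\sum_i b_i\,w(c_i)^2>0$ for every nonzero real polynomial $w$ of degree at most $l-1$. (Both conditions hold automatically if $l=1$ or if $u\ge 2l-1$.) For $\Delta T>0$, an integer $p\ge1$, $\Delta t=\Delta T/p$ and $q_0,q_1\in Q$: * $L_d^E(q_0,q_1)=\int_0^{\Delta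 T}L(q_{\mathrm{EL}},\dot q_{\mathrm{EL}})\,dt$, where $q_{\mathrm{EL}}:[0,\Delta T]\to Q$ is a smooth solution of the Euler–Lagrange equations with $q_{\mathrm{EL}}(0)=q_0$, $q_{\mathrm{EL}}(\Delta T)=q_1$ (a continuous critical curve). * $L_d(q_0,q_1)$ is the value at a critical point (a discrete critical curve) of the discrete action $$\Delta t\sum_{m=0}^{p-1}\sum_{i=1}^r b_i\,L\big(\hat q^s,\check q^f,\dot{\hat q}^s,\dot{\check q}^f\big)\big|_{t=m\Delta t+c_i\Delta t}$$ over the pairs consisting of a polynomial $\hat q^s:[0,\Delta T]\to Q^s$ of degree at most $l$ and a continuous $\check q^f:[0,\Delta T]\to Q^f$ whose restriction to each micro interval $[m\Delta t,(m+1)\Delta t]$ is a polynomial of degree at most $l$, such that $(\hat q^s,\check q^f)$ takes the values $q_0$ at $0$ and $q_1$ at $\Delta T$. Velocities in the $m$-th summand are those of the $m$-th polynomial piece. Let $T>0$ and let $q:[0,T]\to Q$ be a smooth curve. Then there are constants $C>0$ and $h_0\in(0,T]$, independent of $\Delta T$ and $p$, such that for all $0<\Delta T\le h_0$ and all $p\ge1$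 the following holds. If all continuous critical curves from $q(0)$ to $q(\Delta T)$ minimise the action among the smooth curves $[0,\Delta T]\to Q$ with these end points, and all discrete critical curves with these end points minimise the discrete action among the admissible pairs $(\hat q^s,\check q^f)$, then $$\big|L_d(q(0),q(\Delta T))-L_d^E(q(0),q(\Delta T))\big|\le C\,\Delta T^{2l+1}+p\,C\,\Delta t^{u+1},$$ that is, $L_d(q(0),q(\Delta T))=L_d^E(q(0),q(\Delta T))+\mathcal O(\Delta T^{2l+1})+p\,\mathcal O(\Delta t^{u+1})$. Here $L_d$ and $L_d^E$ are evaluated at any discrete, respectively continuous, critical curve. -/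

import Mathlib

open Set Filter Topology MeasureTheory
open scoped ContDiff Matrix

namespace Multirate

/-- Configurations `q = (q^s, q^f)`: a slow and a fast part.  Velocities have the same type. -/
abbrev Config (ns nf : ℕ) : Type :=
  EuclideanSpace ℝ (Fin ns) × EuclideanSpace ℝ (Fin nf)

/-- A multirate mechanical system: open configuration spaces of the slow and the fast variables,
a smooth slow potential of all variables, a smooth fast potential of the fast variables only, and
symmetric positive definite slow and fast mass matrices. -/
structure MultirateSystem (ns nf : ℕ) where
  Qs : Set (EuclideanSpace ℝ (Fin ns))
  Qf : Set (EuclideanSpace ℝ (Fin nf))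
  isOpen_Qs : IsOpen Qs
  isOpen_Qf : IsOpen Qf
  V : Config ns nf → ℝ
  W : EuclideanSpace ℝ (Fin nf) → ℝ
  smooth_V : ContDiffOn ℝ ∞ V (Qs ×ˢ Qf)
  smooth_W : ContDiffOn ℝ ∞ W Qf
  Ms : Matrix (Fin ns) (Fin ns) ℝ
  Mf : Matrix (Fin nf) (Fin nf) ℝ
  posDef_Ms : Ms.PosDef
  posDef_Mf : Mf.PosDef

/-- A quadrature rule on the unit interval with nodes `c i` and weights `b i`. -/
structure QuadratureRule where
  r : ℕ
  c : Fin r → ℝ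
  b : Fin r → ℝ
  c_mem : ∀ i, c i ∈ Icc (0 : ℝ) 1
  sum_b : ∑ i, b i = 1

/-- The rule has order (at least) `u`: for every smooth `f` the quadrature error on `[0, h]`
is `O(h ^ (u + 1))` as `h → 0+`. -/
def QuadratureRule.HasOrder (R : QuadratureRule) (u : ℕ) : Prop :=
  ∀ f : ℝ → ℝ, ContDiff ℝ ∞ f →
    (fun h : ℝ => (∫ t in (0 : ℝ)..h, f t) - h * ∑ i, R.b i * f (h * R.c i))
      =O[𝓝[>] 0] (fun h : ℝ => h ^ (u + 1))

/-- The discrete square norm `∑ b_i w(c_i)^2` is positive on the nonzero polynomials of degree at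
most `l - 1` (the space of velocities of polynomial curves of degree at most `l`). -/
def QuadratureRule.IsDefinite (R : QuadratureRule) (l : ℕ) : Prop :=
  ∀ w : Polynomial ℝ, w ≠ 0 → w.natDegree < l → 0 < ∑ i, R.b i * (w.eval (R.c i)) ^ 2

variable {ns nf : ℕ}

namespace MultirateSystem

/-- The kinetic energy, with block-diagonal mass matrix. -/
noncomputable def kinetic (S : MultirateSystem ns nf) (v : Config ns nf) : ℝ :=
  (1 / 2) * (v.1.ofLp ⬝ᵥ (S.Ms *ᵥ v.1.ofLp)) + (1 / 2) * (v.2.ofLp ⬝ᵥ (S.Mf *ᵥ v.2.ofLp))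

/-- The multirate Lagrangian `L(q, v) = T(v) - V(q) - W(q^f)`. -/
noncomputable def lagrangian (S : MultirateSystem ns nf) (q v : Config ns nf) : ℝ :=
  S.kinetic v - S.V q - S.W q.2

/-! ### Curves in continuous time -/

/-- The velocity of a curve on `[0, ΔT]` (one-sided at the end points). -/
noncomputable def velocity (ΔT : ℝ) (x : ℝ → Config ns nf) (t : ℝ) : Config ns nf :=
  derivWithin x (Icc 0 ΔT) t

/-- The action of a curve on `[0, ΔT]`. -/
noncomputable def action (S : MultirateSystem ns nf) (ΔT : ℝ) (x : ℝ → Config ns nf) : ℝ :=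
  ∫ t in (0 : ℝ)..ΔT, S.lagrangian (x t) (velocity ΔT x t)

/-- Smooth curves `[0, ΔT] → Q = Q^s × Q^f` from `q₀` to `q₁`. -/
def IsCurve (S : MultirateSystem ns nf) (ΔT : ℝ) (q₀ q₁ : Config ns nf)
    (x : ℝ → Config ns nf) : Prop :=
  ContDiffOn ℝ ∞ x (Icc 0 ΔT) ∧ (∀ t ∈ Icc 0 ΔT, x t ∈ S.Qs ×ˢ S.Qf) ∧ x 0 = q₀ ∧ x ΔT = q₁

/-- Critical curves of the action with fixed end points: the smooth curves from `q₀` to `q₁` that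
solve the Euler-Lagrange equations `d/dt (∂L/∂v) = ∂L/∂q` on `[0, ΔT]`. -/
def IsCritical (S : MultirateSystem ns nf) (ΔT : ℝ) (q₀ q₁ : Config ns nf)
    (x : ℝ → Config ns nf) : Prop :=
  S.IsCurve ΔT q₀ q₁ x ∧
    ∀ t ∈ Icc 0 ΔT,
      HasDerivWithinAt
        (fun s => fderiv ℝ (fun v => S.lagrangian (x s) v) (velocity ΔT x s))
        (fderiv ℝ (fun y => S.lagrangian y (velocity ΔT x t)) (x t))
        (Icc 0 ΔT) t

/-- All critical curves from `q₀` to `q₁` minimise the action among the smooth curves in `Q`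
with the same end points. -/
def CriticalCurvesMinimise (S : MultirateSystem ns nf) (ΔT : ℝ) (q₀ q₁ : Config ns nf) : Prop :=
  ∀ x, S.IsCritical ΔT q₀ q₁ x → ∀ y, S.IsCurve ΔT q₀ q₁ y → S.action ΔT x ≤ S.action ΔT y

/-- `a` is the value `L_d^E(q₀, q₁)` of the exact discrete Lagrangian: the action of a solution
of the Euler-Lagrange equations from `q₀` to `q₁`. -/
def IsExactDiscreteLagrangian (S : MultirateSystem ns nf) (ΔT : ℝ) (q₀ q₁ : Config ns nf)
    (a : ℝ) : Prop :=
  ∃ x, S.IsCritical ΔT q₀ q₁ x ∧ a = S.action ΔT x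

end MultirateSystem

/-! ### Multirate polynomial curves -/

/-- The vector valued polynomial of degree at most `l` with coefficients `a`. -/
def polyCurve {l : ℕ} {E : Type*} [AddCommGroup E] [Module ℝ E] (a : Fin (l + 1) → E) (t : ℝ) : E :=
  ∑ k : Fin (l + 1), t ^ (k : ℕ) • a k

/-- The coefficients of a slow polynomial on `[0, ΔT]` and of `p` fast polynomials, the `m`-th one
being used on the micro interval `[mΔt, (m+1)Δt]`, where `Δt = ΔT / p`. -/
abbrev PolyPair (ns nf l p : ℕ) : Type :=
  (Fin (l + 1) → EuclideanSpace ℝ (Fin ns)) × (Fin p → Fin (l + 1) → EuclideanSpace ℝ (Fin nf))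

variable {l p : ℕ}

/-- The configuration at time `t` of the `m`-th micro interval. -/
def PolyPair.pos (g : PolyPair ns nf l p) (m : Fin p) (t : ℝ) : Config ns nf :=
  (polyCurve g.1 t, polyCurve (g.2 m) t)

/-- The velocity at time `t` of the `m`-th micro interval (one-sided at the micro nodes). -/
noncomputable def PolyPair.vel (g : PolyPair ns nf l p) (m : Fin p) (t : ℝ) : Config ns nf :=
  (deriv (polyCurve g.1) t, deriv (polyCurve (g.2 m)) t)

/-- Consecutive fast pieces agree at the interior micro nodes. -/
def PolyPair.IsContinuous (ΔT : ℝ) (g : PolyPair ns nf l p) : Prop :=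
  ∀ m m' : Fin p, (m' : ℕ) = (m : ℕ) + 1 →
    polyCurve (g.2 m) ((m' : ℕ) * (ΔT / p)) = polyCurve (g.2 m') ((m' : ℕ) * (ΔT / p))

/-- The slow and the fast curve start at `q₀` and end at `q₁`. -/
def PolyPair.HasEndpoints (ΔT : ℝ) (q₀ q₁ : Config ns nf) (g : PolyPair ns nf l p) : Prop :=
  (polyCurve g.1 0 = q₀.1 ∧ polyCurve g.1 ΔT = q₁.1) ∧
    (∀ m : Fin p, (m : ℕ) = 0 → polyCurve (g.2 m) 0 = q₀.2) ∧
    (∀ m : Fin p, (m : ℕ) + 1 = p → polyCurve (g.2 m) ΔT = q₁.2)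

namespace MultirateSystem

/-- Multirate polynomial curves in `Q` from `q₀` to `q₁`: a slow polynomial in `Q^s` on `[0, ΔT]`
and a continuous piecewise polynomial in `Q^f`. -/
def IsPolyCurve (S : MultirateSystem ns nf) (ΔT : ℝ) (q₀ q₁ : Config ns nf)
    (g : PolyPair ns nf l p) : Prop :=
  g.IsContinuous ΔT ∧ g.HasEndpoints ΔT q₀ q₁ ∧
    (∀ t ∈ Icc 0 ΔT, polyCurve g.1 t ∈ S.Qs) ∧
    (∀ m : Fin p, ∀ t ∈ Icc ((m : ℕ) * (ΔT / p)) (((m : ℕ) + 1) * (ΔT / p)),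
      polyCurve (g.2 m) t ∈ S.Qf)

/-- The discrete action `Δt ∑_m ∑_i b_i L(q(mΔt + c_iΔt), q'(mΔt + c_iΔt))`, `Δt = ΔT / p`. -/
noncomputable def discreteAction (S : MultirateSystem ns nf) (R : QuadratureRule) (ΔT : ℝ)
    (g : PolyPair ns nf l p) : ℝ :=
  (ΔT / p) * ∑ m : Fin p, ∑ i : Fin R.r, R.b i *
    S.lagrangian (g.pos m ((m : ℕ) * (ΔT / p) + R.c i * (ΔT / p)))
      (g.vel m ((m : ℕ) * (ΔT / p) + R.c i * (ΔT / p)))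

/-- Critical points of the discrete action with fixed end points: the derivative vanishes in the
direction of every continuous multirate polynomial that is zero at both end points. -/
def IsDiscreteCritical (S : MultirateSystem ns nf) (R : QuadratureRule) (ΔT : ℝ)
    (q₀ q₁ : Config ns nf) (g : PolyPair ns nf l p) : Prop :=
  S.IsPolyCurve ΔT q₀ q₁ g ∧
    ∀ d : PolyPair ns nf l p, d.IsContinuous ΔT → d.HasEndpoints ΔT 0 0 →
      HasDerivAt (fun ε : ℝ => S.discreteAction R ΔT (g + ε • d)) 0 0

/-- All critical points of the discrete action minimise it among the multirate polynomial curves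
in `Q` with the same end points (degree at most `l`, `p` micro intervals). -/
def DiscreteCriticalCurvesMinimise (S : MultirateSystem ns nf) (R : QuadratureRule) (l p : ℕ)
    (ΔT : ℝ) (q₀ q₁ : Config ns nf) : Prop :=
  ∀ g : PolyPair ns nf l p, S.IsDiscreteCritical R ΔT q₀ q₁ g →
    ∀ g' : PolyPair ns nf l p, S.IsPolyCurve ΔT q₀ q₁ g' →
      S.discreteAction R ΔT g ≤ S.discreteAction R ΔT g'

/-- `a` is the value `L_d(q₀, q₁)` of the multirate Galerkin discrete Lagrangian: the value of the
discrete action at a critical point. -/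
def IsDiscreteLagrangian (S : MultirateSystem ns nf) (R : QuadratureRule) (l p : ℕ) (ΔT : ℝ)
    (q₀ q₁ : Config ns nf) (a : ℝ) : Prop :=
  ∃ g : PolyPair ns nf l p, S.IsDiscreteCritical R ΔT q₀ q₁ g ∧ a = S.discreteAction R ΔT g

end MultirateSystem

end Multirate

/-! Write `h` for the macro step and `δ = h / p`. Two critical curves that both minimise have the
same action, so the two discrete Lagrangians can be computed from any critical curves. It therefore
suffices to construct one convenient curve of each kind near `q 0`, where the potential may be
replaced by a compactly supported one with global bounds (`exists_local_model`).

Let `x` be the Euler–Lagrange solution from `q 0` to `q h`, found by contraction, let `g` be a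
discrete critical curve, and let `Y` be a polynomial of degree at most `l` with the same end points
such that `Y - x` and its derivative are `O(h ^ l)`. Upper bound: the discrete action of `g` is at
most that of `Y`, which is the action of `Y` up to quadrature error. Stationarity of `x` makes the
action of `Y` exceed that of `x` by a quantity quadratic in the deviation, hence by `O(h ^ (2l +
1))` (`action_le_add`). Lower bound: the discrete action of `g` is its true action up to quadrature
error, and on short intervals the true action of any piecewise smooth curve is at least that of `x`
(`action_le_action_pieces`).

The main work is the quadrature error along `g`. It is `O(δ ^ (u + 1))` per piece, uniformly in `h`
and `p`, once the polynomial pieces of `g`, centred at their micro nodes, have bounded coefficients.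
This comes from a stability estimate for the Galerkin equations (`galerkin_estimate`): a discrete
critical curve is `O(h ^ 2 * ε)` away from any polynomial of sufficiently low degree that satisfies
the equations of motion up to `ε`. Comparison with a polynomial having residual `O(h ^ (l - 2))`
gives a distance `O(h ^ l)`, and a polynomial of degree at most `l` that is `O(h ^ l)` on `[0, h]`
has bounded coefficients. This settles the slow variables. A fast piece lives on an interval of
length `δ`, possibly much shorter than `h`, so the argument is repeated there with the slow
polynomial as a known input (`exists_fast_polyBound`). That step needs fast increments of size
`O(δ)`, obtained by testing the discrete equations with a piecewise linear curve
(`exists_fast_increment_bound`). -/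

namespace Multirate

/-! ### Vector-valued polynomials and bounds on their coefficients -/

section Polynomials

variable {E F G : Type*} [NormedAddCommGroup E] [NormedSpace ℝ E]
  [NormedAddCommGroup F] [NormedSpace ℝ F] [NormedAddCommGroup G] [NormedSpace ℝ G]

/-- The vector valued polynomial with coefficients `a`, of degree less than `n`. -/
def pval {n : ℕ} (a : Fin n → E) (t : ℝ) : E := ∑ k : Fin n, t ^ (k : ℕ) • a k

/-- The coefficients of the derivative. -/
def dcoef {n : ℕ} (a : Fin (n + 1) → E) : Fin n → E := fun k => ((k : ℝ) + 1) • a k.succ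

/-- `f` is a vector valued polynomial of degree less than `n`. -/
def IsPoly (n : ℕ) (f : ℝ → E) : Prop := ∃ a : Fin n → E, f = pval a

/-- `f` is a polynomial of degree less than `n` with coefficients bounded by `C`. -/
def PolyBound (n : ℕ) (C : ℝ) (f : ℝ → E) : Prop := ∃ a : Fin n → E, ‖a‖ ≤ C ∧ f = pval a

theorem PolyBound.isPoly {n : ℕ} {C : ℝ} {f : ℝ → E} (h : PolyBound n C f) : IsPoly n f :=
  let ⟨a, _, h⟩ := h; ⟨a, h⟩

theorem IsPoly.exists_polyBound {n : ℕ} {f : ℝ → E} (h : IsPoly n f) : ∃ C, PolyBound n C f :=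
  let ⟨a, h⟩ := h; ⟨‖a‖, a, le_rfl, h⟩

theorem PolyBound.nonneg {n : ℕ} {C : ℝ} {f : ℝ → E} (h : PolyBound n C f) : 0 ≤ C :=
  let ⟨_, h, _⟩ := h; (norm_nonneg _).trans h

theorem PolyBound.weaken {n : ℕ} {C D : ℝ} {f : ℝ → E} (h : PolyBound n C f) (hCD : C ≤ D) :
    PolyBound n D f :=
  let ⟨a, h, h'⟩ := h; ⟨a, h.trans hCD, h'⟩

theorem pval_succ {n : ℕ} (a : Fin (n + 1) → E) (t : ℝ) :
    pval a t = a 0 + t • pval (fun k : Fin n => a k.succ) t := by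
  simp only [pval, Fin.sum_univ_succ, Fin.val_zero, pow_zero, one_smul, Finset.smul_sum, Fin.val_succ,
    pow_succ', mul_smul]

theorem pval_add {n : ℕ} (a b : Fin n → E) (t : ℝ) : pval (a + b) t = pval a t + pval b t := by
  simp [pval, Finset.sum_add_distrib]

theorem pval_smul {n : ℕ} (c : ℝ) (a : Fin n → E) (t : ℝ) : pval (c • a) t = c • pval a t := by
  simp only [pval, Pi.smul_apply, Finset.smul_sum]
  exact Finset.sum_congr rfl fun k _ => smul_comm _ _ _

theorem pval_map {n : ℕ} (φ : E →ₗ[ℝ] F) (a : Fin n → E) (t : ℝ) :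
    pval (fun k => φ (a k)) t = φ (pval a t) := by
  simp [pval, map_sum]

theorem hasDerivAt_pval {n : ℕ} (a : Fin (n + 1) → E) (t : ℝ) :
    HasDerivAt (pval a) (pval (dcoef a) t) t := by
  have : ∀ k : Fin (n + 1), HasDerivAt (fun t : ℝ => t ^ (k : ℕ) • a k)
      (((k : ℕ) * t ^ ((k : ℕ) - 1)) • a k) t := fun k =>
    (hasDerivAt_pow (k : ℕ) t).smul_const (a k)
  have h := HasDerivAt.fun_sum (u := Finset.univ) fun k _ => this k
  have e : pval (dcoef a) t = ∑ k : Fin (n + 1), (((k : ℕ) : ℝ) * t ^ ((k : ℕ) - 1)) • a k := by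
    rw [Fin.sum_univ_succ]
    simp [pval, dcoef, smul_smul, mul_comm]
  rw [e]
  exact h

theorem deriv_pval {n : ℕ} (a : Fin (n + 1) → E) : deriv (pval a) = pval (dcoef a) :=
  funext fun t => (hasDerivAt_pval a t).deriv

theorem continuous_pval {n : ℕ} (a : Fin n → E) : Continuous (pval a) := by
  unfold pval; fun_prop

theorem norm_pval_le {n : ℕ} (a : Fin n → E) {t : ℝ} (ht : t ∈ Icc (0 : ℝ) 1) :
    ‖pval a t‖ ≤ n * ‖a‖ := by
  refine (norm_sum_le _ _).trans ?_
  have : ∀ k ∈ (Finset.univ : Finset (Fin n)), ‖t ^ (k : ℕ) • a k‖ ≤ ‖a‖ := fun k _ => by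
    rw [norm_smul, norm_pow, Real.norm_of_nonneg ht.1]
    exact (mul_le_of_le_one_left (norm_nonneg _) (pow_le_one₀ ht.1 ht.2)).trans (norm_le_pi_norm a k)
  simpa using Finset.sum_le_card_nsmul _ _ _ this

theorem isPoly_zero (n : ℕ) : IsPoly n (fun _ => (0 : E)) := ⟨0, by ext; simp [pval]⟩

theorem IsPoly.succ {n : ℕ} {f : ℝ → E} (h : IsPoly n f) : IsPoly (n + 1) f := by
  obtain ⟨a, rfl⟩ := h
  refine ⟨Fin.snoc a 0, funext fun t => ?_⟩
  simp [pval, Fin.sum_univ_castSucc]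

theorem IsPoly.mono {n m : ℕ} {f : ℝ → E} (h : IsPoly n f) (hnm : n ≤ m) : IsPoly m f := by
  induction hnm with
  | refl => exact h
  | step _ ih => exact ih.succ

theorem IsPoly.add {n : ℕ} {f g : ℝ → E} (hf : IsPoly n f) (hg : IsPoly n g) :
    IsPoly n (fun t => f t + g t) := by
  obtain ⟨a, rfl⟩ := hf
  obtain ⟨b, rfl⟩ := hg
  exact ⟨a + b, funext fun t => (pval_add a b t).symm⟩

theorem IsPoly.const_smul {n : ℕ} {f : ℝ → E} (hf : IsPoly n f) (c : ℝ) :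
    IsPoly n (fun t => c • f t) := by
  obtain ⟨a, rfl⟩ := hf
  exact ⟨c • a, funext fun t => (pval_smul c a t).symm⟩

theorem IsPoly.sub {n : ℕ} {f g : ℝ → E} (hf : IsPoly n f) (hg : IsPoly n g) :
    IsPoly n (fun t => f t - g t) := by
  simpa [sub_eq_add_neg] using hf.add (hg.const_smul (-1))

theorem IsPoly.map {n : ℕ} {f : ℝ → E} (hf : IsPoly n f) (φ : E →L[ℝ] F) :
    IsPoly n (fun t => φ (f t)) := by
  obtain ⟨a, rfl⟩ := hf
  exact ⟨fun k => φ (a k), funext fun t => (pval_map φ.toLinearMap a t).symm⟩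

theorem IsPoly.smul_id {n : ℕ} {f : ℝ → E} (h : IsPoly n f) : IsPoly (n + 1) (fun t => t • f t) := by
  obtain ⟨a, rfl⟩ := h
  refine ⟨Fin.cons 0 a, funext fun t => ?_⟩
  simp [pval_succ]

theorem isPoly_const {n : ℕ} (hn : 1 ≤ n) (c : E) : IsPoly n (fun _ => c) :=
  IsPoly.mono (n := 1) ⟨fun _ => c, by ext; simp [pval]⟩ hn

theorem IsPoly.differentiable {n : ℕ} {f : ℝ → E} (h : IsPoly n f) : Differentiable ℝ f := by
  obtain ⟨a, rfl⟩ := h.succ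
  exact fun t => (hasDerivAt_pval a t).differentiableAt

theorem IsPoly.deriv {n : ℕ} {f : ℝ → E} (h : IsPoly (n + 1) f) : IsPoly n (deriv f) := by
  obtain ⟨a, rfl⟩ := h
  exact ⟨dcoef a, deriv_pval a⟩

theorem IsPoly.continuous_deriv {n : ℕ} {f : ℝ → E} (h : IsPoly n f) : Continuous (_root_.deriv f) :=
  h.succ.deriv.differentiable.continuous

/-- Degrees `n - 1` and `m` add up to `n + m - 1`; writing the second bound as `m + 1` avoids
truncated subtraction. The induction peels off the constant coefficient of `f`. -/
theorem IsPoly.bilin {n m : ℕ} {f : ℝ → E} {g : ℝ → F} (B : E →L[ℝ] F →L[ℝ] G)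
    (hf : IsPoly n f) (hg : IsPoly (m + 1) g) : IsPoly (n + m) (fun t => B (f t) (g t)) := by
  induction n generalizing f with
  | zero =>
    obtain ⟨a, rfl⟩ := hf
    simpa [pval] using isPoly_zero (E := G) (0 + m)
  | succ n ih =>
    obtain ⟨a, rfl⟩ := hf
    have h1 := (hg.map (B (a 0))).mono (show m + 1 ≤ n + 1 + m by omega)
    have h2 := (ih ⟨fun k : Fin n => a k.succ, rfl⟩).smul_id
    have := h1.add (h2.mono (show n + m + 1 ≤ n + 1 + m by omega))
    simpa only [pval_succ, map_add, map_smul, _root_.add_apply,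
      _root_.smul_apply] using this

/-- Horner's scheme: with `f x = a 0 + x • f₁ x`, the substitution yields the three terms `a 0`, `β
• f₁` and `s • α • f₁`, whence a factor `3` per degree. The bound does not depend on the shift, so
polynomials can be recentred at every micro node at a cost independent of `p`. -/
theorem PolyBound.comp_affine {n : ℕ} {C α β : ℝ} {f : ℝ → E} (hα : |α| ≤ 1) (hβ : |β| ≤ 1)
    (hf : PolyBound n C f) : PolyBound n (3 ^ n * C) (fun s => f (β + α * s)) := by
  induction n generalizing f with
  | zero =>
    obtain ⟨a, ha, rfl⟩ := hf
    exact ⟨a, by simpa using ha, by ext; simp [pval]⟩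
  | succ n ih =>
    have hC := hf.nonneg
    obtain ⟨a, ha, rfl⟩ := hf
    obtain ⟨b, hb, hb'⟩ := ih (f := pval fun k : Fin n => a k.succ)
      ⟨_, (pi_norm_le_iff_of_nonneg hC).2 fun k => (norm_le_pi_norm a _).trans ha, rfl⟩
    have hb' : ∀ s, pval (fun k : Fin n => a k.succ) (β + α * s) = pval b s := fun s =>
      congrFun hb' s
    have h1 : ‖a 0‖ ≤ C := (norm_le_pi_norm a _).trans ha
    have h3 : (1 : ℝ) ≤ 3 ^ n := one_le_pow₀ (by norm_num)
    refine ⟨Fin.cons (a 0) 0 + (Fin.snoc (β • b) 0 : Fin (n + 1) → E) + Fin.cons 0 (α • b), ?_,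
      funext fun s => ?_⟩
    · have i1 : ‖(Fin.cons (a 0) 0 : Fin (n + 1) → E)‖ ≤ C := by
        refine (pi_norm_le_iff_of_nonneg hC).2 fun k => ?_
        refine Fin.cases ?_ (fun k => ?_) k
        · simpa using h1
        · simpa using hC
      have i2 : ‖(Fin.snoc (β • b) 0 : Fin (n + 1) → E)‖ ≤ 3 ^ n * C := by
        refine (pi_norm_le_iff_of_nonneg (by positivity)).2 fun k => ?_
        refine Fin.lastCases ?_ (fun k => ?_) k
        · simpa using by positivity
        · simp only [Fin.snoc_castSucc, Pi.smul_apply, norm_smul, Real.norm_eq_abs]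
          exact (mul_le_of_le_one_left (norm_nonneg _) hβ).trans ((norm_le_pi_norm b k).trans hb)
      have i3 : ‖(Fin.cons 0 (α • b) : Fin (n + 1) → E)‖ ≤ 3 ^ n * C := by
        refine (pi_norm_le_iff_of_nonneg (by positivity)).2 fun k => ?_
        refine Fin.cases ?_ (fun k => ?_) k
        · simpa using by positivity
        · simp only [Fin.cons_succ, Pi.smul_apply, norm_smul, Real.norm_eq_abs]
          exact (mul_le_of_le_one_left (norm_nonneg _) hα).trans ((norm_le_pi_norm b k).trans hb)
      refine (norm_add₃_le.trans (add_le_add_three i1 i2 i3)).trans ?_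
      rw [pow_succ]
      nlinarith
    · have j1 : pval (Fin.cons (a 0) 0 : Fin (n + 1) → E) s = a 0 := by
        rw [pval_succ]; simp [pval]
      have j2 : pval (Fin.snoc (β • b) 0 : Fin (n + 1) → E) s = β • pval b s := by
        rw [← pval_smul]; simp [pval, Fin.sum_univ_castSucc]
      have j3 : pval (Fin.cons 0 (α • b) : Fin (n + 1) → E) s = (s * α) • pval b s := by
        rw [mul_smul, ← pval_smul]; simp [pval_succ, Pi.smul_def]
      rw [pval_add, pval_add, j1, j2, j3, pval_succ, hb', add_smul, mul_comm α s, add_assoc]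

theorem IsPoly.comp_scale {n : ℕ} {f : ℝ → E} (hf : IsPoly n f) (α : ℝ) :
    IsPoly n (fun s => f (α * s)) := by
  obtain ⟨a, rfl⟩ := hf
  exact ⟨fun k => α ^ (k : ℕ) • a k, by
    ext s; simp [pval, smul_smul, mul_pow, mul_comm]⟩

/-- The bounded version allows only shifts of size at most one. Scaling the variable by `|β| + 1`
brings any shift into that range, and no coefficient bound has to survive here. -/
theorem IsPoly.comp_affine {n : ℕ} {f : ℝ → E} (hf : IsPoly n f) (α β : ℝ) :
    IsPoly n (fun s => f (β + α * s)) := by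
  have key : ∀ β : ℝ, |β| ≤ 1 → ∀ g : ℝ → E, IsPoly n g → IsPoly n (fun s => g (β + s)) := by
    intro β hβ g hg
    obtain ⟨C, hC⟩ := hg.exists_polyBound
    simpa using (hC.comp_affine (α := 1) (by simp) hβ).isPoly
  have hc : 0 < |β| + 1 := by positivity
  have h1 := key (β / (|β| + 1)) (by
    rw [abs_div, abs_of_pos hc, div_le_one hc]; linarith) _ (hf.comp_scale (|β| + 1))
  have h2 := h1.comp_scale (α / (|β| + 1))
  have : (fun s => f (β + α * s)) = fun s => f ((|β| + 1) * (β / (|β| + 1) + α / (|β| + 1) * s)) := by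
    ext s
    congr 1
    field_simp
  rw [this]; exact h2

/-- The coordinate polynomial of `pval a` along a linear functional. -/
noncomputable def coordPoly {n : ℕ} (φ : E →L[ℝ] ℝ) (a : Fin n → E) : Polynomial ℝ :=
  ∑ k : Fin n, Polynomial.monomial (k : ℕ) (φ (a k))

theorem eval_coordPoly {n : ℕ} (φ : E →L[ℝ] ℝ) (a : Fin n → E) (t : ℝ) :
    (coordPoly φ a).eval t = φ (pval a t) := by
  simp [coordPoly, pval, Polynomial.eval_finsetSum, mul_comm]

theorem coeff_coordPoly {n : ℕ} (φ : E →L[ℝ] ℝ) (a : Fin n → E) (k : Fin n) :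
    (coordPoly φ a).coeff k = φ (a k) := by
  simp [coordPoly, Polynomial.coeff_monomial, Fin.val_inj]

theorem natDegree_coordPoly {n : ℕ} (hn : 0 < n) (φ : E →L[ℝ] ℝ) (a : Fin n → E) :
    (coordPoly φ a).natDegree < n := by
  refine lt_of_le_of_lt (Polynomial.natDegree_sum_le_of_forall_le (n := n - 1) _ _ fun k _ => ?_)
    (Nat.sub_lt hn one_pos)
  refine (Polynomial.natDegree_monomial_le _).trans ?_
  omega

/-- A positive, continuous, 2-homogeneous function is coercive. -/
theorem exists_coercive [FiniteDimensional ℝ E] (Q : E → ℝ) (hc : Continuous Q)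
    (hs : ∀ (c : ℝ) v, Q (c • v) = c ^ 2 * Q v) (hp : ∀ v, v ≠ 0 → 0 < Q v) :
    ∃ κ > 0, ∀ v, κ * ‖v‖ ^ 2 ≤ Q v := by
  have h0 : Q 0 = 0 := by simpa using hs 0 0
  by_cases hE : ∃ v : E, v ≠ 0
  · obtain ⟨v₀, hv₀⟩ := hE
    have : Nontrivial E := ⟨v₀, 0, hv₀⟩
    obtain ⟨w, hw, hmin⟩ := (isCompact_sphere (0 : E) 1).exists_isMinOn
      (NormedSpace.sphere_nonempty.2 zero_le_one) hc.continuousOn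
    have hw1 : ‖w‖ = 1 := by simpa using hw
    refine ⟨Q w, hp w (by rintro rfl; simp at hw1), fun v => ?_⟩
    by_cases hv : v = 0
    · simp [hv, h0]
    have hvn : ‖v‖ ≠ 0 := norm_ne_zero_iff.2 hv
    have h1 : Q w ≤ Q (‖v‖⁻¹ • v) := hmin (by simp [norm_smul, hvn])
    rw [hs] at h1
    have : Q v = ‖v‖ ^ 2 * (‖v‖⁻¹ ^ 2 * Q v) := by field_simp
    rw [this, mul_comm]
    exact mul_le_mul_of_nonneg_left h1 (by positivity)
  · push Not at hE
    exact ⟨1, one_pos, fun v => by simp [hE v, h0]⟩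

/-- Evaluation at the `n` points `j / n` is injective on polynomials of degree less than `n`, by
counting roots of the coordinate polynomials. The sum of the squared values is then coercive in the
coefficients. -/
theorem exists_coeff_bound [FiniteDimensional ℝ E] (n : ℕ) :
    ∃ C : ℝ, 0 ≤ C ∧ ∀ a : Fin n → E, ∀ K : ℝ, (∀ t ∈ Icc (0 : ℝ) 1, ‖pval a t‖ ≤ K) → ‖a‖ ≤ C * K := by
  have hinj : ∀ a : Fin n → E, a ≠ 0 → ∃ j : Fin n, pval a ((j : ℝ) / n) ≠ 0 := by
    intro a ha
    by_contra! hz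
    refine ha (funext fun k => ?_)
    have hn : 0 < n := k.pos
    have hn' : (0 : ℝ) < n := by exact_mod_cast hn
    refine (SeparatingDual.eq_zero_iff_forall_dual_eq_zero (R := ℝ) (a k)).2 fun φ => ?_
    have : coordPoly φ a = 0 := by
      refine Polynomial.eq_zero_of_natDegree_lt_card_of_eval_eq_zero (ι := Fin n) _
        (f := fun j => (j : ℝ) / n) (fun i j hij => ?_) (fun j => ?_) ?_
      · have : (i : ℝ) = j := by
          have := hij; simp only [] at this; field_simp at this; exact this
        exact Fin.ext (by exact_mod_cast this)
      · rw [eval_coordPoly, hz, map_zero]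
      · simpa using natDegree_coordPoly hn φ a
    rw [← coeff_coordPoly φ a k, this, Polynomial.coeff_zero]
  obtain ⟨κ, hκ, h⟩ := exists_coercive (E := Fin n → E)
    (fun a => ∑ j : Fin n, ‖pval a ((j : ℝ) / n)‖ ^ 2) (by unfold pval; fun_prop)
    (fun c a => by simp [pval_smul, norm_smul, mul_pow, Finset.mul_sum])
    (fun a ha => by
      obtain ⟨j, hj⟩ := hinj a ha
      exact Finset.sum_pos' (fun _ _ => by positivity) ⟨j, Finset.mem_univ _, by positivity⟩)
  refine ⟨√(n / κ), Real.sqrt_nonneg _, fun a K hK => ?_⟩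
  have hK0 : 0 ≤ K := (norm_nonneg _).trans (hK 0 (by simp))
  have h1 : ∑ j : Fin n, ‖pval a ((j : ℝ) / n)‖ ^ 2 ≤ n * K ^ 2 := by
    refine (Finset.sum_le_card_nsmul _ _ (K ^ 2) fun j _ => ?_).trans (by simp)
    have hj : ((j : ℕ) : ℝ) ≤ n := by exact_mod_cast j.2.le
    exact pow_le_pow_left₀ (norm_nonneg _)
      (hK _ ⟨by positivity, div_le_one_of_le₀ hj (by positivity)⟩) 2
  have h2 : ‖a‖ ^ 2 ≤ n / κ * K ^ 2 := by
    rw [div_mul_eq_mul_div, le_div_iff₀ hκ, mul_comm]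
    exact (h a).trans h1
  calc ‖a‖ = √(‖a‖ ^ 2) := (Real.sqrt_sq (norm_nonneg _)).symm
    _ ≤ √(n / κ * K ^ 2) := Real.sqrt_le_sqrt h2
    _ = _ := by rw [Real.sqrt_mul (by positivity), Real.sqrt_sq hK0]

/-- A polynomial of degree less than `n` that is `O(h ^ (n - 1))` on `[0, h]` has bounded
coefficients. -/
theorem exists_polyBound_of_small [FiniteDimensional ℝ E] (n : ℕ) (K : ℝ) :
    ∃ C : ℝ, ∀ h : ℝ, 0 < h → h ≤ 1 → ∀ f : ℝ → E, IsPoly (n + 1) f →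
      (∀ t ∈ Icc (0 : ℝ) h, ‖f t‖ ≤ K * h ^ n) → PolyBound (n + 1) C f := by
  obtain ⟨C, hC, H⟩ := exists_coeff_bound (E := E) (n + 1)
  refine ⟨C * K, ?_⟩
  rintro h h0 h1 _ ⟨a, rfl⟩ hf
  have hK : 0 ≤ K := by
    have := (norm_nonneg _).trans (hf 0 ⟨le_rfl, h0.le⟩)
    exact nonneg_of_mul_nonneg_left this (by positivity)
  -- Rescaling `[0, h]` to `[0, 1]` turns the coefficients into `h ^ k • a k`. Each of them is at
  -- most `C * K * h ^ n`, and `k ≤ n` allows division by `h ^ k`.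
  have := H (fun k => h ^ (k : ℕ) • a k) (K * h ^ n) fun t ht => by
    have e : pval (fun k => h ^ (k : ℕ) • a k) t = pval a (h * t) := by
      simp [pval, smul_smul, mul_pow, mul_comm]
    rw [e]
    exact hf _ ⟨mul_nonneg h0.le ht.1, mul_le_of_le_one_right h0.le ht.2⟩
  refine ⟨a, (pi_norm_le_iff_of_nonneg (by positivity)).2 fun k => ?_, rfl⟩
  have h2 := (norm_le_pi_norm (fun k : Fin (n + 1) => h ^ (k : ℕ) • a k) k).trans this
  rw [norm_smul, norm_pow, Real.norm_of_nonneg h0.le] at h2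
  have h3 : h ^ n ≤ h ^ (k : ℕ) := pow_le_pow_of_le_one h0.le h1 (Nat.lt_succ_iff.1 k.2)
  have h4 : h ^ n * ‖a k‖ ≤ h ^ n * (C * K) :=
    (mul_le_mul_of_nonneg_right h3 (norm_nonneg _)).trans (h2.trans_eq (by ring))
  exact le_of_mul_le_mul_left h4 (by positivity)

end Polynomials

/-! ### Exactness and coercivity of the quadrature rule -/

namespace QuadratureRule

variable {E : Type*} [NormedAddCommGroup E] [NormedSpace ℝ E]

/-- The rule integrates the monomials of degree at most `N` exactly. -/
def ExactTo (R : QuadratureRule) (N : ℕ) : Prop :=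
  ∀ k ≤ N, ∑ i, R.b i * R.c i ^ k = 1 / ((k : ℝ) + 1)

/-- On `t ^ k` the quadrature error is exactly `c * h ^ (k + 1)`. Being `O(h ^ (u + 1))` with `k <
u` forces `c = 0`. -/
theorem HasOrder.moment {R : QuadratureRule} {u : ℕ} (hu : R.HasOrder u) {k : ℕ} (hk : k < u) :
    ∑ i, R.b i * R.c i ^ k = 1 / ((k : ℝ) + 1) := by
  have h := hu (fun t => t ^ k) (by fun_prop)
  set c : ℝ := 1 / ((k : ℝ) + 1) - ∑ i, R.b i * R.c i ^ k with hc
  have e : (fun h : ℝ => (∫ t in (0 : ℝ)..h, t ^ k) - h * ∑ i, R.b i * (h * R.c i) ^ k)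
      = fun h => c * h ^ (k + 1) := by
    ext h
    rw [integral_pow, hc]
    have : ∑ i, R.b i * (h * R.c i) ^ k = h ^ k * ∑ i, R.b i * R.c i ^ k := by
      rw [Finset.mul_sum]; exact Finset.sum_congr rfl fun i _ => by rw [mul_pow]; ring
    rw [this, zero_pow (by omega)]
    ring
  rw [e] at h
  obtain ⟨M, hM⟩ := h.bound
  have hlim : Tendsto (fun h : ℝ => M * h ^ (u - k)) (𝓝[>] 0) (𝓝 0) := by
    have : Continuous fun h : ℝ => M * h ^ (u - k) := by fun_prop
    have h2 := this.tendsto 0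
    rw [zero_pow (by omega), mul_zero] at h2
    exact h2.mono_left nhdsWithin_le_nhds
  have : |c| ≤ 0 := by
    refine ge_of_tendsto hlim ?_
    filter_upwards [hM, self_mem_nhdsWithin] with h hh h0
    have h0 : 0 < h := h0
    rw [norm_mul, norm_pow, norm_pow, Real.norm_of_nonneg h0.le, Real.norm_eq_abs,
      show h ^ (u + 1) = h ^ (u - k) * h ^ (k + 1) by rw [← pow_add]; congr 1; omega,
      ← mul_assoc] at hh
    exact le_of_mul_le_mul_right hh (pow_pos h0 (k + 1))
  have : c = 0 := abs_eq_zero.1 (le_antisymm this (abs_nonneg _))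
  linarith

/-- For `2 ≤ l` the degree is `2l - 3`, below the order. For `l = 1` truncation makes it `0`, where
the order may be zero too and only the normalisation of the weights is available. -/
theorem HasOrder.exactTo {R : QuadratureRule} {l u : ℕ} (hu : R.HasOrder u) (hl : 1 ≤ l)
    (hlu : 2 * l ≤ u + 2) : R.ExactTo (l - 2 + (l - 1)) := by
  intro k hk
  rcases Nat.eq_zero_or_pos k with rfl | hk0
  · simpa using R.sum_b
  · exact hu.moment (by omega)

/-- The derivative has degree at most `N`, so the rule integrates it exactly. This fundamental
theorem of calculus for the rule is what permits the integration by parts in `galerkin_estimate`. -/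
theorem ExactTo.sum_deriv {R : QuadratureRule} {N : ℕ} (hR : R.ExactTo N) {f : ℝ → E}
    (hf : IsPoly (N + 2) f) (δ β : ℝ) :
    δ • ∑ i, R.b i • deriv f (β + R.c i * δ) = f (β + δ) - f β := by
  have key : ∀ a : Fin (N + 2) → E, ∑ i, R.b i • deriv (pval a) (R.c i) = pval a 1 - pval a 0 := by
    intro a
    rw [deriv_pval, pval_succ a 1, pval_succ a 0, one_smul, zero_smul, add_zero,
      add_sub_cancel_left]
    simp only [pval, dcoef, Finset.smul_sum, one_pow, one_smul]
    rw [Finset.sum_comm]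
    refine Finset.sum_congr rfl fun k _ => ?_
    simp_rw [smul_smul]
    rw [← Finset.sum_smul, show ∑ i, R.b i * (R.c i ^ (k : ℕ) * ((k : ℝ) + 1))
      = (∑ i, R.b i * R.c i ^ (k : ℕ)) * ((k : ℝ) + 1) by
        rw [Finset.sum_mul]; exact Finset.sum_congr rfl fun i _ => by ring,
      hR k (by omega)]
    have : ((k : ℕ) : ℝ) + 1 ≠ 0 := by positivity
    rw [one_div_mul_cancel this, one_smul]
  obtain ⟨a, ha⟩ := hf.comp_affine δ β
  have h := key a
  rw [← ha] at h
  simp only [mul_one, mul_zero, add_zero] at h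
  rw [← h, Finset.smul_sum]
  refine Finset.sum_congr rfl fun i _ => ?_
  have hd : HasDerivAt (fun s => f (β + δ * s)) (δ • deriv f (β + δ * R.c i)) (R.c i) := by
    have h1 : HasDerivAt (fun s => β + δ * s) δ (R.c i) := by
      simpa using ((hasDerivAt_id (R.c i)).const_mul δ).const_add β
    exact HasDerivAt.scomp (R.c i) (hf.differentiable _).hasDerivAt h1
  rw [hd.deriv, smul_comm, mul_comm δ]

/-- Coercivity of the discrete energy on vector valued polynomials, for an energy form that is a
sum of squares of linear functionals separating points. -/
theorem IsDefinite.exists_coercive [FiniteDimensional ℝ E] {R : QuadratureRule} {l : ℕ}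
    (hl : 1 ≤ l) (hdef : R.IsDefinite l) (B : E →L[ℝ] E →L[ℝ] ℝ) {ι : Type*} [Fintype ι]
    (φ : ι → E →L[ℝ] ℝ) (hB : ∀ v w, B v w = ∑ k, φ k v * φ k w)
    (hφ : ∀ v, (∀ k, φ k v = 0) → v = 0) :
    ∃ κ > 0, ∀ w : ℝ → E, IsPoly l w → ∀ t ∈ Icc (0 : ℝ) 1,
      κ * ‖w t‖ ^ 2 ≤ ∑ i, R.b i * B (w (R.c i)) (w (R.c i)) := by
  -- The form splits into scalar energies of the coordinates `φ k`, and definiteness applies to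
  -- each. The weights may be negative, so there is no positivity node by node.
  have e : ∀ a : Fin l → E, ∑ i, R.b i * B (pval a (R.c i)) (pval a (R.c i))
      = ∑ k, ∑ i, R.b i * ((coordPoly (φ k) a).eval (R.c i)) ^ 2 := by
    intro a
    rw [Finset.sum_comm]
    refine Finset.sum_congr rfl fun i _ => ?_
    rw [hB, Finset.mul_sum]
    exact Finset.sum_congr rfl fun k _ => by rw [eval_coordPoly]; ring
  have hpos : ∀ k (a : Fin l → E), coordPoly (φ k) a ≠ 0 →
      0 < ∑ i, R.b i * ((coordPoly (φ k) a).eval (R.c i)) ^ 2 := fun k a h =>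
    hdef _ h (natDegree_coordPoly hl _ _)
  obtain ⟨κ, hκ, h⟩ := Multirate.exists_coercive (E := Fin l → E)
    (fun a => ∑ i, R.b i * B (pval a (R.c i)) (pval a (R.c i)))
    (by unfold pval; fun_prop)
    (fun c a => by
      rw [Finset.mul_sum]
      refine Finset.sum_congr rfl fun i _ => ?_
      simp only [pval_smul, map_smul, _root_.smul_apply, smul_eq_mul]
      ring)
    (fun a ha => by
      rw [e]
      have : ∃ k, coordPoly (φ k) a ≠ 0 := by
        by_contra! hz
        refine ha (funext fun j => hφ _ fun k => ?_)
        rw [← coeff_coordPoly, hz k, Polynomial.coeff_zero]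
      obtain ⟨k, hk⟩ := this
      refine Finset.sum_pos' (fun k' _ => ?_) ⟨k, Finset.mem_univ _, hpos k a hk⟩
      by_cases h0 : coordPoly (φ k') a = 0
      · simp [h0]
      · exact (hpos k' a h0).le)
  refine ⟨κ / l ^ 2, by positivity, ?_⟩
  rintro _ ⟨a, rfl⟩ t ht
  refine le_trans ?_ (h a)
  have h1 := pow_le_pow_left₀ (norm_nonneg _) (norm_pval_le a ht) 2
  have hl' : (0 : ℝ) < l := by exact_mod_cast hl
  rw [div_mul_eq_mul_div, div_le_iff₀ (by positivity)]
  calc κ * ‖pval a t‖ ^ 2 ≤ κ * (l * ‖a‖) ^ 2 := by gcongr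
    _ = _ := by ring

end QuadratureRule

end Multirate

namespace Multirate

/-! ### Uniform Taylor expansion, quadrature error and approximate solutions -/

section Taylor

variable {E F P : Type*} [NormedAddCommGroup E] [NormedSpace ℝ E]
  [NormedAddCommGroup F] [NormedSpace ℝ F] [NormedAddCommGroup P] [NormedSpace ℝ P]

/-- The coefficients of a primitive, without the constant term. -/
noncomputable def icoef {n : ℕ} (a : Fin n → E) : Fin n → E := fun k => (1 / ((k : ℝ) + 1)) • a k

theorem norm_icoef_le {n : ℕ} (a : Fin n → E) : ‖icoef a‖ ≤ ‖a‖ := by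
  refine (pi_norm_le_iff_of_nonneg (norm_nonneg _)).2 fun k => ?_
  rw [icoef, norm_smul, Real.norm_of_nonneg (by positivity)]
  refine (mul_le_of_le_one_left (norm_nonneg _) ?_).trans (norm_le_pi_norm a k)
  rw [div_le_one (by positivity)]
  linarith [Nat.cast_nonneg (α := ℝ) (k : ℕ)]

theorem dcoef_cons_icoef {n : ℕ} (c : E) (a : Fin n → E) :
    dcoef (Fin.cons c (icoef a) : Fin (n + 1) → E) = a := by
  ext k
  have : ((k : ℕ) : ℝ) + 1 ≠ 0 := by positivity
  simp [dcoef, icoef, smul_smul, this]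

theorem norm_cons_le {E : Type*} [NormedAddCommGroup E] {n : ℕ} {c : E} {a : Fin n → E} {K : ℝ} (hc : ‖c‖ ≤ K) (ha : ‖a‖ ≤ K) :
    ‖(Fin.cons c a : Fin (n + 1) → E)‖ ≤ K := by
  refine (pi_norm_le_iff_of_nonneg ((norm_nonneg _).trans hc)).2 fun k => ?_
  refine Fin.cases ?_ (fun k => ?_) k
  · simpa using hc
  · simpa using (norm_le_pi_norm a k).trans ha

theorem norm_sub_le_of_deriv_le {f f' : ℝ → E} {a b K : ℝ}
    (hf : ∀ t ∈ Icc a b, HasDerivAt f (f' t) t) (hK : ∀ t ∈ Icc a b, ‖f' t‖ ≤ K)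
    {s t : ℝ} (hs : s ∈ Icc a b) (ht : t ∈ Icc a b) : ‖f t - f s‖ ≤ K * |t - s| := by
  simpa using Convex.norm_image_sub_le_of_norm_hasDerivWithin_le
    (fun x hx => (hf x hx).hasDerivWithinAt) hK (convex_Icc a b) hs ht

/-- Taylor expansion at `0` of a smooth family of functions of one variable, uniformly over
bounded sets of parameters. -/
theorem exists_taylor [FiniteDimensional ℝ P] (C : ℝ) (n : ℕ) (Ψ : P × ℝ → F)
    (hΨ : ContDiff ℝ ∞ Ψ) :
    ∃ K, 0 ≤ K ∧ ∀ α, ‖α‖ ≤ C → ∃ a : Fin n → F, ‖a‖ ≤ K ∧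
      ∀ t ∈ Icc (0 : ℝ) 1, ‖Ψ (α, t) - pval a t‖ ≤ K * t ^ n := by
  have hbd : ∀ Ψ : P × ℝ → F, ContDiff ℝ ∞ Ψ → ∃ K, 0 ≤ K ∧ ∀ α, ‖α‖ ≤ C →
      ∀ t ∈ Icc (0 : ℝ) 1, ‖Ψ (α, t)‖ ≤ K := by
    intro Ψ hΨ
    obtain ⟨K, hK⟩ := ((isCompact_closedBall (0 : P) C).prod
      (isCompact_Icc (a := (0 : ℝ)) (b := 1))).exists_bound_of_continuousOn hΨ.continuous.continuousOn
    refine ⟨max K 0, le_max_right _ _, fun α hα t ht => (hK (α, t) ⟨?_, ht⟩).trans (le_max_left _ _)⟩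
    simpa using hα
  induction n generalizing Ψ with
  | zero =>
    obtain ⟨K, hK0, hK⟩ := hbd Ψ hΨ
    exact ⟨K, hK0, fun α hα => ⟨0, norm_zero.trans_le hK0, fun t ht => by
      simpa [pval] using hK α hα t ht⟩⟩
  | succ n ih =>
    obtain ⟨K₀, hK₀, hb⟩ := hbd Ψ hΨ
    -- The time derivative is again a smooth family, so its expansion is available by induction and
    -- is integrated from `0`.
    obtain ⟨K, hK, H⟩ := ih (fun z => fderiv ℝ Ψ z (0, 1))
      ((hΨ.fderiv_right (m := ∞) le_rfl).clm_apply contDiff_const)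
    refine ⟨K + K₀, by positivity, fun α hα => ?_⟩
    obtain ⟨a, ha, hat⟩ := H α hα
    refine ⟨Fin.cons (Ψ (α, 0)) (icoef a), norm_cons_le ((hb α hα 0 (by simp)).trans (by linarith))
      ((norm_icoef_le a).trans (ha.trans (by linarith))), fun t ht => ?_⟩
    have hd : ∀ s, HasDerivAt (fun s => Ψ (α, s) - pval (Fin.cons (Ψ (α, 0)) (icoef a) : Fin (n + 1) → F) s)
        (fderiv ℝ Ψ (α, s) (0, 1) - pval a s) s := by
      intro s
      have h1 : HasDerivAt (fun s : ℝ => (α, s)) (0, 1) s :=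
        (hasDerivAt_const s α).prodMk (hasDerivAt_id s)
      have h2 := ((hΨ.differentiable (by simp)) (α, s)).hasFDerivAt.comp_hasDerivAt s h1
      have h3 := hasDerivAt_pval (Fin.cons (Ψ (α, 0)) (icoef a) : Fin (n + 1) → F) s
      rw [dcoef_cons_icoef] at h3
      exact h2.sub h3
    have := norm_sub_le_of_deriv_le (a := 0) (b := t) (K := K * t ^ n) (fun s _ => hd s)
      (fun s hs => (hat s ⟨hs.1, hs.2.trans ht.2⟩).trans
        (mul_le_mul_of_nonneg_left (pow_le_pow_left₀ hs.1 hs.2 n) hK))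
      (left_mem_Icc.2 ht.1) (right_mem_Icc.2 ht.1)
    have e : pval (Fin.cons (Ψ (α, 0)) (icoef a) : Fin (n + 1) → F) 0 = Ψ (α, 0) := by
      rw [pval_succ]; simp
    simp only [e, sub_self, sub_zero, abs_of_nonneg ht.1] at this
    refine this.trans ?_
    rw [pow_succ, mul_assoc]
    exact mul_le_mul_of_nonneg_right (by linarith) (mul_nonneg (pow_nonneg ht.1 n) ht.1)

theorem integral_pval {n : ℕ} (a : Fin n → ℝ) (h : ℝ) :
    ∫ t in (0 : ℝ)..h, pval a t = ∑ k : Fin n, h ^ ((k : ℕ) + 1) / ((k : ℝ) + 1) * a k := by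
  simp only [pval, smul_eq_mul]
  rw [intervalIntegral.integral_finsetSum fun (k : Fin n) _ =>
    (by fun_prop : Continuous fun t : ℝ => t ^ (k : ℕ) * a k).intervalIntegrable _ _]
  refine Finset.sum_congr rfl fun k _ => ?_
  rw [intervalIntegral.integral_mul_const, integral_pow, zero_pow (by omega), sub_zero]

theorem QuadratureRule.HasOrder.quadrature_pval {R : QuadratureRule} {u : ℕ} (hu : R.HasOrder u)
    (a : Fin u → ℝ) (h : ℝ) :
    h * ∑ i, R.b i * pval a (R.c i * h) = ∫ t in (0 : ℝ)..h, pval a t := by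
  rw [integral_pval]
  simp only [pval, smul_eq_mul, Finset.mul_sum]
  rw [Finset.sum_comm]
  refine Finset.sum_congr rfl fun k _ => ?_
  rw [div_eq_mul_one_div, ← hu.moment k.2, Finset.mul_sum, Finset.sum_mul]
  refine Finset.sum_congr rfl fun i _ => ?_
  ring

/-- The quadrature error on a smooth family of functions is uniformly `O(h ^ (u + 1))` over bounded
sets of parameters. -/
theorem QuadratureRule.HasOrder.exists_error_bound [FiniteDimensional ℝ P] {R : QuadratureRule}
    {u : ℕ} (hu : R.HasOrder u) (C : ℝ) (Ψ : P × ℝ → ℝ) (hΨ : ContDiff ℝ ∞ Ψ) :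
    ∃ K, 0 ≤ K ∧ ∀ α, ‖α‖ ≤ C → ∀ h, 0 < h → h ≤ 1 →
      |(∫ t in (0 : ℝ)..h, Ψ (α, t)) - h * ∑ i, R.b i * Ψ (α, R.c i * h)| ≤ K * h ^ (u + 1) := by
  obtain ⟨K, hK, H⟩ := exists_taylor C u Ψ hΨ
  refine ⟨K * (1 + ∑ i, |R.b i|), by positivity, fun α hα h h0 h1 => ?_⟩
  obtain ⟨a, -, ha⟩ := H α hα
  have hcont : Continuous fun t => Ψ (α, t) := hΨ.continuous.comp (by fun_prop)
  have hle : ∀ t ∈ Icc 0 h, ‖Ψ (α, t) - pval a t‖ ≤ K * h ^ u := fun t ht =>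
    (ha t ⟨ht.1, ht.2.trans h1⟩).trans
      (mul_le_mul_of_nonneg_left (pow_le_pow_left₀ ht.1 ht.2 u) hK)
  -- The Taylor polynomial has degree less than `u` and is integrated exactly. Only the remainder,
  -- `O(h ^ u)` at every point, enters the integral and the sum.
  have e : (∫ t in (0 : ℝ)..h, Ψ (α, t)) - h * ∑ i, R.b i * Ψ (α, R.c i * h)
      = (∫ t in (0 : ℝ)..h, (Ψ (α, t) - pval a t))
        - h * ∑ i, R.b i * (Ψ (α, R.c i * h) - pval a (R.c i * h)) := by
    rw [intervalIntegral.integral_sub (hcont.intervalIntegrable _ _)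
      ((continuous_pval a).intervalIntegrable _ _), ← hu.quadrature_pval]
    simp only [mul_sub, Finset.sum_sub_distrib]
    ring
  have e1 : |∫ t in (0 : ℝ)..h, (Ψ (α, t) - pval a t)| ≤ K * h ^ u * h := by
    have := intervalIntegral.norm_integral_le_of_norm_le_const (a := 0) (b := h)
      (f := fun t => Ψ (α, t) - pval a t) (C := K * h ^ u) fun t ht => hle t (by
        rw [uIoc_of_le h0.le] at ht; exact ⟨ht.1.le, ht.2⟩)
    simpa [abs_of_pos h0] using this
  have e2 : |∑ i, R.b i * (Ψ (α, R.c i * h) - pval a (R.c i * h))| ≤ (∑ i, |R.b i|) * (K * h ^ u) := by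
    rw [Finset.sum_mul]
    refine (Finset.abs_sum_le_sum_abs _ _).trans (Finset.sum_le_sum fun i _ => ?_)
    rw [abs_mul]
    have hc := R.c_mem i
    exact mul_le_mul_of_nonneg_left
      (hle _ ⟨mul_nonneg hc.1 h0.le, mul_le_of_le_one_left h0.le hc.2⟩) (abs_nonneg _)
  rw [e]
  refine (abs_sub _ _).trans ?_
  rw [abs_mul, abs_of_pos h0]
  calc _ ≤ K * h ^ u * h + h * ((∑ i, |R.b i|) * (K * h ^ u)) := by gcongr
    _ = _ := by ring

/-- A curve vanishing at both ends is controlled by its second derivative. -/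
theorem norm_le_of_second_deriv_le {d d' d'' : ℝ → E} {h ε : ℝ} (h0 : 0 < h)
    (hd : ∀ t ∈ Icc 0 h, HasDerivAt d (d' t) t) (hd' : ∀ t ∈ Icc 0 h, HasDerivAt d' (d'' t) t)
    (hε : ∀ t ∈ Icc 0 h, ‖d'' t‖ ≤ ε) (hd0 : d 0 = 0) (hdh : d h = 0) :
    ∀ t ∈ Icc 0 h, ‖d' t‖ ≤ 2 * h * ε ∧ ‖d t‖ ≤ 2 * h ^ 2 * ε := by
  have m0 : (0 : ℝ) ∈ Icc 0 h := left_mem_Icc.2 h0.le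
  have mh : h ∈ Icc 0 h := right_mem_Icc.2 h0.le
  have hε0 : 0 ≤ ε := (norm_nonneg _).trans (hε 0 m0)
  have habs : ∀ t ∈ Icc 0 h, |t - 0| ≤ h := fun t ht => by
    rw [sub_zero, abs_of_nonneg ht.1]; exact ht.2
  have s1 : ∀ t ∈ Icc 0 h, ‖d' t - d' 0‖ ≤ ε * h := fun t ht =>
    (norm_sub_le_of_deriv_le hd' hε m0 ht).trans (mul_le_mul_of_nonneg_left (habs t ht) hε0)
  -- The derivative stays within `ε * h` of `d' 0`, while `d` returns to zero. Hence `h • d' 0` is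
  -- at most `ε * h` times `h` in norm.
  have s2 : ‖d' 0‖ ≤ ε * h := by
    have := norm_sub_le_of_deriv_le (f := fun t => d t - t • d' 0) (f' := fun t => d' t - d' 0)
      (fun t ht => by
        have := (hd t ht).sub ((hasDerivAt_id t).smul_const (d' 0))
        rwa [one_smul] at this) s1 m0 mh
    simp only [hd0, hdh, zero_smul, zero_sub, sub_zero, norm_neg, norm_smul,
      Real.norm_eq_abs, abs_of_pos h0] at this
    exact le_of_mul_le_mul_left (this.trans_eq (mul_comm _ _)) h0
  have s3 : ∀ t ∈ Icc 0 h, ‖d' t‖ ≤ 2 * h * ε := fun t ht => by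
    have := norm_add_le (d' t - d' 0) (d' 0)
    rw [sub_add_cancel] at this
    linarith [s1 t ht]
  refine fun t ht => ⟨s3 t ht, ?_⟩
  have := norm_sub_le_of_deriv_le hd s3 m0 ht
  rw [hd0, sub_zero] at this
  refine this.trans ((mul_le_mul_of_nonneg_left (habs t ht) (by positivity)).trans_eq (by ring))

/-- The polynomial with prescribed second derivative and end points. -/
theorem exists_second_primitive {j : ℕ} (φ : Fin j → E) {h C K : ℝ} (h0 : 0 < h) (h1 : h ≤ 1)
    (hφ : ‖φ‖ ≤ K) {y₀ y₁ : E} (hy₀ : ‖y₀‖ ≤ C) (hy : ‖y₁ - y₀‖ ≤ C * h) :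
    ∃ Y : ℝ → E, PolyBound (j + 2) (C + (j + 1) * K) Y ∧ Y 0 = y₀ ∧ Y h = y₁ ∧
      deriv (deriv Y) = pval φ := by
  have hK : 0 ≤ K := (norm_nonneg _).trans hφ
  have hC : 0 ≤ C := (norm_nonneg _).trans hy₀
  set ψ : Fin j → E := fun k => icoef (Fin.cons 0 (icoef φ) : Fin (j + 1) → E) k.succ with hψ
  have hψn : ‖ψ‖ ≤ K := by
    refine (pi_norm_le_iff_of_nonneg hK).2 fun k => (norm_le_pi_norm
      (icoef (Fin.cons 0 (icoef φ) : Fin (j + 1) → E)) k.succ).trans ((norm_icoef_le _).trans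
      (norm_cons_le (by simpa using hK) ((norm_icoef_le _).trans hφ)))
  -- The curve is `y₀ + t • v + t ^ 2 • ψ t`, and `v` is the initial velocity that makes it hit `y₁`
  -- at time `h`. It stays bounded because `y₁ - y₀` is `O(h)`.
  set v : E := h⁻¹ • (y₁ - y₀) - h • pval ψ h with hv
  have hvn : ‖v‖ ≤ C + j * K := by
    refine (norm_sub_le _ _).trans (add_le_add ?_ ?_)
    · rw [norm_smul, norm_inv, Real.norm_of_nonneg h0.le, inv_mul_le_iff₀ h0, mul_comm]
      exact hy
    · rw [norm_smul, Real.norm_of_nonneg h0.le]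
      refine (mul_le_of_le_one_left (norm_nonneg _) h1).trans
        ((norm_pval_le ψ ⟨h0.le, h1⟩).trans ?_)
      gcongr
  set a : Fin (j + 2) → E := Fin.cons y₀ (icoef (Fin.cons v (icoef φ) : Fin (j + 1) → E)) with ha
  refine ⟨pval a, ⟨a, ?_, rfl⟩, ?_, ?_, ?_⟩
  · refine norm_cons_le (hy₀.trans (by nlinarith [Nat.cast_nonneg (α := ℝ) j]))
      ((norm_icoef_le _).trans (norm_cons_le (hvn.trans (by linarith))
        ((norm_icoef_le _).trans (hφ.trans (by nlinarith [Nat.cast_nonneg (α := ℝ) j])))))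
  · rw [pval_succ]; simp [ha]
  · rw [pval_succ, pval_succ]
    have e : (fun k : Fin j => (fun k : Fin (j + 1) => a k.succ) k.succ) = ψ := by
      ext k; simp [ha, hψ, icoef]
    have e0 : a (Fin.succ 0) = v := by simp [ha, icoef]
    rw [e]
    simp only [e0]
    rw [show a 0 = y₀ by simp [ha], hv, sub_add_cancel, smul_smul, mul_inv_cancel₀ h0.ne', one_smul,
      add_sub_cancel]
  · rw [deriv_pval, ha, dcoef_cons_icoef, deriv_pval, dcoef_cons_icoef]

/-- Polynomials with given end points that satisfy a second order equation up to `O(h ^ j)`. -/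
theorem exists_formal_solution [FiniteDimensional ℝ E] [FiniteDimensional ℝ P]
    (f : P → ℝ → E → E) (hf : ContDiff ℝ ∞ fun z : P × ℝ × E => f z.1 z.2.1 z.2.2) {C L : ℝ}
    (hL : 0 ≤ L)
    (hLip : ∀ α t y y', ‖f α t y - f α t y'‖ ≤ L * ‖y - y'‖) (j : ℕ) :
    ∃ K, 0 ≤ K ∧ ∀ α, ‖α‖ ≤ C → ∀ h, 0 < h → h ≤ 1 → ∀ y₀ y₁ : E, ‖y₀‖ ≤ C → ‖y₁ - y₀‖ ≤ C * h →
      ∃ Y : ℝ → E, PolyBound (j + 2) K Y ∧ Y 0 = y₀ ∧ Y h = y₁ ∧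
        ∀ t ∈ Icc 0 h, ‖f α t (Y t) - deriv (deriv Y) t‖ ≤ K * h ^ j := by
  -- Expands the force along a polynomial curve. The coefficients of the curve join the parameter,
  -- so the bound is uniform over all curves with bounded coefficients.
  have hT : ∀ (n m : ℕ) (D : ℝ), ∃ K, 0 ≤ K ∧ ∀ α : P, ‖α‖ ≤ C → ∀ Y : ℝ → E, PolyBound m D Y →
      ∃ φ : Fin n → E, ‖φ‖ ≤ K ∧ ∀ t ∈ Icc (0 : ℝ) 1, ‖f α t (Y t) - pval φ t‖ ≤ K * t ^ n := by
    intro n m D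
    have hs : ContDiff ℝ ∞ fun z : (P × (Fin m → E)) × ℝ => f z.1.1 z.2 (pval z.1.2 z.2) := by
      refine hf.comp (g := fun z : P × ℝ × E => f z.1 z.2.1 z.2.2)
        (f := fun z : (P × (Fin m → E)) × ℝ => (z.1.1, z.2, pval z.1.2 z.2)) ?_
      unfold pval
      fun_prop
    obtain ⟨K, hK, H⟩ := exists_taylor (max C D) n _ hs
    refine ⟨K, hK, ?_⟩
    rintro α hα _ ⟨a, ha, rfl⟩
    obtain ⟨φ, hφ, h⟩ := H (α, a)
      (max_le (hα.trans (le_max_left _ _)) (ha.trans (le_max_right _ _)))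
    exact ⟨φ, hφ, h⟩
  induction j with
  | zero =>
    obtain ⟨K, hK, H⟩ := hT 0 2 (C + (0 + 1) * 0)
    refine ⟨K + |C|, by positivity, fun α hα h h0 h1 y₀ y₁ hy₀ hy => ?_⟩
    obtain ⟨Y, hY, hY0, hYh, hY2⟩ := exists_second_primitive (K := 0) (0 : Fin 0 → E) h0 h1
      (by simp) hy₀ hy
    simp only [Nat.cast_zero] at hY
    refine ⟨Y, hY.weaken (by linarith [le_abs_self C]), hY0, hYh, fun t ht => ?_⟩
    obtain ⟨φ, -, hφ⟩ := H α hα Y hY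
    have := hφ t ⟨ht.1, ht.2.trans h1⟩
    rw [hY2]
    simp only [pval, Finset.univ_eq_empty, Finset.sum_empty, pow_zero, mul_one] at this ⊢
    linarith [abs_nonneg C]
  | succ j ih =>
    obtain ⟨K, hK, H⟩ := ih
    obtain ⟨K₁, hK₁, H₁⟩ := hT (j + 1) (j + 2) K
    have hM : 0 ≤ (↑(j + 1) + 1 : ℝ) * K₁ := by positivity
    refine ⟨|C| + (↑(j + 1) + 1) * K₁ + L * (2 * (K₁ + K)) + K₁, by positivity,
      fun α hα h h0 h1 y₀ y₁ hy₀ hy => ?_⟩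
    obtain ⟨Y, hY, hY0, hYh, hYr⟩ := H α hα h h0 h1 y₀ y₁ hy₀ hy
    obtain ⟨φ, hφ, hφr⟩ := H₁ α hα Y hY
    -- One Picard step: the second derivative of `Z` is the truncated expansion of the force along
    -- `Y`. It differs from that of `Y` by `O(h ^ j)`, so `Z - Y` gains two powers of `h`, and by
    -- the Lipschitz bound the residual of `Z` is one order better.
    obtain ⟨Z, hZ, hZ0, hZh, hZ2⟩ := exists_second_primitive φ h0 h1 hφ hy₀ hy
    have hLK : 0 ≤ L * (2 * (K₁ + K)) := by positivity
    refine ⟨Z, hZ.weaken (by linarith [le_abs_self C]), hZ0, hZh, fun t ht => ?_⟩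
    have hφr' : ∀ t ∈ Icc 0 h, ‖f α t (Y t) - pval φ t‖ ≤ K₁ * h ^ (j + 1) := fun t ht =>
      (hφr t ⟨ht.1, ht.2.trans h1⟩).trans
        (mul_le_mul_of_nonneg_left (pow_le_pow_left₀ ht.1 ht.2 _) hK₁)
    have hpow : h ^ (j + 1) ≤ h ^ j := pow_le_pow_of_le_one h0.le h1 (Nat.le_succ j)
    have hd : ∀ t ∈ Icc 0 h, ‖Z t - Y t‖ ≤ 2 * h ^ 2 * ((K₁ + K) * h ^ j) := by
      refine fun t ht => (norm_le_of_second_deriv_le (d := fun t => Z t - Y t)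
        (d' := fun t => deriv Z t - deriv Y t)
        (d'' := fun t => deriv (deriv Z) t - deriv (deriv Y) t) h0 (fun t _ => ?_) (fun t _ => ?_)
        (fun t ht => ?_) (by simp [hZ0, hY0]) (by simp [hZh, hYh]) t ht).2
      · exact (hZ.isPoly.differentiable t).hasDerivAt.sub (hY.isPoly.differentiable t).hasDerivAt
      · exact (hZ.isPoly.deriv.differentiable t).hasDerivAt.sub
          (hY.isPoly.deriv.differentiable t).hasDerivAt
      · have e : deriv (deriv Z) t - deriv (deriv Y) t
            = (f α t (Y t) - deriv (deriv Y) t) - (f α t (Y t) - pval φ t) := by rw [hZ2]; abel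
        rw [e]
        refine (norm_sub_le _ _).trans ((add_le_add (hYr t ht) (hφr' t ht)).trans ?_)
        nlinarith
    have e : f α t (Z t) - deriv (deriv Z) t
        = (f α t (Z t) - f α t (Y t)) + (f α t (Y t) - pval φ t) := by rw [hZ2]; abel
    rw [e]
    refine (norm_add_le _ _).trans ((add_le_add ((hLip _ _ _ _).trans
      (mul_le_mul_of_nonneg_left (hd t ht) hL)) (hφr' t ht)).trans ?_)
    have h2 : 2 * h ^ 2 * ((K₁ + K) * h ^ j) ≤ 2 * (K₁ + K) * h ^ (j + 1) := by
      have : 2 * h ^ 2 * ((K₁ + K) * h ^ j) = h * (2 * (K₁ + K) * h ^ (j + 1)) := by ring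
      rw [this]
      exact mul_le_of_le_one_left (by positivity) h1
    have h3 := mul_le_mul_of_nonneg_left h2 hL
    have h4 : 0 ≤ (|C| + (↑(j + 1) + 1) * K₁) * h ^ (j + 1) := by positivity
    nlinarith

end Taylor

end Multirate

namespace Multirate

/-! ### Stability of the Galerkin equations -/

section Galerkin

variable {E : Type*} [NormedAddCommGroup E] [NormedSpace ℝ E]

/-- Continuity turns the sum into a telescoping sum of node values; no piece starts at the last
node, so `y` stands in there. Applied to curves, to boundary terms of integrations by parts, and,
through primitives, to integrals over the pieces. -/
theorem sum_pieces_telescope {F : Type*} [AddCommGroup F] {p : ℕ} (hp : 1 ≤ p) (G : Fin p → ℝ → F)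
    {δ h : ℝ} (hδ : p * δ = h) {x y : F}
    (hcont : ∀ m m' : Fin p, (m' : ℕ) = (m : ℕ) + 1 → G m ((m' : ℕ) * δ) = G m' ((m' : ℕ) * δ))
    (h0 : ∀ m : Fin p, (m : ℕ) = 0 → G m 0 = x) (h1 : ∀ m : Fin p, (m : ℕ) + 1 = p → G m h = y) :
    ∑ m : Fin p, (G m ((m : ℕ) * δ + δ) - G m ((m : ℕ) * δ)) = y - x := by
  set T : ℕ → F := fun k => if hk : k < p then G ⟨k, hk⟩ (k * δ) else y with hT
  have e : ∀ m : Fin p, G m ((m : ℕ) * δ + δ) - G m ((m : ℕ) * δ) = T (m + 1) - T m := by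
    intro m
    have e1 : T m = G m ((m : ℕ) * δ) := by simp [hT]
    have e2 : T (m + 1) = G m ((m : ℕ) * δ + δ) := by
      have ht : (m : ℕ) * δ + δ = ((m + 1 : ℕ) : ℝ) * δ := by push_cast; ring
      by_cases hm : (m : ℕ) + 1 < p
      · simp only [hT, hm, dif_pos]
        rw [ht]
        exact (hcont m ⟨m + 1, hm⟩ rfl).symm
      · have hm' : (m : ℕ) + 1 = p := by have := m.2; omega
        simp only [hT, hm, dif_neg, not_false_eq_true]
        rw [ht, hm', hδ, h1 m hm']
    rw [e1, e2]
  rw [Finset.sum_congr rfl fun m _ => e m, ← Finset.sum_range fun k => T (k + 1) - T k,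
    Finset.sum_range_sub]
  have t0 : T 0 = x := by
    have := h0 ⟨0, hp⟩ rfl
    simp [hT, show 0 < p from hp, this]
  rw [t0]
  simp [hT]

/-- A continuous piecewise smooth curve starting at `0` is bounded by the integral of the bounds
for its velocity on the pieces. -/
theorem norm_piece_le_sum {p : ℕ} (d : Fin p → ℝ → E) {δ : ℝ} (hδ : 0 ≤ δ)
    (hdiff : ∀ m, Differentiable ℝ (d m))
    (hcont : ∀ m m' : Fin p, (m' : ℕ) = (m : ℕ) + 1 → d m ((m' : ℕ) * δ) = d m' ((m' : ℕ) * δ))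
    (h0 : ∀ m : Fin p, (m : ℕ) = 0 → d m 0 = 0) (σ : Fin p → ℝ)
    (hσ : ∀ m : Fin p, ∀ t ∈ Icc ((m : ℕ) * δ) ((m : ℕ) * δ + δ), ‖deriv (d m) t‖ ≤ σ m)
    (m : Fin p) (t : ℝ) (ht : t ∈ Icc ((m : ℕ) * δ) ((m : ℕ) * δ + δ)) :
    ‖d m t‖ ≤ δ * ∑ k, σ k := by
  have hσ0 : ∀ m, 0 ≤ σ m := fun m =>
    (norm_nonneg _).trans (hσ m _ (left_mem_Icc.2 (by linarith)))
  have hstep : ∀ m : Fin p, ∀ t ∈ Icc ((m : ℕ) * δ) ((m : ℕ) * δ + δ),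
      ‖d m t‖ ≤ ‖d m ((m : ℕ) * δ)‖ + δ * σ m := by
    intro m t ht
    have := norm_sub_le_of_deriv_le (fun t _ => (hdiff m t).hasDerivAt) (hσ m)
      (left_mem_Icc.2 (by linarith)) ht
    have h2 : σ m * |t - (m : ℕ) * δ| ≤ δ * σ m := by
      rw [abs_of_nonneg (by linarith [ht.1]), mul_comm]
      exact mul_le_mul_of_nonneg_right (by linarith [ht.2]) (hσ0 m)
    have h3 := norm_add_le (d m t - d m ((m : ℕ) * δ)) (d m ((m : ℕ) * δ))
    rw [sub_add_cancel] at h3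
    linarith
  set s : ℕ → ℝ := fun k => if hk : k < p then σ ⟨k, hk⟩ else 0 with hs
  have hsm : ∀ m : Fin p, s m = σ m := fun m => by simp [hs]
  have hs0 : ∀ k, 0 ≤ s k := fun k => by
    simp only [hs]; split_ifs
    · exact hσ0 _
    · exact le_rfl
  have hnode : ∀ k, ∀ hk : k < p, ‖d ⟨k, hk⟩ (k * δ)‖ ≤ δ * ∑ i ∈ Finset.range k, s i := by
    intro k
    induction k with
    | zero => intro hk; simp [h0 ⟨0, hk⟩ rfl]
    | succ k ih =>
      intro hk
      have hk' : k < p := by omega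
      rw [← hcont ⟨k, hk'⟩ ⟨k + 1, hk⟩ rfl, Finset.sum_range_succ, mul_add]
      refine (hstep ⟨k, hk'⟩ _ ⟨?_, ?_⟩).trans (add_le_add (ih hk') ?_)
      · push_cast; nlinarith
      · push_cast; linarith
      · exact le_of_eq (by rw [← hsm])
  refine (hstep m t ht).trans ?_
  have h1 := hnode m m.2
  have h2 : ∑ i ∈ Finset.range (m + 1), s i ≤ ∑ i ∈ Finset.range p, s i :=
    Finset.sum_le_sum_of_subset_of_nonneg (Finset.range_mono m.2) fun i _ _ => hs0 i
  rw [Finset.sum_range_succ, hsm] at h2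
  have h3 : ∑ i ∈ Finset.range p, s i = ∑ k, σ k := by
    rw [Finset.sum_range]
    exact Finset.sum_congr rfl fun k _ => hsm k
  rw [h3] at h2
  have := mul_le_mul_of_nonneg_left h2 hδ
  rw [mul_add] at this
  exact (add_le_add_left h1 _).trans this

/-- Stability of the Galerkin equations: a discrete critical curve `g` is close to any polynomial
curve `Y` with the same end points that has almost the same accelerations. -/
theorem galerkin_estimate (R : QuadratureRule) {l N : ℕ} (hR : R.ExactTo N)
    (B : E →L[ℝ] E →L[ℝ] ℝ) {κ : ℝ} (hκ : 0 < κ)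
    (hcoer : ∀ w : ℝ → E, IsPoly l w → ∀ t ∈ Icc (0 : ℝ) 1,
      κ * ‖w t‖ ^ 2 ≤ ∑ i, R.b i * B (w (R.c i)) (w (R.c i))) :
    ∃ C, 0 < C ∧ ∀ p : ℕ, 1 ≤ p → ∀ h L ε : ℝ, 0 < h → 0 ≤ L → 0 ≤ ε → C * L * h ^ 2 ≤ 1 →
      ∀ (g : Fin p → ℝ → E) (Y : ℝ → E) (a : Fin p → Fin R.r → E) (n : ℕ),
      (∀ m, IsPoly (l + 1) (g m)) → IsPoly (n + 1) Y → n ≤ l → n + l ≤ N + 2 →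
      (∀ m m' : Fin p, (m' : ℕ) = (m : ℕ) + 1 →
        g m ((m' : ℕ) * (h / p)) = g m' ((m' : ℕ) * (h / p))) →
      (∀ m : Fin p, (m : ℕ) = 0 → g m 0 = Y 0) → (∀ m : Fin p, (m : ℕ) + 1 = p → g m h = Y h) →
      (∀ m i, ‖a m i - deriv (deriv Y) ((m : ℕ) * (h / p) + R.c i * (h / p))‖ ≤
        L * ‖g m ((m : ℕ) * (h / p) + R.c i * (h / p)) - Y ((m : ℕ) * (h / p) + R.c i * (h / p))‖
          + ε) →
      (∑ m : Fin p, ∑ i, R.b i *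
        (B (deriv (g m) ((m : ℕ) * (h / p) + R.c i * (h / p)))
            (deriv (fun t => g m t - Y t) ((m : ℕ) * (h / p) + R.c i * (h / p)))
          + B (a m i) (g m ((m : ℕ) * (h / p) + R.c i * (h / p))
            - Y ((m : ℕ) * (h / p) + R.c i * (h / p)))) = 0) →
      ∀ m : Fin p, ∀ t ∈ Icc ((m : ℕ) * (h / p)) ((m : ℕ) * (h / p) + h / p),
        ‖g m t - Y t‖ ≤ C * h ^ 2 * ε := by
  set c : ℝ := (∑ i, |R.b i|) * ‖B‖ / κ with hc
  have hc0 : 0 ≤ c := by positivity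
  -- With this constant the smallness assumption gives `c * L * h ^ 2 ≤ 1 / 2`, so the Lipschitz
  -- contribution can be absorbed at the end.
  refine ⟨2 * c + 1, by positivity, ?_⟩
  intro p hp h L ε hh hL hε hsmall g Y a n hg hY hnl hnN hcont hg0 hg1 hacc horth m₀ t₀ ht₀
  have hp' : (0 : ℝ) < p := by exact_mod_cast hp
  set δ := h / p with hδ
  have hδ0 : 0 < δ := by positivity
  have hpδ : p * δ = h := by rw [hδ]; field_simp
  set tn : Fin p → Fin R.r → ℝ := fun m i => (m : ℕ) * δ + R.c i * δ with htn
  have htn_mem : ∀ (m : Fin p) i, tn m i ∈ Icc ((m : ℕ) * δ) ((m : ℕ) * δ + δ) := fun m i => by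
    have := R.c_mem i
    exact ⟨by simp only [htn]; nlinarith [this.1], by simp only [htn]; nlinarith [this.2]⟩
  set d : Fin p → ℝ → E := fun m t => g m t - Y t with hd
  have hdp : ∀ m, IsPoly (l + 1) (d m) := fun m => (hg m).sub (hY.mono (by omega))
  have hdd : ∀ m, Differentiable ℝ (d m) := fun m => (hdp m).differentiable
  have hdderiv : ∀ m t, deriv (d m) t = deriv (g m) t - deriv Y t := fun m t =>
    deriv_fun_sub ((hg m).differentiable t) (hY.differentiable t)
  have hdcont : ∀ m m' : Fin p, (m' : ℕ) = (m : ℕ) + 1 →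
      d m ((m' : ℕ) * δ) = d m' ((m' : ℕ) * δ) := fun m m' hm => by
    simp only [hd, hcont m m' hm]
  have hd0 : ∀ m : Fin p, (m : ℕ) = 0 → d m 0 = 0 := fun m hm => by simp [hd, hg0 m hm]
  have hd1 : ∀ m : Fin p, (m : ℕ) + 1 = p → d m h = 0 := fun m hm => by simp [hd, hg1 m hm]
  set ν : Fin p → ℝ := fun m => ∑ i, R.b i * B (deriv (d m) (tn m i)) (deriv (d m) (tn m i)) with hν
  have hνσ : ∀ m : Fin p, ∀ t ∈ Icc ((m : ℕ) * δ) ((m : ℕ) * δ + δ), κ * ‖deriv (d m) t‖ ^ 2 ≤ ν m := by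
    intro m t ht
    have := hcoer _ ((hdp m).deriv.comp_affine δ ((m : ℕ) * δ)) ((t - (m : ℕ) * δ) / δ)
      ⟨div_nonneg (by linarith [ht.1]) hδ0.le, (div_le_one hδ0).2 (by linarith [ht.2])⟩
    rw [mul_div_cancel₀ _ hδ0.ne', add_sub_cancel] at this
    simpa only [hν, htn, mul_comm δ] using this
  have hν0 : ∀ m, 0 ≤ ν m := fun m => le_trans (by positivity) (hνσ m _ (left_mem_Icc.2 (by linarith)))
  set σ : Fin p → ℝ := fun m => √(ν m / κ) with hσ
  -- A bound for `d` obtained by summing the velocity bounds `σ m`. Cauchy–Schwarz then yields a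
  -- discrete Poincaré inequality between `D` and the total energy.
  set D : ℝ := δ * ∑ m, σ m with hD
  have hD0 : 0 ≤ D := mul_nonneg hδ0.le (Finset.sum_nonneg fun m _ => Real.sqrt_nonneg _)
  have hdD : ∀ m : Fin p, ∀ t ∈ Icc ((m : ℕ) * δ) ((m : ℕ) * δ + δ), ‖d m t‖ ≤ D :=
    norm_piece_le_sum d hδ0.le hdd hdcont hd0 σ fun m t ht => by
      refine Real.le_sqrt_of_sq_le ?_
      rw [le_div_iff₀ hκ, mul_comm]
      exact hνσ m t ht
  -- the squared energy
  have hDsq : D ^ 2 ≤ δ ^ 2 * p / κ * ∑ m, ν m := by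
    have h1 := sq_sum_le_card_mul_sum_sq (s := Finset.univ) (f := σ)
    have h2 : ∑ m, σ m ^ 2 = (∑ m, ν m) / κ := by
      rw [Finset.sum_div]
      exact Finset.sum_congr rfl fun m _ => Real.sq_sqrt (div_nonneg (hν0 m) hκ.le)
    rw [h2, Finset.card_univ, Fintype.card_fin] at h1
    calc D ^ 2 = δ ^ 2 * (∑ m, σ m) ^ 2 := by rw [hD, mul_pow]
      _ ≤ δ ^ 2 * (p * ((∑ m, ν m) / κ)) := by gcongr
      _ = _ := by ring
  -- Exact integration by parts for `Y`: on each piece `B (deriv Y t) (d m t)` has degree at most `N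
  -- + 1`, so the rule sums its derivative exactly. The boundary terms telescope to zero.
  have hexact : ∑ m : Fin p, ∑ i, R.b i * (B (deriv Y (tn m i)) (deriv (d m) (tn m i))
      + B (deriv (deriv Y) (tn m i)) (d m (tn m i))) = 0 := by
    have hG : ∀ m, IsPoly (N + 2) (fun t => B (deriv Y t) (d m t)) := fun m =>
      ((hY.deriv).bilin B (hdp m)).mono hnN
    have hGd : ∀ m t, deriv (fun t => B (deriv Y t) (d m t)) t
        = B (deriv Y t) (deriv (d m) t) + B (deriv (deriv Y) t) (d m t) := fun m t =>
      (B.hasDerivAt_of_bilinear (fun _ => (hY.deriv.differentiable t).hasDerivAt)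
        (fun _ => (hdd m t).hasDerivAt)).deriv
    have h1 := sum_pieces_telescope hp (fun m t => B (deriv Y t) (d m t)) hpδ (x := 0) (y := 0)
      (fun m m' hm => by simp only [hdcont m m' hm]) (fun m hm => by simp only [hd0 m hm, map_zero])
      (fun m hm => by simp only [hd1 m hm, map_zero])
    simp only [sub_zero] at h1
    rw [Finset.sum_congr rfl fun m _ => (hR.sum_deriv (hG m) δ ((m : ℕ) * δ)).symm,
      ← Finset.smul_sum] at h1
    have h2 := (smul_eq_zero.1 h1).resolve_left hδ0.ne'
    simpa only [hGd, smul_eq_mul] using h2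
  -- Subtracting the identity for `Y` from the Galerkin equation tested with `d` leaves the energy
  -- of `d` against the mismatch of accelerations.
  have hS : ∑ m, ν m = -∑ m : Fin p, ∑ i, R.b i *
      B (a m i - deriv (deriv Y) (tn m i)) (d m (tn m i)) := by
    have h3 : ∑ m : Fin p, ∑ i, R.b i * (B (deriv (g m) (tn m i)) (deriv (d m) (tn m i))
      + B (a m i) (d m (tn m i))) = 0 := horth
    rw [eq_neg_iff_add_eq_zero]
    have h4 := congrArg₂ (· - ·) h3 hexact
    simp only [sub_zero, ← Finset.sum_sub_distrib] at h4
    simp only [hν, ← Finset.sum_add_distrib]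
    rw [← h4]
    refine Finset.sum_congr rfl fun m _ => Finset.sum_congr rfl fun i _ => ?_
    rw [hdderiv]
    simp only [map_sub, _root_.sub_apply]
    ring
  have hSle : ∑ m, ν m ≤ p * ((∑ i, |R.b i|) * (‖B‖ * (L * D + ε) * D)) := by
    rw [hS, ← Finset.sum_neg_distrib]
    refine (Finset.sum_le_card_nsmul _ _ ((∑ i, |R.b i|) * (‖B‖ * (L * D + ε) * D))
      fun m _ => ?_).trans_eq (by simp)
    refine (neg_le_abs _).trans ((Finset.abs_sum_le_sum_abs _ _).trans ?_)
    rw [Finset.sum_mul]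
    refine Finset.sum_le_sum fun i _ => ?_
    rw [abs_mul]
    refine mul_le_mul_of_nonneg_left ?_ (abs_nonneg _)
    have h5 := B.le_opNorm₂ (a m i - deriv (deriv Y) (tn m i)) (d m (tn m i))
    have h6 := hdD m _ (htn_mem m i)
    rw [Real.norm_eq_abs] at h5
    refine h5.trans ?_
    have h7 : ‖a m i - deriv (deriv Y) (tn m i)‖ ≤ L * D + ε :=
      (hacc m i).trans (by gcongr)
    gcongr
  -- The Poincaré inequality and the energy bound combined. Cancelling one factor `D` and absorbing
  -- the term with `L` gives the claim.
  have hfin : D ^ 2 ≤ c * h ^ 2 * (L * D + ε) * D := by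
    refine hDsq.trans ((mul_le_mul_of_nonneg_left hSle (by positivity)).trans_eq ?_)
    rw [hc, ← hpδ]
    ring
  have hDle : D ≤ (2 * c + 1) * h ^ 2 * ε := by
    rcases hD0.eq_or_lt with h8 | h8
    · rw [← h8]; positivity
    · have h9 : D ≤ c * h ^ 2 * (L * D + ε) := by
        rw [sq] at hfin
        exact le_of_mul_le_mul_right hfin h8
      have h10 : 0 ≤ L * h ^ 2 := by positivity
      have h11 : c * L * h ^ 2 * D ≤ 1 / 2 * D := by
        refine mul_le_mul_of_nonneg_right ?_ hD0
        nlinarith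
      have h12 : 0 ≤ h ^ 2 * ε := by positivity
      nlinarith
  exact (hdD m₀ t₀ ht₀).trans hDle

end Galerkin

end Multirate

namespace Multirate

/-! ### The two-point boundary value problem -/

section BoundaryValue

variable {E : Type*} [NormedAddCommGroup E] [NormedSpace ℝ E]

/-- Existence for two-point boundary value problems on short intervals. -/
theorem exists_boundary_value_solution [CompleteSpace E] {f : E → E} {L : ℝ} (hL : 0 ≤ L)
    (hf : Continuous f) (hLip : ∀ x y, ‖f x - f y‖ ≤ L * ‖x - y‖) {h : ℝ} (h0 : 0 < h)
    (hsmall : 4 * L * h ^ 2 ≤ 1) (y₀ y₁ : E) :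
    ∃ x v : ℝ → E, x 0 = y₀ ∧ x h = y₁ ∧ (∀ t, HasDerivAt x (v t) t) ∧ Continuous v ∧
      ∀ t ∈ Icc 0 h, HasDerivAt v (f (x t)) t := by
  -- The curve is extended constantly beyond `[0, h]`, so that all primitives are differentiable on
  -- the whole line.
  set F : C(Icc 0 h, E) → ℝ → E := fun α s => f (α (projIcc 0 h h0.le s)) with hF
  have hFc : ∀ α, Continuous (F α) := fun α =>
    hf.comp (α.continuous.comp continuous_projIcc)
  set A : C(Icc 0 h, E) → ℝ → E := fun α t => ∫ s in (0 : ℝ)..t, F α s with hA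
  have hAd : ∀ α t, HasDerivAt (A α) (F α t) t := fun α t => (hFc α).integral_hasStrictDerivAt 0 t
    |>.hasDerivAt
  have hAc : ∀ α, Continuous (A α) := fun α =>
    continuous_iff_continuousAt.2 fun t => (hAd α t).continuousAt
  set W : C(Icc 0 h, E) → ℝ → E := fun α t => ∫ s in (0 : ℝ)..t, A α s with hW
  have hWd : ∀ α t, HasDerivAt (W α) (A α t) t := fun α t => (hAc α).integral_hasStrictDerivAt 0 t
    |>.hasDerivAt
  -- The double primitive of the force, corrected by an affine function to meet both end points. Its
  -- fixed points are the solutions sought.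
  set X : C(Icc 0 h, E) → ℝ → E := fun α t => y₀ + t • (h⁻¹ • (y₁ - y₀ - W α h)) + W α t with hX
  have hXd : ∀ α t, HasDerivAt (X α) (h⁻¹ • (y₁ - y₀ - W α h) + A α t) t := fun α t => by
    have := (((hasDerivAt_id t).smul_const (h⁻¹ • (y₁ - y₀ - W α h))).const_add y₀).add (hWd α t)
    rw [one_smul] at this
    exact this
  have hXc : ∀ α, Continuous (X α) := fun α =>
    continuous_iff_continuousAt.2 fun t => (hXd α t).continuousAt
  set T : C(Icc 0 h, E) → C(Icc 0 h, E) := fun α =>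
    ⟨fun t => X α t, (hXc α).comp continuous_subtype_val⟩ with hT
  -- The double primitive and the affine correction each change by at most `L * h ^ 2 * D`, and
  -- `hsmall` makes the total at most `D / 2`.
  have hT : ContractingWith (1 / 2) T := by
    refine ⟨by norm_num [← NNReal.coe_lt_coe], LipschitzWith.of_dist_le_mul fun α β => ?_⟩
    set D := dist α β with hD
    have m0 : (0 : ℝ) ∈ Icc 0 h := left_mem_Icc.2 h0.le
    have habs : ∀ t ∈ Icc 0 h, |t - 0| ≤ h := fun t ht => by
      rw [sub_zero, abs_of_nonneg ht.1]; exact ht.2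
    have b1 : ∀ s, ‖F α s - F β s‖ ≤ L * D := fun s =>
      (hLip _ _).trans (mul_le_mul_of_nonneg_left
        (by rw [← dist_eq_norm]; exact ContinuousMap.dist_apply_le_dist _) hL)
    have hLD : 0 ≤ L * D := mul_nonneg hL dist_nonneg
    have b2 : ∀ t ∈ Icc 0 h, ‖A α t - A β t‖ ≤ L * D * h := fun t ht => by
      have := norm_sub_le_of_deriv_le (fun t _ => (hAd α t).sub (hAd β t)) (fun s _ => b1 s) m0 ht
      simp only [Pi.sub_apply, hA, intervalIntegral.integral_same, sub_zero] at this
      exact this.trans (mul_le_mul_of_nonneg_left (by simpa using habs t ht) hLD)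
    have b3 : ∀ t ∈ Icc 0 h, ‖W α t - W β t‖ ≤ L * D * h * h := fun t ht => by
      have := norm_sub_le_of_deriv_le (fun t _ => (hWd α t).sub (hWd β t)) b2 m0 ht
      simp only [Pi.sub_apply, hW, intervalIntegral.integral_same, sub_zero] at this
      exact this.trans (mul_le_mul_of_nonneg_left (by simpa using habs t ht) (by positivity))
    refine (ContinuousMap.dist_le (by positivity)).2 fun t => ?_
    have e : X α t - X β t = (W α t - W β t) - ((t : ℝ) * h⁻¹) • (W α h - W β h) := by
      simp only [hX, smul_smul, smul_sub]
      abel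
    change dist (X α t) (X β t) ≤ _
    rw [dist_eq_norm, e]
    refine (norm_sub_le _ _).trans ?_
    have b4 := b3 t t.2
    have b5 := b3 h (right_mem_Icc.2 h0.le)
    have b6 : ‖(t : ℝ) * h⁻¹‖ ≤ 1 := by
      rw [Real.norm_of_nonneg (mul_nonneg t.2.1 (by positivity)), ← div_eq_mul_inv]
      exact (div_le_one h0).2 t.2.2
    have b7 : ‖((t : ℝ) * h⁻¹) • (W α h - W β h)‖ ≤ L * D * h * h := by
      rw [norm_smul]
      exact (mul_le_of_le_one_left (norm_nonneg _) b6).trans b5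
    have hD0 : 0 ≤ D := dist_nonneg
    have : 4 * L * h ^ 2 * D ≤ 1 * D := mul_le_mul_of_nonneg_right hsmall hD0
    push_cast
    nlinarith
  have hfix : T (ContractingWith.fixedPoint T hT) = ContractingWith.fixedPoint T hT :=
    hT.fixedPoint_isFixedPt
  set α := ContractingWith.fixedPoint T hT with hα
  refine ⟨X α, fun t => h⁻¹ • (y₁ - y₀ - W α h) + A α t, by simp [hX, hW], ?_, hXd α,
    continuous_const.add (hAc α), fun t ht => ?_⟩
  · simp only [hX, smul_smul, mul_inv_cancel₀ h0.ne', one_smul]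
    abel
  · have e : F α t = f (X α t) := by
      simp only [hF, projIcc_of_mem h0.le ht]
      conv_lhs => rw [← hfix]
      rfl
    rw [← e]
    exact (hAd α t).const_add _

end BoundaryValue

/-! ### Comparison of actions with a solution of the Euler–Lagrange equations -/

section Action

variable {E : Type*} [NormedAddCommGroup E] [NormedSpace ℝ E]

/-- The Lagrangian with kinetic energy `B v v / 2` and potential energy `U`. -/
noncomputable def lag (B : E →L[ℝ] E →L[ℝ] ℝ) (U : E → ℝ) (q v : E) : ℝ := 1 / 2 * B v v - U q

variable {B : E →L[ℝ] E →L[ℝ] ℝ} {U : E → ℝ} {f : E → E} {K : ℝ}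

theorem continuous_lag (hU : Continuous U) {q v : ℝ → E} (hq : Continuous q) (hv : Continuous v) :
    Continuous fun t => lag B U (q t) (v t) := by
  unfold lag; fun_prop

/-- Along a solution `v' = f x` the first bracket is the derivative of `B v (y - x)`, so it
integrates to a boundary term. What remains is quadratic in the deviation. -/
theorem lag_sub_lag (hB : ∀ v w, B v w = B w v) (hf : ∀ q w, B (f q) w = -fderiv ℝ U q w)
    (x v y w : E) :
    lag B U y w - lag B U x v = (B (f x) (y - x) + B v (w - v)) + 1 / 2 * B (w - v) (w - v)
      - (U y - U x - fderiv ℝ U x (y - x)) := by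
  rw [hf]
  simp only [lag, map_sub, _root_.sub_apply, hB w v]
  ring

/-- The action of a piecewise curve is at least that of the solution of the Euler-Lagrange
equations with the same end points, on short intervals. -/
theorem action_le_action_pieces (hB : ∀ v w, B v w = B w v) {c : ℝ} (hc : 0 < c)
    (hcB : ∀ v, c * ‖v‖ ^ 2 ≤ B v v) (hUc : Continuous U) (hfc : Continuous f)
    (hf : ∀ q w, B (f q) w = -fderiv ℝ U q w)
    (hK : ∀ x y, |U y - U x - fderiv ℝ U x (y - x)| ≤ K * ‖y - x‖ ^ 2) (hK0 : 0 ≤ K)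
    {h : ℝ} (h0 : 0 < h) (hsmall : 8 * (K / c) * h ^ 2 ≤ 1) {x v : ℝ → E}
    (hx : ∀ t, HasDerivAt x (v t) t) (hvc : Continuous v)
    (hv : ∀ t ∈ Icc 0 h, HasDerivAt v (f (x t)) t) {p : ℕ} (hp : 1 ≤ p) (g : Fin p → ℝ → E)
    (hgd : ∀ m, Differentiable ℝ (g m)) (hgc : ∀ m, Continuous (deriv (g m)))
    (hcont : ∀ m m' : Fin p, (m' : ℕ) = (m : ℕ) + 1 →
      g m ((m' : ℕ) * (h / p)) = g m' ((m' : ℕ) * (h / p)))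
    (hg0 : ∀ m : Fin p, (m : ℕ) = 0 → g m 0 = x 0)
    (hg1 : ∀ m : Fin p, (m : ℕ) + 1 = p → g m h = x h) :
    ∫ t in (0 : ℝ)..h, lag B U (x t) (v t) ≤
      ∑ m : Fin p, ∫ t in ((m : ℕ) * (h / p) : ℝ)..((m : ℕ) * (h / p) + h / p),
        lag B U (g m t) (deriv (g m) t) := by
  have hp' : (0 : ℝ) < p := by exact_mod_cast hp
  set δ := h / p with hδ
  have hδ0 : 0 < δ := by positivity
  have hpδ : p * δ = h := by rw [hδ]; field_simp
  set k := K / c with hk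
  have hk0 : 0 ≤ k := by positivity
  have hkB : ∀ w, K * ‖w‖ ^ 2 ≤ k * B w w := fun w => by
    have : K * ‖w‖ ^ 2 = k * (c * ‖w‖ ^ 2) := by rw [hk]; field_simp
    rw [this]; exact mul_le_mul_of_nonneg_left (hcB w) hk0
  have hBn : ∀ w, 0 ≤ B w w := fun w => le_trans (by positivity) (hcB w)
  have hxc : Continuous x := continuous_iff_continuousAt.2 fun t => (hx t).continuousAt
  have hlx : Continuous fun t => lag B U (x t) (v t) := continuous_lag hUc hxc hvc
  have hlg : ∀ m, Continuous fun t => lag B U (g m t) (deriv (g m) t) := fun m =>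
    continuous_lag hUc (hgd m).continuous (hgc m)
  -- Legendre's device: besides `B v d`, with `d = g m - x`, the null term `-2 * k * t * B d d` is
  -- included. It also vanishes at the end points, and its derivative completes the second variation
  -- to a square.
  set G : Fin p → ℝ → ℝ := fun m t =>
    B (v t) (g m t - x t) + (-(2 * k) * t) * B (g m t - x t) (g m t - x t) with hG
  set G' : Fin p → ℝ → ℝ := fun m t =>
    (B (v t) (deriv (g m) t - v t) + B (f (x t)) (g m t - x t)) +
      ((-(2 * k)) * B (g m t - x t) (g m t - x t) + (-(2 * k) * t) *
        (B (g m t - x t) (deriv (g m) t - v t) + B (deriv (g m) t - v t) (g m t - x t))) with hG'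
  have hGd : ∀ m, ∀ t ∈ Icc 0 h, HasDerivAt (G m) (G' m t) t := by
    intro m t ht
    have hd : HasDerivAt (fun t => g m t - x t) (deriv (g m) t - v t) t :=
      (hgd m t).hasDerivAt.sub (hx t)
    have hlin : HasDerivAt (fun t : ℝ => -(2 * k) * t) (-(2 * k)) t := by
      simpa using (hasDerivAt_id t).const_mul (-(2 * k))
    exact (B.hasDerivAt_of_bilinear (fun _ => hv t ht) (fun _ => hd)).add
      (hlin.mul (B.hasDerivAt_of_bilinear (fun _ => hd) (fun _ => hd)))
  have hG'c : ∀ m, Continuous (G' m) := by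
    intro m
    have h1 := (hgd m).continuous
    have h2 := hgc m
    have h3 : Continuous fun t => f (x t) := hfc.comp hxc
    simp only [hG']
    fun_prop
  have hpt : ∀ m, ∀ t ∈ Icc 0 h, G' m t ≤ lag B U (g m t) (deriv (g m) t) - lag B U (x t) (v t) := by
    intro m t ht
    rw [lag_sub_lag hB hf]
    set d := g m t - x t
    set e := deriv (g m) t - v t
    have h1 := (abs_le.1 (hK (x t) (g m t))).2.trans (hkB d)
    -- The completed square. It leaves a term `8 * k ^ 2 * t ^ 2 * B d d`, at most `k * B d d` on
    -- short intervals; with the Taylor remainder of `U` this uses up the `2 * k * B d d` supplied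
    -- by the null term.
    have h2 := hBn (e + (4 * k * t) • d)
    simp only [map_add, map_smul, _root_.add_apply, _root_.smul_apply, smul_eq_mul] at h2
    have h3 := hB e d
    have h5 : 8 * k * t ^ 2 ≤ 1 :=
      (mul_le_mul_of_nonneg_left (pow_le_pow_left₀ ht.1 ht.2 2) (by positivity)).trans hsmall
    have h6 : k * (8 * k * t ^ 2) * B d d ≤ k * B d d :=
      mul_le_mul_of_nonneg_right (mul_le_of_le_one_right hk0 h5) (hBn d)
    simp only [hG']
    rw [h3] at h2 ⊢
    nlinarith
  have hpiece : ∀ m : Fin p, G m ((m : ℕ) * δ + δ) - G m ((m : ℕ) * δ) ≤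
      (∫ t in ((m : ℕ) * δ : ℝ)..((m : ℕ) * δ + δ), lag B U (g m t) (deriv (g m) t))
        - ∫ t in ((m : ℕ) * δ : ℝ)..((m : ℕ) * δ + δ), lag B U (x t) (v t) := by
    intro m
    have hle : (m : ℕ) * δ ≤ (m : ℕ) * δ + δ := by linarith
    have hsub : ∀ t ∈ Icc ((m : ℕ) * δ) ((m : ℕ) * δ + δ), t ∈ Icc 0 h := fun t ht => by
      have hm : ((m : ℕ) : ℝ) + 1 ≤ p := by exact_mod_cast m.2
      refine ⟨le_trans (by positivity) ht.1, ht.2.trans ?_⟩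
      rw [← hpδ]
      nlinarith
    rw [← intervalIntegral.integral_sub ((hlg m).intervalIntegrable _ _)
      (hlx.intervalIntegrable _ _), ← intervalIntegral.integral_eq_sub_of_hasDerivAt
      (fun t ht => hGd m t (hsub t (by rwa [uIcc_of_le hle] at ht)))
      ((hG'c m).intervalIntegrable _ _)]
    exact intervalIntegral.integral_mono_on hle ((hG'c m).intervalIntegrable _ _)
      (((hlg m).sub hlx).intervalIntegrable _ _) fun t ht => hpt m t (hsub t ht)
  have hsum := Finset.sum_le_sum fun m (_ : m ∈ Finset.univ) => hpiece m
  -- The increments of `G` over the pieces add up to zero, since all curves share their end points.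
  rw [sum_pieces_telescope hp G hpδ (x := 0) (y := 0)
    (fun m m' hm => by simp only [hG, hcont m m' hm]) (fun m hm => by simp [hG, hg0 m hm])
    (fun m hm => by simp [hG, hg1 m hm]), Finset.sum_sub_distrib] at hsum
  have htot := sum_pieces_telescope hp (fun (_ : Fin p) t => ∫ s in (0 : ℝ)..t, lag B U (x s) (v s))
    hpδ (x := 0) (y := ∫ s in (0 : ℝ)..h, lag B U (x s) (v s)) (fun _ _ _ => rfl)
    (fun _ _ => by simp) (fun _ _ => rfl)
  simp only [intervalIntegral.integral_interval_sub_left (hlx.intervalIntegrable _ _)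
    (hlx.intervalIntegrable _ _)] at htot
  linarith

/-- The action of a curve close to a solution of the Euler-Lagrange equations with the same end
points. -/
theorem action_le_add (hB : ∀ v w, B v w = B w v) (hUc : Continuous U) (hfc : Continuous f)
    (hf : ∀ q w, B (f q) w = -fderiv ℝ U q w)
    (hK : ∀ x y, |U y - U x - fderiv ℝ U x (y - x)| ≤ K * ‖y - x‖ ^ 2) (hK0 : 0 ≤ K)
    {h : ℝ} (h0 : 0 < h) {x v : ℝ → E}
    (hx : ∀ t, HasDerivAt x (v t) t) (hvc : Continuous v)
    (hv : ∀ t ∈ Icc 0 h, HasDerivAt v (f (x t)) t) {Y : ℝ → E}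
    (hYd : Differentiable ℝ Y) (hYc : Continuous (deriv Y)) (hY0 : Y 0 = x 0) (hYh : Y h = x h)
    {ε : ℝ} (hε1 : ∀ t ∈ Icc 0 h, ‖deriv Y t - v t‖ ≤ ε) (hε : ∀ t ∈ Icc 0 h, ‖Y t - x t‖ ≤ ε) :
    ∫ t in (0 : ℝ)..h, lag B U (Y t) (deriv Y t) ≤
      (∫ t in (0 : ℝ)..h, lag B U (x t) (v t)) + h * ((‖B‖ + K) * ε ^ 2) := by
  have hxc : Continuous x := continuous_iff_continuousAt.2 fun t => (hx t).continuousAt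
  have hlx : Continuous fun t => lag B U (x t) (v t) := continuous_lag hUc hxc hvc
  have hlY : Continuous fun t => lag B U (Y t) (deriv Y t) := continuous_lag hUc hYd.continuous hYc
  -- The terms linear in the deviation form the derivative of `B v (Y - x)`, which vanishes at both
  -- ends. The second summand dominates the quadratic remainder.
  set G : ℝ → ℝ := fun t => B (v t) (Y t - x t) + t * ((‖B‖ + K) * ε ^ 2) with hG
  set G' : ℝ → ℝ := fun t => (B (v t) (deriv Y t - v t) + B (f (x t)) (Y t - x t)) +
    (‖B‖ + K) * ε ^ 2 with hG'
  have hGd : ∀ t ∈ Icc 0 h, HasDerivAt G (G' t) t := by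
    intro t ht
    have hd : HasDerivAt (fun t => Y t - x t) (deriv Y t - v t) t := (hYd t).hasDerivAt.sub (hx t)
    have hlin : HasDerivAt (fun t : ℝ => t * ((‖B‖ + K) * ε ^ 2)) ((‖B‖ + K) * ε ^ 2) t := by
      simpa using (hasDerivAt_id t).mul_const ((‖B‖ + K) * ε ^ 2)
    exact (B.hasDerivAt_of_bilinear (fun _ => hv t ht) (fun _ => hd)).add hlin
  have hG'c : Continuous G' := by
    have h1 := hYd.continuous
    have h3 : Continuous fun t => f (x t) := hfc.comp hxc
    simp only [hG']
    fun_prop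
  have hpt : ∀ t ∈ Icc 0 h, lag B U (Y t) (deriv Y t) - lag B U (x t) (v t) ≤ G' t := by
    intro t ht
    rw [lag_sub_lag hB hf]
    have h1 := (abs_le.1 (hK (x t) (Y t))).1
    have h2 := (le_abs_self _).trans (B.le_opNorm₂ (deriv Y t - v t) (deriv Y t - v t))
    have h3 : ‖deriv Y t - v t‖ ^ 2 ≤ ε ^ 2 := pow_le_pow_left₀ (norm_nonneg _) (hε1 t ht) 2
    have h4 : ‖Y t - x t‖ ^ 2 ≤ ε ^ 2 := pow_le_pow_left₀ (norm_nonneg _) (hε t ht) 2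
    have h5 := mul_le_mul_of_nonneg_left h3 (norm_nonneg B)
    have h6 := mul_le_mul_of_nonneg_left h4 hK0
    have h7 : 0 ≤ ‖B‖ * ε ^ 2 := by positivity
    simp only [hG']
    nlinarith
  have := intervalIntegral.integral_mono_on (μ := volume) h0.le
    ((hlY.sub hlx).intervalIntegrable _ _)
    (hG'c.intervalIntegrable 0 h) hpt
  simp only [Pi.sub_apply] at this
  rw [intervalIntegral.integral_sub (hlY.intervalIntegrable _ _) (hlx.intervalIntegrable _ _),
    intervalIntegral.integral_eq_sub_of_hasDerivAt
      (fun t ht => hGd t (by rwa [uIcc_of_le h0.le] at ht)) (hG'c.intervalIntegrable _ _)] at this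
  simp only [hG, hY0, hYh, sub_self, map_zero, zero_mul, add_zero, zero_add, sub_zero] at this
  linarith

end Action

end Multirate

namespace Multirate

/-! ### Sum-of-squares mass forms and localisation of the potential -/

section Model

variable {E : Type*} [NormedAddCommGroup E] [NormedSpace ℝ E] {ι : Type*} [Fintype ι]

/-- The bilinear form `∑ φ_k v φ_k w`. -/
noncomputable def sumSqForm (φ : ι → E →L[ℝ] ℝ) : E →L[ℝ] E →L[ℝ] ℝ :=
  ∑ k, (φ k).smulRight (φ k)

theorem sumSqForm_apply (φ : ι → E →L[ℝ] ℝ) (v w : E) :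
    sumSqForm φ v w = ∑ k, φ k v * φ k w := by
  simp [sumSqForm]

theorem sumSqForm_comm (φ : ι → E →L[ℝ] ℝ) (v w : E) : sumSqForm φ v w = sumSqForm φ w v := by
  simp only [sumSqForm_apply, mul_comm]

theorem sumSqForm_pos {φ : ι → E →L[ℝ] ℝ} (hφ : ∀ v, (∀ k, φ k v = 0) → v = 0) {v : E}
    (hv : v ≠ 0) : 0 < sumSqForm φ v v := by
  rw [sumSqForm_apply]
  obtain ⟨k, hk⟩ : ∃ k, φ k v ≠ 0 := by
    by_contra! h
    exact hv (hφ v h)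
  exact Finset.sum_pos' (fun k _ => mul_self_nonneg _)
    ⟨k, Finset.mem_univ _, mul_self_pos.2 hk⟩

theorem sumSqForm_coercive [FiniteDimensional ℝ E] {φ : ι → E →L[ℝ] ℝ}
    (hφ : ∀ v, (∀ k, φ k v = 0) → v = 0) : ∃ c > 0, ∀ v, c * ‖v‖ ^ 2 ≤ sumSqForm φ v v :=
  exists_coercive (fun v => sumSqForm φ v v) (by fun_prop)
    (fun c v => by simp only [map_smul, _root_.smul_apply, smul_eq_mul]; ring)
    fun _ hv => sumSqForm_pos hφ hv

/-- A positive form gives an injective map into the dual, which has the same dimension. The inverse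
turns the differential of the potential into an acceleration. -/
theorem exists_sumSqForm_inverse [FiniteDimensional ℝ E] {φ : ι → E →L[ℝ] ℝ}
    (hφ : ∀ v, (∀ k, φ k v = 0) → v = 0) :
    ∃ A : (E →L[ℝ] ℝ) →L[ℝ] E, ∀ ψ, sumSqForm φ (A ψ) = ψ := by
  set T : E →ₗ[ℝ] Module.Dual ℝ E :=
    { toFun := fun v => (sumSqForm φ v).toLinearMap
      map_add' := fun v w => by ext; simp
      map_smul' := fun c v => by ext; simp } with hT
  have hinj : Function.Injective T := by
    rw [injective_iff_map_eq_zero]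
    intro v hv
    by_contra h
    have h1 := sumSqForm_pos hφ h
    have h2 : T v v = sumSqForm φ v v := rfl
    rw [← h2, hv] at h1
    simp at h1
  have hsurj := (LinearMap.injective_iff_surjective_of_finrank_eq_finrank
    (Subspace.dual_finrank_eq (K := ℝ) (V := E)).symm).1 hinj
  obtain ⟨g, hg⟩ := T.exists_rightInverse_of_surjective (LinearMap.range_eq_top.2 hsurj)
  refine ⟨LinearMap.toContinuousLinearMap
    (g ∘ₗ (LinearMap.toContinuousLinearMap (𝕜 := ℝ) (E := E) (F' := ℝ)).symm.toLinearMap),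
    fun ψ => ?_⟩
  ext w
  have := congrArg (fun F => F ((LinearMap.toContinuousLinearMap (𝕜 := ℝ) (E := E) (F' := ℝ)).symm ψ) w) hg
  exact this

/-- Near a configuration `q₀`, the potential energy agrees with a compactly supported smooth one;
`f` is the corresponding acceleration field. -/
theorem exists_local_model [FiniteDimensional ℝ E] {φ : ι → E →L[ℝ] ℝ}
    (hφ : ∀ v, (∀ k, φ k v = 0) → v = 0) {Q : Set E} (hQ : IsOpen Q) {V : E → ℝ}
    (hV : ContDiffOn ℝ ∞ V Q) {q₀ : E} (hq₀ : q₀ ∈ Q) :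
    ∃ (ρ L : ℝ) (U : E → ℝ) (f : E → E), 0 < ρ ∧ 0 ≤ L ∧ Metric.closedBall q₀ ρ ⊆ Q ∧
      ContDiff ℝ ∞ U ∧ (∀ q ∈ Metric.closedBall q₀ ρ, U q = V q) ∧ ContDiff ℝ ∞ f ∧
      (∀ q w, sumSqForm φ (f q) w = -fderiv ℝ U q w) ∧ (∀ x y, ‖f x - f y‖ ≤ L * ‖x - y‖) ∧
      (∀ q, ‖f q‖ ≤ L) ∧ (∀ q, |U q| ≤ L) ∧
      ∀ x y, |U y - U x - fderiv ℝ U x (y - x)| ≤ L * ‖y - x‖ ^ 2 := by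
  obtain ⟨r, hr, hrQ⟩ := Metric.nhds_basis_closedBall.mem_iff.1 (hQ.mem_nhds hq₀)
  -- The cutoff equals one on the ball of radius `r / 2` and has its support inside `Q`, so the
  -- product is smooth everywhere although `V` is arbitrary outside `Q`.
  let χ : ContDiffBump q₀ := ⟨r / 2, r, by positivity, by linarith⟩
  set U : E → ℝ := fun q => χ q * V q with hU
  have hUs : ContDiff ℝ ∞ U := by
    refine contDiff_iff_contDiffAt.2 fun q => ?_
    by_cases hq : q ∈ Q
    · exact χ.contDiff.contDiffAt.mul (hV.contDiffAt (hQ.mem_nhds hq))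
    · have hq' : q ∉ tsupport χ := by
        rw [χ.tsupport_eq]
        exact fun h => hq (hrQ h)
      have : U =ᶠ[𝓝 q] fun _ => 0 := by
        filter_upwards [(isClosed_tsupport χ).isOpen_compl.mem_nhds hq'] with z hz
        simp [hU, image_eq_zero_of_notMem_tsupport hz]
      exact contDiffAt_const.congr_of_eventuallyEq this
  have hUcs : HasCompactSupport U := χ.hasCompactSupport.mul_right
  obtain ⟨A, hA⟩ := exists_sumSqForm_inverse hφ
  set f : E → E := fun q => A (-fderiv ℝ U q) with hf
  have hDs : ContDiff ℝ ∞ (fderiv ℝ U) := hUs.fderiv_right (m := ∞) le_rfl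
  have hfs : ContDiff ℝ ∞ f := A.contDiff.comp hDs.neg
  have hDcs : HasCompactSupport (fderiv ℝ U) := hUcs.fderiv ℝ
  have hfcs : HasCompactSupport f :=
    hDcs.comp_left (g := fun ψ => A (-ψ)) (by simp)
  -- Compact support gives all global constants. The Lipschitz constant of `fderiv ℝ U` yields the
  -- quadratic Taylor bound by the mean value inequality.
  obtain ⟨L₁, hL₁⟩ := ContDiff.lipschitzWith_of_hasCompactSupport hfcs hfs (by simp)
  obtain ⟨L₂, hL₂⟩ := ContDiff.lipschitzWith_of_hasCompactSupport hDcs hDs (by simp)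
  obtain ⟨L₃, hL₃⟩ := hfcs.exists_bound_of_continuous hfs.continuous
  obtain ⟨L₄, hL₄⟩ := hUcs.exists_bound_of_continuous hUs.continuous
  have hL₃0 : 0 ≤ L₃ := (norm_nonneg _).trans (hL₃ 0)
  have hL₄0 : 0 ≤ L₄ := (norm_nonneg _).trans (hL₄ 0)
  have hL₁0 := L₁.2
  have hL₂0 := L₂.2
  refine ⟨r / 2, L₁ + L₂ + L₃ + L₄, U, f, by positivity, by positivity,
    (Metric.closedBall_subset_closedBall (by linarith)).trans hrQ, hUs, fun q hq => ?_, hfs,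
    fun q w => by rw [hf, hA, _root_.neg_apply], fun x y => ?_, fun q => ?_, fun q => ?_,
    fun x y => ?_⟩
  · rw [hU]
    simp [χ.one_of_mem_closedBall hq]
  · refine (hL₁.norm_sub_le x y).trans (mul_le_mul_of_nonneg_right ?_ (norm_nonneg _))
    linarith
  · exact (hL₃ q).trans (by linarith)
  · exact (hL₄ q).trans (by linarith)
  · have := Convex.norm_image_sub_le_of_norm_fderiv_le' (𝕜 := ℝ) (f := U) (φ := fderiv ℝ U x)
      (C := L₂ * ‖y - x‖) (s := Metric.closedBall x ‖y - x‖) (x := x) (y := y)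
      (fun z _ => hUs.differentiable (by simp) z)
      (fun z hz => (hL₂.norm_sub_le z x).trans (mul_le_mul_of_nonneg_left
        (by rwa [mem_closedBall_iff_norm] at hz) L₂.2)) (convex_closedBall _ _)
      (Metric.mem_closedBall_self (norm_nonneg _)) (by rw [mem_closedBall_iff_norm])
    rw [Real.norm_eq_abs] at this
    refine this.trans ?_
    rw [mul_assoc, ← sq]
    exact mul_le_mul_of_nonneg_right (by linarith) (sq_nonneg _)

end Model

/-! ### Positive definite mass matrices as sums of squares -/

section MassMatrix

-- Factor `M = Cᴴ * C` and take the rows of `C` as functionals; they separate points because `M` is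
-- positive definite. This form makes the scalar definiteness of the quadrature rule applicable
-- coordinate by coordinate.
open scoped MatrixOrder Matrix.Norms.L2Operator in
theorem exists_sumSq_of_posDef {n : ℕ} {M : Matrix (Fin n) (Fin n) ℝ} (hM : M.PosDef) :
    ∃ φ : Fin n → EuclideanSpace ℝ (Fin n) →L[ℝ] ℝ,
      (∀ v, v.ofLp ⬝ᵥ (M *ᵥ v.ofLp) = ∑ k, φ k v * φ k v) ∧ ∀ v, (∀ k, φ k v = 0) → v = 0 := by
  obtain ⟨C, hC⟩ := CStarAlgebra.nonneg_iff_eq_star_mul_self.mp hM.posSemidef.nonneg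
  set φ : Fin n → EuclideanSpace ℝ (Fin n) →L[ℝ] ℝ := fun k =>
    LinearMap.toContinuousLinearMap
      { toFun := fun v => (C *ᵥ v.ofLp) k
        map_add' := fun v w => by simp [Matrix.mulVec_add]
        map_smul' := fun c v => by simp [Matrix.mulVec_smul] } with hφ
  have hφa : ∀ k v, φ k v = (C *ᵥ v.ofLp) k := fun k v => rfl
  have key : ∀ v : EuclideanSpace ℝ (Fin n),
      v.ofLp ⬝ᵥ (M *ᵥ v.ofLp) = ∑ k, φ k v * φ k v := by
    intro v
    rw [hC, ← Matrix.mulVec_mulVec, Matrix.dotProduct_mulVec, Matrix.star_eq_conjTranspose,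
      Matrix.vecMul_conjTranspose]
    simp [dotProduct, hφa]
  refine ⟨φ, key, fun v hv => ?_⟩
  by_contra h
  have h1 := hM.dotProduct_mulVec_pos (x := v.ofLp) (by simpa using h)
  rw [star_trivial, key v] at h1
  simp [hv] at h1

variable {ns nf : ℕ}

/-- The kinetic energy as a sum of squares compatible with the splitting. -/
theorem MultirateSystem.exists_kinetic_functionals (S : MultirateSystem ns nf) :
    ∃ φ : Fin ns ⊕ Fin nf → Config ns nf →L[ℝ] ℝ,
      (∀ v, (∀ k, φ k v = 0) → v = 0) ∧ (∀ v, S.kinetic v = 1 / 2 * sumSqForm φ v v) ∧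
      ∀ a b, sumSqForm φ (a, 0) (0, b) = 0 := by
  obtain ⟨φs, hs, hs0⟩ := exists_sumSq_of_posDef S.posDef_Ms
  obtain ⟨φf, hf, hf0⟩ := exists_sumSq_of_posDef S.posDef_Mf
  refine ⟨Sum.elim (fun k => (φs k).comp (ContinuousLinearMap.fst ℝ _ _))
    (fun k => (φf k).comp (ContinuousLinearMap.snd ℝ _ _)), fun v hv => ?_, fun v => ?_,
    fun a b => ?_⟩
  · exact Prod.ext (hs0 _ fun k => hv (Sum.inl k)) (hf0 _ fun k => hv (Sum.inr k))
  · rw [sumSqForm_apply, Fintype.sum_sum_type, MultirateSystem.kinetic, hs, hf]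
    simp [mul_add]
  · simp [sumSqForm_apply, Fintype.sum_sum_type]

end MassMatrix

end Multirate

namespace Multirate

/-! ### Algebra of multirate polynomial curves -/

section PolyCurve

variable {E : Type*} [NormedAddCommGroup E] [NormedSpace ℝ E]

theorem polyCurve_eq_pval {l : ℕ} (a : Fin (l + 1) → E) : polyCurve a = pval a := rfl

/-- A polynomial vanishing on a nontrivial interval has zero coefficients. -/
theorem eq_zero_of_pval_eq_zero {n : ℕ} {a : Fin n → E} {x y : ℝ} (hxy : x < y)
    (h : ∀ t ∈ Icc x y, pval a t = 0) : a = 0 := by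
  ext k
  refine (SeparatingDual.eq_zero_iff_forall_dual_eq_zero (R := ℝ) (a k)).2 fun φ => ?_
  have : coordPoly φ a = 0 := by
    refine Polynomial.eq_zero_of_infinite_isRoot _ ((Icc_infinite hxy).mono fun t ht => ?_)
    rw [mem_ofPred_eq, Polynomial.IsRoot, eval_coordPoly, h t ht, map_zero]
  rw [← coeff_coordPoly φ a k, this, Polynomial.coeff_zero]

end PolyCurve

namespace PolyPair

variable {ns nf l p : ℕ}

theorem pos_add (g d : PolyPair ns nf l p) (m : Fin p) (t : ℝ) :
    (g + d).pos m t = g.pos m t + d.pos m t :=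
  Prod.ext (pval_add g.1 d.1 t) (pval_add (g.2 m) (d.2 m) t)

theorem pos_smul (c : ℝ) (g : PolyPair ns nf l p) (m : Fin p) (t : ℝ) :
    (c • g).pos m t = c • g.pos m t :=
  Prod.ext (pval_smul c g.1 t) (pval_smul c (g.2 m) t)

theorem pos_eq_pval (g : PolyPair ns nf l p) (m : Fin p) :
    g.pos m = pval fun k => (g.1 k, g.2 m k) := by
  ext t : 1
  simp only [PolyPair.pos, polyCurve, pval]
  exact Prod.ext (by simp [Prod.fst_sum]) (by simp [Prod.snd_sum])

theorem isPoly_pos (g : PolyPair ns nf l p) (m : Fin p) : IsPoly (l + 1) (g.pos m) :=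
  ⟨_, g.pos_eq_pval m⟩

theorem hasDerivAt_pos (g : PolyPair ns nf l p) (m : Fin p) (t : ℝ) :
    HasDerivAt (g.pos m) (g.vel m t) t :=
  (hasDerivAt_pval g.1 t).differentiableAt.hasDerivAt.prodMk
    (hasDerivAt_pval (g.2 m) t).differentiableAt.hasDerivAt

theorem deriv_pos (g : PolyPair ns nf l p) (m : Fin p) : deriv (g.pos m) = g.vel m :=
  funext fun t => (g.hasDerivAt_pos m t).deriv

theorem vel_add (g d : PolyPair ns nf l p) (m : Fin p) (t : ℝ) :
    (g + d).vel m t = g.vel m t + d.vel m t := by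
  rw [← ((g + d).hasDerivAt_pos m t).deriv, ← ((g.hasDerivAt_pos m t).add
    (d.hasDerivAt_pos m t)).deriv]
  congr 1
  exact funext fun s => pos_add g d m s

theorem vel_smul (c : ℝ) (g : PolyPair ns nf l p) (m : Fin p) (t : ℝ) :
    (c • g).vel m t = c • g.vel m t := by
  rw [← ((c • g).hasDerivAt_pos m t).deriv, ← ((g.hasDerivAt_pos m t).const_smul c).deriv]
  congr 1
  exact funext fun s => pos_smul c g m s

theorem continuous_pos (m : Fin p) (t : ℝ) :
    Continuous fun g : PolyPair ns nf l p => g.pos m t :=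
  LinearMap.continuous_of_finiteDimensional
    ({ toFun := fun g => g.pos m t
       map_add' := fun g d => pos_add g d m t
       map_smul' := fun c g => pos_smul c g m t } : PolyPair ns nf l p →ₗ[ℝ] Config ns nf)

theorem continuous_vel (m : Fin p) (t : ℝ) :
    Continuous fun g : PolyPair ns nf l p => g.vel m t :=
  LinearMap.continuous_of_finiteDimensional
    ({ toFun := fun g => g.vel m t
       map_add' := fun g d => vel_add g d m t
       map_smul' := fun c g => vel_smul c g m t } : PolyPair ns nf l p →ₗ[ℝ] Config ns nf)

theorem IsContinuous.pos_eq {ΔT : ℝ} {g : PolyPair ns nf l p} (hg : g.IsContinuous ΔT)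
    (m m' : Fin p) (hm : (m' : ℕ) = (m : ℕ) + 1) :
    g.pos m ((m' : ℕ) * (ΔT / p)) = g.pos m' ((m' : ℕ) * (ΔT / p)) :=
  Prod.ext rfl (hg m m' hm)

theorem HasEndpoints.pos_zero {ΔT : ℝ} {q₀ q₁ : Config ns nf} {g : PolyPair ns nf l p}
    (hg : g.HasEndpoints ΔT q₀ q₁) (m : Fin p) (hm : (m : ℕ) = 0) : g.pos m 0 = q₀ :=
  Prod.ext hg.1.1 (hg.2.1 m hm)

theorem HasEndpoints.pos_last {ΔT : ℝ} {q₀ q₁ : Config ns nf} {g : PolyPair ns nf l p}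
    (hg : g.HasEndpoints ΔT q₀ q₁) (m : Fin p) (hm : (m : ℕ) + 1 = p) : g.pos m ΔT = q₁ :=
  Prod.ext hg.1.2 (hg.2.2 m hm)

theorem IsContinuous.add_smul {ΔT : ℝ} {g d : PolyPair ns nf l p} (hg : g.IsContinuous ΔT)
    (hd : d.IsContinuous ΔT) (c : ℝ) : (g + c • d).IsContinuous ΔT := by
  intro m m' hm
  have e : ∀ m, polyCurve ((g + c • d).2 m) = fun t => pval (g.2 m) t + c • pval (d.2 m) t :=
    fun m => funext fun t => by
      rw [← pval_smul, ← pval_add]; rfl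
  rw [e, e]
  have h1 := hg m m' hm
  have h2 := hd m m' hm
  rw [polyCurve_eq_pval, polyCurve_eq_pval] at h1 h2
  simp only [h1, h2]

theorem HasEndpoints.add_smul {ΔT : ℝ} {q₀ q₁ r₀ r₁ : Config ns nf} {g d : PolyPair ns nf l p}
    (hg : g.HasEndpoints ΔT q₀ q₁) (hd : d.HasEndpoints ΔT r₀ r₁) (c : ℝ) :
    (g + c • d).HasEndpoints ΔT (q₀ + c • r₀) (q₁ + c • r₁) := by
  have e1 : polyCurve (g + c • d).1 = fun t => polyCurve g.1 t + c • polyCurve d.1 t :=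
    funext fun t => by
      simp only [polyCurve_eq_pval]
      rw [← pval_smul, ← pval_add]; rfl
  have e2 : ∀ m, polyCurve ((g + c • d).2 m) =
      fun t => polyCurve (g.2 m) t + c • polyCurve (d.2 m) t := fun m => funext fun t => by
    simp only [polyCurve_eq_pval]
    rw [← pval_smul, ← pval_add]; rfl
  refine ⟨⟨?_, ?_⟩, fun m hm => ?_, fun m hm => ?_⟩
  · rw [e1]; simp only [hg.1.1, hd.1.1]; rfl
  · rw [e1]; simp only [hg.1.2, hd.1.2]; rfl
  · rw [e2]; simp only [hg.2.1 m hm, hd.2.1 m hm]; rfl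
  · rw [e2]; simp only [hg.2.2 m hm, hd.2.2 m hm]; rfl

theorem zero_isContinuous_hasEndpoints {ΔT : ℝ} :
    (0 : PolyPair ns nf l p).IsContinuous ΔT ∧ (0 : PolyPair ns nf l p).HasEndpoints ΔT 0 0 := by
  have e : ∀ (n : ℕ) (t : ℝ), polyCurve (0 : Fin (l + 1) → EuclideanSpace ℝ (Fin n)) t = 0 :=
    fun n t => by simp [polyCurve]
  exact ⟨fun m m' _ => (e _ _).trans (e _ _).symm, ⟨e _ _, e _ _⟩, fun m _ => e _ _, fun m _ => e _ _⟩

/-- The space of test curves: continuous multirate polynomials vanishing at both ends. -/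
def tests (ns nf l p : ℕ) (ΔT : ℝ) : Submodule ℝ (PolyPair ns nf l p) where
  carrier := {d | d.IsContinuous ΔT ∧ d.HasEndpoints ΔT 0 0}
  add_mem' := fun {a b} ha hb => by
    have h1 := ha.1.add_smul hb.1 1
    have h2 := ha.2.add_smul hb.2 1
    rw [one_smul] at h1 h2
    exact ⟨h1, by simpa using h2⟩
  zero_mem' := zero_isContinuous_hasEndpoints
  smul_mem' := fun c a ha => by
    have z := zero_isContinuous_hasEndpoints (ns := ns) (nf := nf) (l := l) (p := p) (ΔT := ΔT)
    have h1 := z.1.add_smul ha.1 c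
    have h2 := z.2.add_smul ha.2 c
    rw [zero_add] at h1 h2
    exact ⟨h1, by simpa using h2⟩

end PolyPair

/-! ### The discrete action: first variation, coercivity, existence of critical points -/

section DiscreteAction

variable {ns nf l p : ℕ}

/-- The quadrature node `mΔt + c_iΔt`. -/
noncomputable def node (R : QuadratureRule) (ΔT : ℝ) (m : Fin p) (i : Fin R.r) : ℝ :=
  (m : ℕ) * (ΔT / p) + R.c i * (ΔT / p)

theorem node_mem (R : QuadratureRule) {ΔT : ℝ} (h : 0 ≤ ΔT) (m : Fin p) (i : Fin R.r) :
    node R ΔT m i ∈ Icc ((m : ℕ) * (ΔT / p)) ((m : ℕ) * (ΔT / p) + ΔT / p) := by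
  have h1 := R.c_mem i
  have h2 : 0 ≤ ΔT / p := by positivity
  simp only [node]
  exact ⟨by nlinarith [h1.1], by nlinarith [h1.2]⟩

/-- The discrete action for the Lagrangian `lag B U`. -/
noncomputable def discAction (R : QuadratureRule) (B : Config ns nf →L[ℝ] Config ns nf →L[ℝ] ℝ)
    (U : Config ns nf → ℝ) (ΔT : ℝ) (g : PolyPair ns nf l p) : ℝ :=
  (ΔT / p) * ∑ m : Fin p, ∑ i, R.b i *
    lag B U (g.pos m (node R ΔT m i)) (g.vel m (node R ΔT m i))

/-- The first variation of the discrete action; `f` is the acceleration field. -/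
noncomputable def firstVar (R : QuadratureRule) (B : Config ns nf →L[ℝ] Config ns nf →L[ℝ] ℝ)
    (f : Config ns nf → Config ns nf) (ΔT : ℝ) (g d : PolyPair ns nf l p) : ℝ :=
  ∑ m : Fin p, ∑ i, R.b i *
    (B (g.vel m (node R ΔT m i)) (d.vel m (node R ΔT m i))
      + B (f (g.pos m (node R ΔT m i))) (d.pos m (node R ΔT m i)))

variable {R : QuadratureRule} {B : Config ns nf →L[ℝ] Config ns nf →L[ℝ] ℝ}
  {U : Config ns nf → ℝ} {f : Config ns nf → Config ns nf} {ΔT : ℝ}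

theorem hasDerivAt_lag_line {E : Type*} [NormedAddCommGroup E] [NormedSpace ℝ E]
    {B : E →L[ℝ] E →L[ℝ] ℝ} {U : E → ℝ} {f : E → E} (hB : ∀ v w, B v w = B w v)
    (hU : Differentiable ℝ U) (hf : ∀ q w, B (f q) w = -fderiv ℝ U q w) (q a v w : E) :
    HasDerivAt (fun ε : ℝ => lag B U (q + ε • a) (v + ε • w)) (B v w + B (f q) a) 0 := by
  have hline : ∀ x y : E, HasDerivAt (fun ε : ℝ => x + ε • y) y 0 := fun x y => by
    simpa using ((hasDerivAt_id (0 : ℝ)).smul_const y).const_add x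
  have h1 := (B.hasDerivAt_of_bilinear (fun _ => hline v w) (fun _ => hline v w)).const_mul (1 / 2)
  have h2 : HasDerivAt (fun ε : ℝ => U (q + ε • a)) (fderiv ℝ U q a) 0 := by
    have h3 : HasFDerivAt U (fderiv ℝ U q) (q + (0 : ℝ) • a) := by
      simpa using (hU q).hasFDerivAt
    exact h3.comp_hasDerivAt (0 : ℝ) (hline q a)
  have h4 := h1.sub h2
  simp only [zero_smul, add_zero] at h4
  have e : B v w + B (f q) a = 1 / 2 * (B v w + B w v) - fderiv ℝ U q a := by
    rw [hf, hB w v]; ring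
  rw [e]
  exact h4

theorem hasDerivAt_discAction (hB : ∀ v w, B v w = B w v) (hU : Differentiable ℝ U)
    (hf : ∀ q w, B (f q) w = -fderiv ℝ U q w) (g d : PolyPair ns nf l p) :
    HasDerivAt (fun ε : ℝ => discAction R B U ΔT (g + ε • d))
      ((ΔT / p) * firstVar R B f ΔT g d) 0 := by
  unfold discAction firstVar
  refine HasDerivAt.const_mul _ (HasDerivAt.fun_sum fun m _ => HasDerivAt.fun_sum fun i _ =>
    HasDerivAt.const_mul _ ?_)
  simp only [PolyPair.pos_add, PolyPair.pos_smul, PolyPair.vel_add, PolyPair.vel_smul]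
  exact hasDerivAt_lag_line hB hU hf _ _ _ _

theorem continuous_discAction (hU : Continuous U) :
    Continuous fun g : PolyPair ns nf l p => discAction R B U ΔT g := by
  unfold discAction lag
  refine continuous_const.mul (continuous_finsetSum _ fun m _ => continuous_finsetSum _ fun i _ =>
    continuous_const.mul ?_)
  have h1 := PolyPair.continuous_pos (ns := ns) (nf := nf) (l := l) m (node R ΔT m i)
  have h2 := PolyPair.continuous_vel (ns := ns) (nf := nf) (l := l) m (node R ΔT m i)
  fun_prop

/-- The discrete kinetic energy of a piece dominates its velocity. -/
theorem piece_energy_ge {κ : ℝ} (hcoer : ∀ w : ℝ → Config ns nf, IsPoly l w → ∀ t ∈ Icc (0 : ℝ) 1,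
      κ * ‖w t‖ ^ 2 ≤ ∑ i, R.b i * B (w (R.c i)) (w (R.c i)))
    (hp : 1 ≤ p) (hΔT : 0 < ΔT) (g : PolyPair ns nf l p) (m : Fin p) {t : ℝ}
    (ht : t ∈ Icc ((m : ℕ) * (ΔT / p)) ((m : ℕ) * (ΔT / p) + ΔT / p)) :
    κ * ‖g.vel m t‖ ^ 2 ≤ ∑ i, R.b i * B (g.vel m (node R ΔT m i)) (g.vel m (node R ΔT m i)) := by
  have hδ0 : 0 < ΔT / p := div_pos hΔT (by exact_mod_cast hp)
  have := hcoer _ ((g.isPoly_pos m).deriv.comp_affine (ΔT / p) ((m : ℕ) * (ΔT / p)))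
    ((t - (m : ℕ) * (ΔT / p)) / (ΔT / p))
    ⟨div_nonneg (by linarith [ht.1]) hδ0.le, (div_le_one hδ0).2 (by linarith [ht.2])⟩
  rw [mul_div_cancel₀ _ hδ0.ne', add_sub_cancel, g.deriv_pos] at this
  simpa only [node, mul_comm (ΔT / p)] using this

/-- Twice the discrete kinetic energy, divided by the micro step size. -/
noncomputable def energy (R : QuadratureRule) (B : Config ns nf →L[ℝ] Config ns nf →L[ℝ] ℝ)
    (ΔT : ℝ) (g : PolyPair ns nf l p) : ℝ :=
  ∑ m : Fin p, ∑ i, R.b i * B (g.vel m (node R ΔT m i)) (g.vel m (node R ΔT m i))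

theorem energy_nonneg {κ : ℝ} (hκ : 0 < κ)
    (hcoer : ∀ w : ℝ → Config ns nf, IsPoly l w → ∀ t ∈ Icc (0 : ℝ) 1,
      κ * ‖w t‖ ^ 2 ≤ ∑ i, R.b i * B (w (R.c i)) (w (R.c i)))
    (hp : 1 ≤ p) (hΔT : 0 < ΔT) (g : PolyPair ns nf l p) : 0 ≤ energy R B ΔT g := by
  have hδ0 : 0 < ΔT / p := div_pos hΔT (by exact_mod_cast hp)
  exact Finset.sum_nonneg fun m _ => le_trans (by positivity)
    (piece_energy_ge hcoer hp hΔT g m (left_mem_Icc.2 (by linarith)))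

theorem continuous_energy : Continuous fun g : PolyPair ns nf l p => energy R B ΔT g := by
  refine continuous_finsetSum _ fun m _ => continuous_finsetSum _ fun i _ =>
    continuous_const.mul ?_
  have h2 := PolyPair.continuous_vel (ns := ns) (nf := nf) (l := l) m (node R ΔT m i)
  fun_prop

theorem energy_smul (c : ℝ) (g : PolyPair ns nf l p) :
    energy R B ΔT (c • g) = c ^ 2 * energy R B ΔT g := by
  simp only [energy, PolyPair.vel_smul, map_smul, _root_.smul_apply, smul_eq_mul, Finset.mul_sum]
  exact Finset.sum_congr rfl fun m _ => Finset.sum_congr rfl fun i _ => by ring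

/-- The parallelogram identity. Dropping the first, nonnegative term on the right bounds the energy
of `g + d` below by half that of `d` minus that of `g`, which gives coercivity on an affine space.
-/
theorem energy_add (hB : ∀ v w, B v w = B w v) (g d : PolyPair ns nf l p) :
    energy R B ΔT (g + d) = 1 / 2 * energy R B ΔT (d + (2 : ℝ) • g) + 1 / 2 * energy R B ΔT d
      - energy R B ΔT g := by
  simp only [energy, PolyPair.vel_add, PolyPair.vel_smul, map_add, map_smul,
    _root_.add_apply, _root_.smul_apply, smul_eq_mul, Finset.mul_sum, ← Finset.sum_add_distrib,
    ← Finset.sum_sub_distrib]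
  refine Finset.sum_congr rfl fun m _ => Finset.sum_congr rfl fun i _ => ?_
  rw [hB (d.vel m _) (g.vel m _)]
  ring

/-- Zero energy makes the velocity of every piece vanish. A continuous test curve starting at zero
is then zero on all micro intervals, and so are its coefficients. -/
theorem energy_pos {κ : ℝ} (hκ : 0 < κ)
    (hcoer : ∀ w : ℝ → Config ns nf, IsPoly l w → ∀ t ∈ Icc (0 : ℝ) 1,
      κ * ‖w t‖ ^ 2 ≤ ∑ i, R.b i * B (w (R.c i)) (w (R.c i)))
    (hp : 1 ≤ p) (hΔT : 0 < ΔT) {d : PolyPair ns nf l p} (hd : d ∈ PolyPair.tests ns nf l p ΔT)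
    (hd0 : d ≠ 0) : 0 < energy R B ΔT d := by
  have hδ0 : 0 < ΔT / p := div_pos hΔT (by exact_mod_cast hp)
  have hge := fun m t ht => piece_energy_ge (κ := κ) (B := B) (R := R) hcoer hp hΔT d m (t := t) ht
  have h0 : ∀ m ∈ (Finset.univ : Finset (Fin p)),
      0 ≤ ∑ i, R.b i * B (d.vel m (node R ΔT m i)) (d.vel m (node R ΔT m i)) := fun m _ =>
    le_trans (by positivity) (hge m _ (left_mem_Icc.2 (by linarith)))
  refine lt_of_le_of_ne (energy_nonneg hκ hcoer hp hΔT d) fun hz => hd0 ?_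
  have hz' := fun m => (Finset.sum_eq_zero_iff_of_nonneg h0).1 hz.symm m (Finset.mem_univ m)
  have hvan := norm_piece_le_sum d.pos hδ0.le (fun m => (d.isPoly_pos m).differentiable)
    hd.1.pos_eq hd.2.pos_zero (fun _ => 0) (fun m t ht => by
      have := hge m t ht
      rw [hz' m] at this
      rw [d.deriv_pos]
      have h3 : ‖d.vel m t‖ ^ 2 ≤ 0 := by
        by_contra! h; nlinarith [mul_pos hκ h]
      exact (pow_eq_zero_iff two_ne_zero).1 (le_antisymm h3 (sq_nonneg _)) |>.le)
  have hzero : ∀ m, (fun k => (d.1 k, d.2 m k)) = 0 := fun m =>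
    eq_zero_of_pval_eq_zero (x := (m : ℕ) * (ΔT / p)) (y := (m : ℕ) * (ΔT / p) + ΔT / p)
      (by linarith) fun t ht => by
        have := hvan m t ht
        rw [← d.pos_eq_pval]
        simpa using this
  refine Prod.ext (funext fun k => ?_) (funext fun m => funext fun k => ?_)
  · exact congrArg Prod.fst (congrFun (hzero ⟨0, hp⟩) k)
  · exact congrArg Prod.snd (congrFun (hzero m) k)

theorem le_discAction (hΔT : 0 ≤ ΔT) {L : ℝ} (hUL : ∀ q, |U q| ≤ L) (g : PolyPair ns nf l p) :
    (ΔT / p) * (1 / 2 * energy R B ΔT g - p * ((∑ i, |R.b i|) * L)) ≤ discAction R B U ΔT g := by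
  refine mul_le_mul_of_nonneg_left ?_ (by positivity)
  have e : ∑ m : Fin p, ∑ i, R.b i * lag B U (g.pos m (node R ΔT m i)) (g.vel m (node R ΔT m i))
      = 1 / 2 * energy R B ΔT g - ∑ m : Fin p, ∑ i, R.b i * U (g.pos m (node R ΔT m i)) := by
    simp only [energy, lag, Finset.mul_sum, ← Finset.sum_sub_distrib]
    exact Finset.sum_congr rfl fun m _ => Finset.sum_congr rfl fun i _ => by ring
  rw [e]
  have : ∑ m : Fin p, ∑ i, R.b i * U (g.pos m (node R ΔT m i)) ≤ p * ((∑ i, |R.b i|) * L) := by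
    refine (Finset.sum_le_card_nsmul _ _ ((∑ i, |R.b i|) * L) fun m _ => ?_).trans_eq (by simp)
    rw [Finset.sum_mul]
    refine Finset.sum_le_sum fun i _ => (le_abs_self _).trans ?_
    rw [abs_mul]
    exact mul_le_mul_of_nonneg_left (hUL _) (abs_nonneg _)
  linarith

/-- Minimisers of a continuous function with quadratic growth on a subspace. -/
theorem exists_min_of_coercive {F : Type*} [NormedAddCommGroup F] [NormedSpace ℝ F]
    [FiniteDimensional ℝ F] (V : Submodule ℝ F) (J : F → ℝ) (hJ : Continuous J) {c K : ℝ}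
    (hc : 0 < c) (h : ∀ d ∈ V, c * ‖d‖ ^ 2 - K ≤ J d) : ∃ d ∈ V, ∀ e ∈ V, J d ≤ J e := by
  have h1 : Tendsto (fun d : V => c * ‖d‖ ^ 2 - K) (cocompact _) atTop :=
    tendsto_atTop_add_const_right _ _ (Tendsto.const_mul_atTop hc
      ((tendsto_pow_atTop two_ne_zero).comp tendsto_norm_cocompact_atTop))
  obtain ⟨d, hd⟩ := (hJ.comp continuous_subtype_val).exists_forall_le
    (tendsto_atTop_mono (fun d : V => h d d.2) h1)
  exact ⟨d, d.2, fun e he => hd ⟨e, he⟩⟩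

/-- Existence of critical points of the discrete action for a bounded smooth potential. -/
theorem exists_discrete_critical {κ : ℝ} (hκ : 0 < κ)
    (hcoer : ∀ w : ℝ → Config ns nf, IsPoly l w → ∀ t ∈ Icc (0 : ℝ) 1,
      κ * ‖w t‖ ^ 2 ≤ ∑ i, R.b i * B (w (R.c i)) (w (R.c i)))
    (hB : ∀ v w, B v w = B w v) (hU : Differentiable ℝ U) {L : ℝ} (hUL : ∀ q, |U q| ≤ L)
    (hf : ∀ q w, B (f q) w = -fderiv ℝ U q w)
    (hp : 1 ≤ p) (hΔT : 0 < ΔT) (ℓ : PolyPair ns nf l p) :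
    ∃ d ∈ PolyPair.tests ns nf l p ΔT, ∀ e ∈ PolyPair.tests ns nf l p ΔT,
      firstVar R B f ΔT (ℓ + d) e = 0 := by
  have hδ0 : 0 < ΔT / p := div_pos hΔT (by exact_mod_cast hp)
  obtain ⟨c, hc, hcQ⟩ := exists_coercive (E := PolyPair.tests ns nf l p ΔT)
    (fun d => energy R B ΔT (d : PolyPair ns nf l p)) (continuous_energy.comp continuous_subtype_val)
    (fun c d => energy_smul c _)
    (fun d hd => energy_pos hκ hcoer hp hΔT d.2 (by simpa using hd))
  have hJc : Continuous fun d : PolyPair ns nf l p => discAction R B U ΔT (ℓ + d) :=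
    (continuous_discAction hU.continuous).comp (continuous_const.add continuous_id)
  obtain ⟨d, hd, hmin⟩ := exists_min_of_coercive (PolyPair.tests ns nf l p ΔT) _ hJc
    -- The factor `1 / 4` combines the `1 / 2` of the kinetic energy with the `1 / 2` of the
    -- parallelogram bound; the bounded potential and the energy of `ℓ` go into `K`.
    (c := (ΔT / p) * (1 / 4 * c))
    (K := (ΔT / p) * (1 / 2 * energy R B ΔT ℓ + p * ((∑ i, |R.b i|) * L))) (by positivity)
    (fun d hd => by
      refine le_trans ?_ (le_discAction hΔT.le hUL (ℓ + d))
      have h1 := hcQ ⟨d, hd⟩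
      have h2 := energy_add (R := R) (ΔT := ΔT) hB ℓ d
      have h3 := energy_nonneg hκ hcoer hp hΔT (d + (2 : ℝ) • ℓ)
      simp only [Submodule.coe_norm] at h1
      rw [mul_assoc, ← mul_sub]
      refine mul_le_mul_of_nonneg_left ?_ hδ0.le
      linarith)
  refine ⟨d, hd, fun e he => ?_⟩
  have hloc : IsLocalMin (fun ε : ℝ => discAction R B U ΔT ((ℓ + d) + ε • e)) 0 := by
    refine Eventually.of_forall fun ε => ?_
    have := hmin (d + ε • e) (Submodule.add_mem _ hd (Submodule.smul_mem _ _ he))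
    rw [← add_assoc] at this
    simpa using this
  have := hloc.hasDerivAt_eq_zero (hasDerivAt_discAction hB hU hf (ℓ + d) e)
  exact (mul_eq_zero.1 this).resolve_left hδ0.ne'

end DiscreteAction

end Multirate

namespace Multirate

/-! ### Further operations on bounded polynomials -/

section PolyBoundOps

variable {E F : Type*} [NormedAddCommGroup E] [NormedSpace ℝ E]
  [NormedAddCommGroup F] [NormedSpace ℝ F]

theorem PolyBound.add {n : ℕ} {C D : ℝ} {f g : ℝ → E} (hf : PolyBound n C f)
    (hg : PolyBound n D g) : PolyBound n (C + D) (fun t => f t + g t) := by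
  obtain ⟨a, ha, rfl⟩ := hf
  obtain ⟨b, hb, rfl⟩ := hg
  exact ⟨a + b, (norm_add_le _ _).trans (add_le_add ha hb), funext fun t => (pval_add a b t).symm⟩

theorem PolyBound.succ {n : ℕ} {C : ℝ} {f : ℝ → E} (h : PolyBound n C f) :
    PolyBound (n + 1) C f := by
  have hC := h.nonneg
  obtain ⟨a, ha, rfl⟩ := h
  refine ⟨Fin.snoc a 0, (pi_norm_le_iff_of_nonneg hC).2 fun k => ?_, funext fun t => ?_⟩
  · refine Fin.lastCases ?_ (fun k => ?_) k
    · simpa using hC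
    · simpa using (norm_le_pi_norm a k).trans ha
  · simp [pval, Fin.sum_univ_castSucc]

theorem PolyBound.mono {n m : ℕ} {C : ℝ} {f : ℝ → E} (h : PolyBound n C f) (hnm : n ≤ m) :
    PolyBound m C f := by
  induction hnm with
  | refl => exact h
  | step _ ih => exact ih.succ

theorem PolyBound.fst {n : ℕ} {C : ℝ} {f : ℝ → E × F} (h : PolyBound n C f) :
    PolyBound n C (fun t => (f t).1) := by
  have hC := h.nonneg
  obtain ⟨a, ha, rfl⟩ := h
  exact ⟨fun k => (a k).1, (pi_norm_le_iff_of_nonneg hC).2 fun k =>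
    (norm_fst_le _).trans ((norm_le_pi_norm a k).trans ha),
    funext fun t => (pval_map (LinearMap.fst ℝ E F) a t).symm⟩

theorem PolyBound.prodMk {n : ℕ} {C : ℝ} {f : ℝ → E} {g : ℝ → F} (hf : PolyBound n C f)
    (hg : PolyBound n C g) : PolyBound n C (fun t => (f t, g t)) := by
  have hC := hf.nonneg
  obtain ⟨a, ha, rfl⟩ := hf
  obtain ⟨b, hb, rfl⟩ := hg
  refine ⟨fun k => (a k, b k), (pi_norm_le_iff_of_nonneg hC).2 fun k =>
    max_le ((norm_le_pi_norm a k).trans ha) ((norm_le_pi_norm b k).trans hb), funext fun t => ?_⟩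
  simp only [pval]
  exact Prod.ext (by simp [Prod.fst_sum]) (by simp [Prod.snd_sum])

/-- The polynomial of degree one with given end points. -/
theorem exists_linear_curve {n : ℕ} (hn : 2 ≤ n) {h : ℝ} (h0 : 0 < h) (y₀ y₁ : E) :
    ∃ Y : ℝ → E, IsPoly n Y ∧ Y 0 = y₀ ∧ Y h = y₁ ∧ (∀ t, deriv (deriv Y) t = 0) ∧
      ∀ t ∈ Icc 0 h, ‖Y t - y₀‖ ≤ ‖y₁ - y₀‖ := by
  have hd : ∀ t : ℝ, HasDerivAt (fun t : ℝ => y₀ + t • (h⁻¹ • (y₁ - y₀))) (h⁻¹ • (y₁ - y₀)) t :=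
    fun t => by simpa using ((hasDerivAt_id t).smul_const (h⁻¹ • (y₁ - y₀))).const_add y₀
  refine ⟨fun t => y₀ + t • (h⁻¹ • (y₁ - y₀)), ((isPoly_const (n := 2) (by norm_num) _).add
    (isPoly_const (n := 1) le_rfl _).smul_id).mono hn, by simp, by simp [smul_smul, h0.ne'],
    fun t => ?_, fun t ht => ?_⟩
  · rw [funext fun s => (hd s).deriv]
    simp
  · rw [add_sub_cancel_left, smul_smul, norm_smul, ← div_eq_mul_inv,
      Real.norm_of_nonneg (div_nonneg ht.1 h0.le)]
    exact mul_le_of_le_one_left (norm_nonneg _) ((div_le_one h0).2 ht.2)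

end PolyBoundOps

/-- Every time lies in a micro interval. -/
theorem exists_mem_piece {p : ℕ} (hp : 1 ≤ p) {h : ℝ} (h0 : 0 < h) {t : ℝ} (ht : t ∈ Icc 0 h) :
    ∃ m : Fin p, t ∈ Icc ((m : ℕ) * (h / p)) ((m : ℕ) * (h / p) + h / p) := by
  have hp' : (0 : ℝ) < p := by exact_mod_cast hp
  have hδ : 0 < h / p := by positivity
  -- At the right end point the floor would return the index `p`, so the last piece is chosen by
  -- hand.
  rcases ht.2.eq_or_lt with rfl | hlt
  · refine ⟨⟨p - 1, by omega⟩, ?_, ?_⟩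
    · have : ((p - 1 : ℕ) : ℝ) ≤ p := by exact_mod_cast Nat.sub_le p 1
      calc _ ≤ (p : ℝ) * (t / p) := mul_le_mul_of_nonneg_right this hδ.le
        _ = t := by field_simp
    · rw [Nat.cast_sub hp]
      refine le_of_eq ?_
      field_simp
      push_cast
      ring
  · have hq : 0 ≤ t / (h / p) := div_nonneg ht.1 hδ.le
    refine ⟨⟨⌊t / (h / p)⌋₊, ?_⟩, ?_, ?_⟩
    · rw [Nat.floor_lt hq, div_lt_iff₀ hδ]
      calc t < h := hlt
        _ = p * (h / p) := by field_simp
    · exact (le_div_iff₀ hδ).1 (Nat.floor_le hq)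
    · have := (Nat.lt_floor_add_one (t / (h / p))).le
      rw [div_le_iff₀ hδ] at this
      linarith

/-- A mechanical system with a globally smooth, bounded potential `U`, mass form `B` and
acceleration field `f`, together with the constants needed in the estimates. -/
structure Model (R : QuadratureRule) (l ns nf : ℕ) where
  B : Config ns nf →L[ℝ] Config ns nf →L[ℝ] ℝ
  U : Config ns nf → ℝ
  f : Config ns nf → Config ns nf
  L : ℝ
  c : ℝ
  κ : ℝ
  comm : ∀ v w, B v w = B w v
  block : ∀ a b, B (a, 0) (0, b) = 0
  c_pos : 0 < c
  B_ge : ∀ v, c * ‖v‖ ^ 2 ≤ B v v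
  κ_pos : 0 < κ
  coercive : ∀ w : ℝ → Config ns nf, IsPoly l w → ∀ t ∈ Icc (0 : ℝ) 1,
    κ * ‖w t‖ ^ 2 ≤ ∑ i, R.b i * B (w (R.c i)) (w (R.c i))
  U_smooth : ContDiff ℝ ∞ U
  f_smooth : ContDiff ℝ ∞ f
  f_spec : ∀ q w, B (f q) w = -fderiv ℝ U q w
  L_nonneg : 0 ≤ L
  f_lip : ∀ x y, ‖f x - f y‖ ≤ L * ‖x - y‖
  f_bdd : ∀ q, ‖f q‖ ≤ L
  U_bdd : ∀ q, |U q| ≤ L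
  U_taylor : ∀ x y, |U y - U x - fderiv ℝ U x (y - x)| ≤ L * ‖y - x‖ ^ 2

/-- A single polynomial curve as a multirate polynomial curve. -/
theorem PolyPair.exists_of_isPoly {l ns nf : ℕ} {Y : ℝ → Config ns nf} (hY : IsPoly (l + 1) Y)
    (p : ℕ) : ∃ G : PolyPair ns nf l p,
      (∀ t, polyCurve G.1 t = (Y t).1) ∧ ∀ m t, polyCurve (G.2 m) t = (Y t).2 := by
  obtain ⟨a, rfl⟩ := hY
  exact ⟨(fun k => (a k).1, fun _ k => (a k).2),
    fun t => pval_map (LinearMap.fst ℝ (EuclideanSpace ℝ (Fin ns)) (EuclideanSpace ℝ (Fin nf))) a t,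
    fun _ t => pval_map (LinearMap.snd ℝ (EuclideanSpace ℝ (Fin ns)) (EuclideanSpace ℝ (Fin nf))) a t⟩

/-- A multirate polynomial curve with vanishing slow part and given fast pieces. -/
theorem PolyPair.exists_fast {l ns nf p : ℕ} {F : Fin p → ℝ → EuclideanSpace ℝ (Fin nf)}
    (hF : ∀ m, IsPoly (l + 1) (F m)) : ∃ d : PolyPair ns nf l p,
      (∀ t, polyCurve d.1 t = 0) ∧ ∀ m, polyCurve (d.2 m) = F m := by
  choose a ha using hF
  exact ⟨(0, a), fun t => by simp [polyCurve], fun m => (ha m).symm⟩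

/-! ### Multirate Galerkin estimate and fast increments -/

namespace Model

variable {R : QuadratureRule} {l ns nf p : ℕ} (M : Model R l ns nf)

/-- The Galerkin estimate for multirate critical points. -/
theorem exists_galerkin_bound {N : ℕ} (hR : R.ExactTo N) :
    ∃ C, 0 < C ∧ ∀ p : ℕ, 1 ≤ p → ∀ h L ε : ℝ, 0 < h → 0 ≤ L → 0 ≤ ε → C * L * h ^ 2 ≤ 1 →
      ∀ (g : PolyPair ns nf l p) (Y : ℝ → Config ns nf) (n : ℕ),
      IsPoly (n + 1) Y → n ≤ l → n + l ≤ N + 2 → g.IsContinuous h → g.HasEndpoints h (Y 0) (Y h) →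
      (∀ d ∈ PolyPair.tests ns nf l p h, firstVar R M.B M.f h g d = 0) →
      (∀ m i, ‖M.f (g.pos m (node R h m i)) - deriv (deriv Y) (node R h m i)‖ ≤
        L * ‖g.pos m (node R h m i) - Y (node R h m i)‖ + ε) →
      ∀ m : Fin p, ∀ t ∈ Icc ((m : ℕ) * (h / p)) ((m : ℕ) * (h / p) + h / p),
        ‖g.pos m t - Y t‖ ≤ C * h ^ 2 * ε := by
  obtain ⟨C, hC, H⟩ := galerkin_estimate R hR M.B M.κ_pos M.coercive
  refine ⟨C, hC, fun p hp h L ε hh hL hε hsmall g Y n hY hnl hnN hgc hge horth hacc => ?_⟩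
  obtain ⟨G, hG1, hG2⟩ := PolyPair.exists_of_isPoly (hY.mono (show n + 1 ≤ l + 1 by omega)) p
  have hGpos : ∀ m, G.pos m = Y := fun m => funext fun t => Prod.ext (hG1 t) (hG2 m t)
  -- The difference of `g` and `Y` is itself an admissible test curve. This is why `Y` must have
  -- degree at most `l`.
  have hd : g + (-1 : ℝ) • G ∈ PolyPair.tests ns nf l p h := by
    refine ⟨hgc.add_smul (fun m m' _ => by rw [hG2, hG2]) (-1), ?_⟩
    have := hge.add_smul (d := G) (r₀ := Y 0) (r₁ := Y h) ⟨⟨hG1 0, hG1 h⟩, fun m _ => hG2 m 0,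
      fun m _ => hG2 m h⟩ (-1)
    simpa using this
  have hdpos : ∀ m t, (g + (-1 : ℝ) • G).pos m t = g.pos m t - Y t := fun m t => by
    rw [PolyPair.pos_add, PolyPair.pos_smul, hGpos]; simp [sub_eq_add_neg]
  have hdvel : ∀ m, (g + (-1 : ℝ) • G).vel m = deriv fun t => g.pos m t - Y t := fun m => by
    rw [← PolyPair.deriv_pos]
    congr 1
    exact funext (hdpos m)
  refine H p hp h L ε hh hL hε hsmall g.pos Y (fun m i => M.f (g.pos m (node R h m i))) n
    g.isPoly_pos hY hnl hnN hgc.pos_eq hge.pos_zero hge.pos_last hacc ?_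
  have := horth _ hd
  simp only [firstVar, hdpos, hdvel] at this
  simpa only [PolyPair.deriv_pos, node] using this

/-- Bounds for the mean fast velocities of a discrete critical curve on the micro intervals. -/
theorem exists_fast_increment_bound {N : ℕ} (hl : 1 ≤ l) (hR : R.ExactTo N) (hN : l ≤ N + 1)
    {C₀ : ℝ} (hC₀ : 0 ≤ C₀) :
    ∃ C, 0 ≤ C ∧ ∀ p : ℕ, 1 ≤ p → ∀ h : ℝ, 0 < h → h ≤ 1 → ∀ (g : PolyPair ns nf l p)
      (q₀ q₁ : Config ns nf), ‖q₁ - q₀‖ ≤ C₀ * h → g.IsContinuous h → g.HasEndpoints h q₀ q₁ →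
      (∀ d ∈ PolyPair.tests ns nf l p h, firstVar R M.B M.f h g d = 0) →
      ∀ m : Fin p, ‖(g.pos m ((m : ℕ) * (h / p) + h / p)).2 - (g.pos m ((m : ℕ) * (h / p))).2‖ ≤
        C * (h / p) := by
  refine ⟨‖M.B‖ * (C₀ + (∑ i, |R.b i|) * M.L) / M.c, div_nonneg (mul_nonneg (norm_nonneg M.B)
    (add_nonneg hC₀ (mul_nonneg (by positivity) M.L_nonneg))) M.c_pos.le, ?_⟩
  intro p hp h h0 h1 g q₀ q₁ hq hgc hge horth m
  have hp' : (0 : ℝ) < p := by exact_mod_cast hp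
  set δ := h / p with hδ
  have hδ0 : 0 < δ := by positivity
  have hpδ : p * δ = h := by rw [hδ]; field_simp
  set Δ : Fin p → Config ns nf := fun m => g.pos m ((m : ℕ) * δ + δ) - g.pos m ((m : ℕ) * δ) with hΔ
  set e : EuclideanSpace ℝ (Fin nf) := (Δ m).2 with he
  -- the test curve: it rises on the `m`-th micro interval
  set α : Fin p → ℝ := fun k => if k < m then 0 else if k = m then -((m : ℕ) * δ) else δ with hα
  -- Unit slope on the `m`-th micro interval, with the mean slope `1 / p` removed everywhere so that
  -- the curve returns to zero at time `h`. Its size never exceeds `δ`.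
  set β : Fin p → ℝ := fun k => (if k = m then 1 else 0) - 1 / p with hβ
  have hFp : ∀ k, IsPoly (l + 1) (fun t : ℝ => (α k + β k * t) • e) := fun k => by
    have h2 := ((isPoly_const (n := 1) le_rfl (β k • e)).smul_id).add
      (isPoly_const (n := 2) (by norm_num) (α k • e))
    refine IsPoly.mono (n := 2) ?_ (by omega)
    convert h2 using 2 with t
    rw [add_smul, smul_smul, mul_comm t, add_comm]
  obtain ⟨d, hd1, hd2⟩ := PolyPair.exists_fast (ns := ns) hFp
  have hdpos : ∀ k t, d.pos k t = (0, (α k + β k * t) • e) := fun k t =>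
    Prod.ext (hd1 t) (congrFun (hd2 k) t)
  have hdvel : ∀ k t, d.vel k t = (0, β k • e) := fun k t => by
    rw [← PolyPair.deriv_pos, show d.pos k = _ from funext (hdpos k)]
    have hlin : HasDerivAt (fun t : ℝ => α k + β k * t) (β k) t := by
      simpa using ((hasDerivAt_id t).const_mul (β k)).const_add (α k)
    exact ((hasDerivAt_const t (0 : EuclideanSpace ℝ (Fin ns))).prodMk (hlin.smul_const e)).deriv
  have hdt : d ∈ PolyPair.tests ns nf l p h := by
    refine ⟨fun k k' hk => ?_, ⟨hd1 0, hd1 h⟩, fun k hk => ?_, fun k hk => ?_⟩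
    · rw [hd2, hd2]
      refine congrArg (· • e) ?_
      have hkk : ((k' : ℕ) : ℝ) = (k : ℕ) + 1 := by exact_mod_cast hk
      have hmk : k = m → ((m : ℕ) : ℝ) = (k : ℕ) := by rintro rfl; rfl
      have hmk' : k' = m → ((m : ℕ) : ℝ) = (k : ℕ) + 1 := by rintro rfl; exact hkk
      simp only [hα, hβ, Fin.lt_def, Fin.ext_iff, hkk, ← hδ]
      rcases lt_trichotomy (k : ℕ) (m : ℕ) with hlt | heq | hgt
      · rw [if_pos hlt, if_neg (show ¬ (k : ℕ) = m by omega)]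
        by_cases hk'm : (k' : ℕ) = m
        · rw [if_neg (show ¬ (k' : ℕ) < m by omega), if_pos hk'm, if_pos hk'm,
            hmk' (Fin.ext hk'm)]
          ring
        · rw [if_pos (show (k' : ℕ) < m by omega), if_neg hk'm]
      · rw [if_neg (show ¬ (k : ℕ) < m by omega), if_pos heq, if_pos heq,
          if_neg (show ¬ (k' : ℕ) < m by omega), if_neg (show ¬ (k' : ℕ) = m by omega),
          if_neg (show ¬ (k' : ℕ) = m by omega), hmk (Fin.ext heq)]
        ring
      · rw [if_neg (show ¬ (k : ℕ) < m by omega), if_neg (show ¬ (k : ℕ) = m by omega),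
          if_neg (show ¬ (k : ℕ) = m by omega),
          if_neg (show ¬ (k' : ℕ) < m by omega), if_neg (show ¬ (k' : ℕ) = m by omega),
          if_neg (show ¬ (k' : ℕ) = m by omega)]
    · rw [hd2]
      have : α k = 0 := by
        simp only [hα, Fin.lt_def, Fin.ext_iff, hk]
        split_ifs with h2 h3
        · rfl
        · simp [← h3]
        · omega
      simp [this]
    · rw [hd2]
      have : α k + β k * h = 0 := by
        have hm := m.2
        have hkp : ((k : ℕ) : ℝ) + 1 = p := by exact_mod_cast hk
        simp only [hα, hβ, Fin.lt_def, Fin.ext_iff]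
        by_cases hkm : (k : ℕ) = m
        · rw [if_neg (by omega), if_pos hkm, if_pos hkm, ← hkm, ← hpδ,
            show ((k : ℕ) : ℝ) = p - 1 by linarith]
          field_simp
          ring
        · rw [if_neg (by omega), if_neg hkm, if_neg hkm, ← hpδ]
          field_simp
          ring
      simp [this]
  have hbound : ∀ k : Fin p, ∀ t ∈ Icc ((k : ℕ) * δ) ((k : ℕ) * δ + δ), |α k + β k * t| ≤ δ := by
    intro k t ht
    have hkp : ((k : ℕ) : ℝ) + 1 ≤ p := by exact_mod_cast k.2
    have hk0 : (0 : ℝ) ≤ (k : ℕ) := Nat.cast_nonneg _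
    have ht0 : 0 ≤ t := le_trans (by positivity) ht.1
    have hth : t ≤ p * δ := ht.2.trans (by nlinarith)
    have htp0 : 0 ≤ 1 / p * t := by positivity
    have htp : 1 / p * t ≤ δ := by
      rw [one_div, inv_mul_le_iff₀ hp']; exact hth
    simp only [hα, hβ]
    rw [abs_le]
    rcases lt_trichotomy k m with hlt | rfl | hgt
    · rw [if_pos hlt, if_neg hlt.ne]
      constructor <;> linarith
    · rw [if_neg (lt_irrefl _), if_pos rfl, if_pos rfl]
      constructor <;> linarith [ht.1, ht.2]
    · rw [if_neg hgt.not_gt, if_neg hgt.ne', if_neg hgt.ne']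
      constructor <;> linarith
  -- The velocity has degree at most `l - 1 ≤ N`, so the rule recovers the increment of each piece
  -- exactly.
  have hmean : ∀ k, δ * ∑ i, R.b i * M.B (g.vel k (node R h k i)) (0, e) = M.B (Δ k) (0, e) := by
    intro k
    have h2 := hR.sum_deriv ((g.isPoly_pos k).mono (show l + 1 ≤ N + 2 by omega)) δ ((k : ℕ) * δ)
    have h3 := congrArg (fun v => M.B v (0, e)) h2
    simp only [map_smul, map_sum, _root_.smul_apply, _root_.sum_apply, smul_eq_mul,
      g.deriv_pos] at h3
    exact h3
  have htot : ∑ k, Δ k = q₁ - q₀ :=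
    sum_pieces_telescope hp g.pos hpδ hgc.pos_eq hge.pos_zero hge.pos_last
  have hvar := horth d hdt
  have hsplit : firstVar R M.B M.f h g d =
      ∑ k, β k * ∑ i, R.b i * M.B (g.vel k (node R h k i)) (0, e) +
      ∑ k : Fin p, ∑ i, R.b i * ((α k + β k * node R h k i) *
        M.B (M.f (g.pos k (node R h k i))) (0, e)) := by
    rw [← Finset.sum_add_distrib]
    refine Finset.sum_congr rfl fun k _ => ?_
    rw [Finset.mul_sum, ← Finset.sum_add_distrib]
    refine Finset.sum_congr rfl fun i _ => ?_
    rw [hdpos, hdvel]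
    have s1 : ∀ c : ℝ, ((0, c • e) : Config ns nf) = c • ((0, e) : Config ns nf) := fun c => by
      simp
    rw [s1, s1, map_smul, map_smul, smul_eq_mul, smul_eq_mul]
    ring
  have hfirst : δ * ∑ k, β k * ∑ i, R.b i * M.B (g.vel k (node R h k i)) (0, e)
      = M.B (Δ m) (0, e) - 1 / p * M.B (q₁ - q₀) (0, e) := by
    have s2 : δ * ∑ k, β k * ∑ i, R.b i * M.B (g.vel k (node R h k i)) (0, e)
        = ∑ k, β k * M.B (Δ k) (0, e) := by
      rw [Finset.mul_sum]
      refine Finset.sum_congr rfl fun k _ => ?_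
      rw [← hmean k]; ring
    rw [s2, ← htot]
    simp only [hβ, sub_mul, Finset.sum_sub_distrib, ite_mul, one_mul, zero_mul, Finset.sum_ite_eq',
      Finset.mem_univ, if_true, map_sum, _root_.sum_apply, Finset.mul_sum]
  have hnorm0e : ‖((0, e) : Config ns nf)‖ = ‖e‖ := by simp [Prod.norm_def]
  have hsecond : |∑ k : Fin p, ∑ i, R.b i * ((α k + β k * node R h k i) *
      M.B (M.f (g.pos k (node R h k i))) (0, e))| ≤
      p * ((∑ i, |R.b i|) * (δ * (‖M.B‖ * M.L * ‖e‖))) := by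
    refine (Finset.abs_sum_le_sum_abs _ _).trans ((Finset.sum_le_card_nsmul _ _
      ((∑ i, |R.b i|) * (δ * (‖M.B‖ * M.L * ‖e‖))) fun k _ => ?_).trans_eq (by simp))
    refine (Finset.abs_sum_le_sum_abs _ _).trans ?_
    rw [Finset.sum_mul]
    refine Finset.sum_le_sum fun i _ => ?_
    rw [abs_mul, abs_mul]
    have b1 := hbound k _ (node_mem R h0.le k i)
    have b2 : |M.B (M.f (g.pos k (node R h k i))) (0, e)| ≤ ‖M.B‖ * M.L * ‖e‖ := by
      have := M.B.le_opNorm₂ (M.f (g.pos k (node R h k i))) (0, e)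
      rw [hnorm0e, Real.norm_eq_abs] at this
      refine this.trans ?_
      have := M.f_bdd (g.pos k (node R h k i))
      gcongr
    exact mul_le_mul_of_nonneg_left (mul_le_mul b1 b2 (abs_nonneg _) hδ0.le) (abs_nonneg _)
  rw [hsplit] at hvar
  -- The mass form has no slow–fast cross terms, so a fast test direction sees only the fast
  -- increment.
  have hBe : M.B (Δ m) (0, e) = M.B (0, e) (0, e) := by
    have : Δ m = ((Δ m).1, 0) + (0, e) := by simp [he]
    conv_lhs => rw [this]
    rw [map_add, _root_.add_apply, M.block, zero_add]
  have hge2 := M.B_ge (0, e)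
  rw [hnorm0e] at hge2
  have hq2 : |M.B (q₁ - q₀) (0, e)| ≤ ‖M.B‖ * (C₀ * h) * ‖e‖ := by
    have := M.B.le_opNorm₂ (q₁ - q₀) (0, e)
    rw [hnorm0e, Real.norm_eq_abs] at this
    refine this.trans ?_
    gcongr
  -- The mean increment contributes `C₀ * h / p = C₀ * δ`. The force contributes `p` pieces, each
  -- with weight `δ` and a test curve of size `δ`, that is `h * δ ≤ δ`.
  have hmain : M.c * ‖e‖ ^ 2 ≤ δ * (‖M.B‖ * (C₀ + (∑ i, |R.b i|) * M.L)) * ‖e‖ := by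
    have s3 : M.B (0, e) (0, e) = 1 / p * M.B (q₁ - q₀) (0, e) -
        δ * ∑ k : Fin p, ∑ i, R.b i * ((α k + β k * node R h k i) *
        M.B (M.f (g.pos k (node R h k i))) (0, e)) := by
      rw [← hBe]
      have := congrArg (δ * ·) hvar
      simp only [mul_add, mul_zero] at this
      linarith
    have s4 : 1 / p * M.B (q₁ - q₀) (0, e) ≤ δ * (‖M.B‖ * C₀ * ‖e‖) := by
      have := mul_le_mul_of_nonneg_left ((le_abs_self _).trans hq2) (show 0 ≤ 1 / (p : ℝ) by positivity)
      refine this.trans_eq ?_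
      rw [hδ]; ring
    have s5 := mul_le_mul_of_nonneg_left ((neg_le_abs _).trans hsecond) hδ0.le
    have s6 : δ * (p * ((∑ i, |R.b i|) * (δ * (‖M.B‖ * M.L * ‖e‖)))) ≤
        δ * ((∑ i, |R.b i|) * (‖M.B‖ * M.L * ‖e‖)) := by
      have : δ * (p * ((∑ i, |R.b i|) * (δ * (‖M.B‖ * M.L * ‖e‖)))) =
        h * (δ * ((∑ i, |R.b i|) * (‖M.B‖ * M.L * ‖e‖))) := by rw [← hpδ]; ring
      rw [this]
      refine mul_le_of_le_one_left ?_ h1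
      have := M.L_nonneg
      positivity
    rw [mul_neg] at s5
    have s7 : δ * (‖M.B‖ * (C₀ + (∑ i, |R.b i|) * M.L)) * ‖e‖ =
      δ * (‖M.B‖ * C₀ * ‖e‖) + δ * ((∑ i, |R.b i|) * (‖M.B‖ * M.L * ‖e‖)) := by ring
    linarith
  change ‖e‖ ≤ _
  rw [div_mul_eq_mul_div, le_div_iff₀ M.c_pos]
  rcases (norm_nonneg e).eq_or_lt with hz | hz
  · rw [← hz, zero_mul]
    have := M.L_nonneg
    positivity
  · have : (M.c * ‖e‖) * ‖e‖ ≤ (δ * (‖M.B‖ * (C₀ + (∑ i, |R.b i|) * M.L))) * ‖e‖ := by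
      rw [← hδ] at *; linarith [hmain, sq ‖e‖]
    have := le_of_mul_le_mul_right this hz
    linarith

end Model

end Multirate

namespace Multirate

/-! ### Bounded coefficients of discrete critical curves, and their quadrature error -/

namespace Model

variable {R : QuadratureRule} {l ns nf p : ℕ} (M : Model R l ns nf)

theorem B_fast (v : Config ns nf) (b : EuclideanSpace ℝ (Fin nf)) :
    M.B v (0, b) = M.B (0, v.2) (0, b) := by
  have : v = (v.1, 0) + (0, v.2) := by simp
  conv_lhs => rw [this]
  rw [map_add, _root_.add_apply, M.block, zero_add]

/-- The mass form of the fast variables. -/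
noncomputable def fastForm :
    EuclideanSpace ℝ (Fin nf) →L[ℝ] EuclideanSpace ℝ (Fin nf) →L[ℝ] ℝ :=
  M.B.bilinearComp (ContinuousLinearMap.inr ℝ _ _) (ContinuousLinearMap.inr ℝ _ _)

theorem fastForm_apply (a b : EuclideanSpace ℝ (Fin nf)) :
    M.fastForm a b = M.B (0, a) (0, b) := rfl

theorem fastForm_coercive (w : ℝ → EuclideanSpace ℝ (Fin nf)) (hw : IsPoly l w) (t : ℝ)
    (ht : t ∈ Icc (0 : ℝ) 1) :
    M.κ * ‖w t‖ ^ 2 ≤ ∑ i, R.b i * M.fastForm (w (R.c i)) (w (R.c i)) := by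
  have := M.coercive (fun t => (0, w t))
    (hw.map (ContinuousLinearMap.inr ℝ (EuclideanSpace ℝ (Fin ns)) _)) t ht
  simpa [Prod.norm_def, fastForm_apply] using this

/-- The acceleration of the fast variables along a slow polynomial. -/
noncomputable def fastForce (a : Fin (l + 1) → EuclideanSpace ℝ (Fin ns)) (t : ℝ)
    (y : EuclideanSpace ℝ (Fin nf)) : EuclideanSpace ℝ (Fin nf) := (M.f (pval a t, y)).2

theorem contDiff_fastForce : ContDiff ℝ ∞ fun z : (Fin (l + 1) → EuclideanSpace ℝ (Fin ns)) × ℝ ×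
    EuclideanSpace ℝ (Fin nf) => M.fastForce z.1 z.2.1 z.2.2 := by
  have h := M.f_smooth
  refine contDiff_snd.comp (h.comp
    (f := fun z : (Fin (l + 1) → EuclideanSpace ℝ (Fin ns)) × ℝ × EuclideanSpace ℝ (Fin nf) =>
      ((pval z.1 z.2.1, z.2.2) : Config ns nf)) ?_)
  unfold pval
  fun_prop

theorem fastForce_lip (a : Fin (l + 1) → EuclideanSpace ℝ (Fin ns)) (t : ℝ)
    (y y' : EuclideanSpace ℝ (Fin nf)) :
    ‖M.fastForce a t y - M.fastForce a t y'‖ ≤ M.L * ‖y - y'‖ := by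
  have h1 := M.f_lip (pval a t, y) (pval a t, y')
  have h2 : ‖((pval a t, y) : Config ns nf) - (pval a t, y')‖ = ‖y - y'‖ := by
    simp [Prod.norm_def]
  rw [h2] at h1
  exact (norm_snd_le (M.f (pval a t, y) - M.f (pval a t, y'))).trans h1

/-- The first variation of a discrete critical curve in the direction of a fast polynomial
supported on one micro interval. -/
theorem firstVar_bubble (hp : 1 ≤ p) {h : ℝ} {g : PolyPair ns nf l p}
    (horth : ∀ d ∈ PolyPair.tests ns nf l p h, firstVar R M.B M.f h g d = 0) (m : Fin p)
    {w : ℝ → EuclideanSpace ℝ (Fin nf)} (hw : IsPoly (l + 1) w) (hw0 : w 0 = 0)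
    (hw1 : w (h / p) = 0) :
    ∑ i, R.b i * (M.fastForm (g.vel m (node R h m i)).2 (deriv w (R.c i * (h / p))) +
      M.fastForm (M.f (g.pos m (node R h m i))).2 (w (R.c i * (h / p)))) = 0 := by
  have hp' : (0 : ℝ) < p := by exact_mod_cast hp
  set δ := h / p with hδ
  have hpδ : p * δ = h := by rw [hδ]; field_simp
  have hws : IsPoly (l + 1) fun t => w (t - (m : ℕ) * δ) := by
    have := hw.comp_affine 1 (-((m : ℕ) * δ))
    simpa only [one_mul, neg_add_eq_sub] using this
  obtain ⟨d, hd1, hd2⟩ := PolyPair.exists_fast (ns := ns) (p := p)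
    (F := fun k t => if k = m then w (t - (m : ℕ) * δ) else 0) (fun k => by
      by_cases hk : k = m
      · simpa only [hk, if_true] using hws
      · simpa only [hk, if_false] using isPoly_zero (l + 1))
  have hd1' : polyCurve d.1 = fun _ => 0 := funext hd1
  replace hd2 : ∀ k t, polyCurve (d.2 k) t = if k = m then w (t - (m : ℕ) * δ) else 0 := fun k t => by
    rw [hd2]
  have hd3 : polyCurve (d.2 m) = fun t => w (t - (m : ℕ) * δ) := by
    funext t; rw [hd2, if_pos rfl]
  have hd4 : ∀ k, k ≠ m → polyCurve (d.2 k) = fun _ => 0 := fun k hk => by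
    funext t; rw [hd2, if_neg hk]
  have hdt : d ∈ PolyPair.tests ns nf l p h := by
    refine ⟨fun k k' hk => ?_, ⟨hd1 0, hd1 h⟩, fun k hk => ?_, fun k hk => ?_⟩
    · have hkk : ((k' : ℕ) : ℝ) = (k : ℕ) + 1 := by exact_mod_cast hk
      have z1 : polyCurve (d.2 k) ((k' : ℕ) * δ) = 0 := by
        rw [hd2]
        split_ifs with hkm
        · rw [hkk, hkm, show (((m : ℕ) : ℝ) + 1) * δ - (m : ℕ) * δ = δ by ring, hw1]
        · rfl
      have z2 : polyCurve (d.2 k') ((k' : ℕ) * δ) = 0 := by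
        rw [hd2]
        split_ifs with hkm
        · rw [hkm, sub_self, hw0]
        · rfl
      rw [z1, z2]
    · rw [hd2]
      by_cases hkm : k = m
      · rw [if_pos hkm, ← hkm, hk]; simp [hw0]
      · rw [if_neg hkm]; rfl
    · rw [hd2]
      by_cases hkm : k = m
      · have hkp : ((k : ℕ) : ℝ) + 1 = p := by exact_mod_cast hk
        rw [if_pos hkm, ← hkm, ← hpδ, ← hkp, show (((k : ℕ) : ℝ) + 1) * δ - (k : ℕ) * δ = δ by ring,
          hw1]
        rfl
      · rw [if_neg hkm]; rfl
  have hv := horth d hdt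
  rw [firstVar, Finset.sum_eq_single m] at hv
  · rw [← hv]
    refine Finset.sum_congr rfl fun i _ => ?_
    have e0 : node R h m i - (m : ℕ) * δ = R.c i * δ := by simp only [node, ← hδ]; ring
    have e1 : d.pos m (node R h m i) = (0, w (R.c i * δ)) := by
      refine Prod.ext (hd1 _) ?_
      simp only [PolyPair.pos, hd2, if_true, e0]
    have e2 : d.vel m (node R h m i) = (0, deriv w (R.c i * δ)) := by
      refine Prod.ext ?_ ?_
      · simp only [PolyPair.vel, hd1', deriv_const]
      · simp only [PolyPair.vel, hd3, deriv_comp_sub_const, e0]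
    rw [e1, e2, M.B_fast, M.B_fast (M.f _)]
    rfl
  · intro k _ hk
    refine Finset.sum_eq_zero fun i _ => ?_
    have e1 : d.pos k (node R h k i) = 0 := by
      refine Prod.ext (hd1 _) ?_
      simp only [PolyPair.pos, hd2, hk, if_false]
      rfl
    have e2 : d.vel k (node R h k i) = 0 := by
      refine Prod.ext ?_ ?_
      · simp only [PolyPair.vel, hd1', deriv_const]; rfl
      · simp only [PolyPair.vel, hd4 k hk, deriv_const]; rfl
    rw [e1, e2]
    simp
  · intro hm
    exact absurd (Finset.mem_univ m) hm

/-- An equality for `2 ≤ l`. For smaller `l` the truncated exponent is `0`, and `δ ≤ 1` makes up for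
it. -/
theorem pow_sub_two_le {δ : ℝ} (h0 : 0 ≤ δ) (h1 : δ ≤ 1) (l : ℕ) : δ ^ 2 * δ ^ (l - 2) ≤ δ ^ l := by
  rw [← pow_add]
  exact pow_le_pow_of_le_one h0 h1 (by omega)

/-- The fast pieces of a discrete critical curve have bounded coefficients. -/
theorem exists_fast_polyBound (hl : 1 ≤ l) (hR : R.ExactTo (l - 2 + (l - 1))) (C : ℝ) :
    ∃ h₁ K, 0 < h₁ ∧ h₁ ≤ 1 ∧ ∀ p : ℕ, 1 ≤ p → ∀ h : ℝ, 0 < h → h ≤ h₁ →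
      ∀ g : PolyPair ns nf l p,
      (∀ d ∈ PolyPair.tests ns nf l p h, firstVar R M.B M.f h g d = 0) → ∀ m : Fin p,
      PolyBound (l + 1) C (fun s => polyCurve g.1 ((m : ℕ) * (h / p) + s)) →
      ‖(g.pos m ((m : ℕ) * (h / p))).2‖ ≤ C →
      ‖(g.pos m ((m : ℕ) * (h / p) + h / p)).2 - (g.pos m ((m : ℕ) * (h / p))).2‖ ≤ C * (h / p) →
      PolyBound (l + 1) K (fun s => polyCurve (g.2 m) ((m : ℕ) * (h / p) + s)) := by
  obtain ⟨Cg, hCg, H⟩ := galerkin_estimate R hR M.fastForm M.κ_pos M.fastForm_coercive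
  obtain ⟨K₁, hK₁, H₁⟩ := exists_formal_solution M.fastForce M.contDiff_fastForce (C := C)
    M.L_nonneg M.fastForce_lip (l - 2)
  obtain ⟨K₂, H₂⟩ := exists_polyBound_of_small (E := EuclideanSpace ℝ (Fin nf)) l (Cg * K₁)
  have hL := M.L_nonneg
  have hden : 0 < Cg * M.L + 1 := by positivity
  refine ⟨1 / (Cg * M.L + 1), K₂ + K₁, by positivity,
    (div_le_one hden).2 (by linarith [mul_nonneg hCg.le hL]), ?_⟩
  intro p hp h h0 hh g horth m hslow hpos hinc
  have hp' : (1 : ℝ) ≤ p := by exact_mod_cast hp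
  have hh1 : h ≤ 1 := hh.trans ((div_le_one hden).2 (by linarith [mul_nonneg hCg.le hL]))
  set δ := h / p with hδ
  have hδ0 : 0 < δ := by positivity
  have hδh : δ ≤ h := div_le_self h0.le hp'
  have hδ1 : δ ≤ 1 := hδh.trans hh1
  obtain ⟨a, ha, haeq⟩ := hslow
  set γ : ℝ → EuclideanSpace ℝ (Fin nf) := fun s => polyCurve (g.2 m) ((m : ℕ) * δ + s) with hγ
  have hγp : IsPoly (l + 1) γ := by
    have : IsPoly (l + 1) (polyCurve (g.2 m)) := ⟨_, rfl⟩
    simpa only [one_mul] using this.comp_affine 1 ((m : ℕ) * δ)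
  have hγ0 : γ 0 = (g.pos m ((m : ℕ) * δ)).2 := by simp [hγ, PolyPair.pos]
  have hγ1 : γ δ = (g.pos m ((m : ℕ) * δ + δ)).2 := rfl
  -- An approximate solution of the fast equation alone, driven by the slow polynomial in the time
  -- of the micro interval. The increment bound supplies the required `O(δ)` distance of its end
  -- points.
  obtain ⟨Y, hY, hY0, hY1, hYr⟩ := H₁ a ha δ hδ0 hδ1 (γ 0) (γ δ) (by rw [hγ0]; exact hpos)
    (by rw [hγ0, hγ1]; exact hinc)
  have hYp : IsPoly (l + 1) Y := hY.isPoly.mono (by omega)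
  have hforce : ∀ i, (M.f (g.pos m (node R h m i))).2 = M.fastForce a (R.c i * δ) (γ (R.c i * δ)) :=
    fun i => by
      have e : pval a (R.c i * δ) = polyCurve g.1 (node R h m i) := (congrFun haeq _).symm
      rw [fastForce, e]
      rfl
  have hbub := M.firstVar_bubble hp horth m (w := fun t => γ t - Y t) (hγp.sub hYp)
    (by simp [hY0]) (by simp only [← hδ, hY1, sub_self])
  have hsmall : Cg * M.L * δ ^ 2 ≤ 1 := by
    have h2 : δ ^ 2 ≤ 1 / (Cg * M.L + 1) := by
      refine le_trans ?_ (hδh.trans hh)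
      rw [sq]
      exact mul_le_of_le_one_left hδ0.le hδ1
    have h3 : Cg * M.L * (1 / (Cg * M.L + 1)) ≤ 1 := by
      rw [mul_one_div, div_le_one hden]; linarith
    exact (mul_le_mul_of_nonneg_left h2 (by positivity)).trans h3
  -- The micro interval is treated as a single step of length `δ`. The degree `l - 2 + 1` of `Y` is
  -- the largest for which exactness of the rule is guaranteed.
  have hres := H 1 le_rfl δ M.L (K₁ * δ ^ (l - 2)) hδ0 hL (by positivity) hsmall (fun _ => γ) Y
    (fun _ i => M.fastForce a (R.c i * δ) (γ (R.c i * δ))) (l - 2 + 1) (fun _ => hγp) hY.isPoly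
    (by omega) (by omega) (fun k k' hk => by omega) (fun _ _ => hY0.symm) (fun _ _ => hY1.symm)
    (fun k i => by
      simp only [Fin.val_eq_zero, Nat.cast_zero, zero_mul, Nat.cast_one, div_one, zero_add]
      have hc := R.c_mem i
      have h2 := hYr (R.c i * δ) ⟨mul_nonneg hc.1 hδ0.le, mul_le_of_le_one_left hδ0.le hc.2⟩
      have h3 := M.fastForce_lip a (R.c i * δ) (γ (R.c i * δ)) (Y (R.c i * δ))
      have h4 := norm_add_le (M.fastForce a (R.c i * δ) (γ (R.c i * δ)) -
        M.fastForce a (R.c i * δ) (Y (R.c i * δ)))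
        (M.fastForce a (R.c i * δ) (Y (R.c i * δ)) - deriv (deriv Y) (R.c i * δ))
      rw [sub_add_sub_cancel] at h4
      linarith)
    (by
      simp only [Fin.val_eq_zero, Nat.cast_zero, zero_mul, Nat.cast_one, div_one, zero_add,
        Finset.univ_unique, Finset.sum_singleton]
      rw [← hbub]
      refine Finset.sum_congr rfl fun i _ => ?_
      rw [hforce]
      have e : deriv γ (R.c i * δ) = (g.vel m (node R h m i)).2 := by
        simp only [hγ, deriv_comp_const_add, PolyPair.vel]
        rfl
      rw [e])
  -- The difference has degree at most `l` and is `O(δ ^ l)` on an interval of length `δ`, so its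
  -- coefficients are bounded.
  have hsm : PolyBound (l + 1) K₂ fun t => γ t - Y t := by
    refine H₂ δ hδ0 hδ1 _ (hγp.sub hYp) fun t ht => ?_
    refine (hres 0 t (by simpa using ht)).trans ?_
    have := pow_sub_two_le hδ0.le hδ1 l
    calc Cg * δ ^ 2 * (K₁ * δ ^ (l - 2)) = Cg * K₁ * (δ ^ 2 * δ ^ (l - 2)) := by ring
      _ ≤ _ := by gcongr
  have := hsm.add (hY.mono (show l - 2 + 2 ≤ l + 1 by omega))
  simpa only [sub_add_cancel] using this

/-- For short macro steps there are discrete critical curves close to `q₀` whose pieces have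
bounded coefficients. -/
theorem exists_regular_discrete_critical (hl : 1 ≤ l) (hR : R.ExactTo (l - 2 + (l - 1)))
    (q₀ : Config ns nf) {C₀ : ℝ} (hC₀ : 0 ≤ C₀) :
    ∃ h₁ K, 0 < h₁ ∧ h₁ ≤ 1 ∧ 0 ≤ K ∧ ∀ p : ℕ, 1 ≤ p → ∀ h : ℝ, 0 < h → h ≤ h₁ →
      ∀ q₁ : Config ns nf, ‖q₁ - q₀‖ ≤ C₀ * h →
      ∃ g : PolyPair ns nf l p, g.IsContinuous h ∧ g.HasEndpoints h q₀ q₁ ∧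
        (∀ d ∈ PolyPair.tests ns nf l p h, firstVar R M.B M.f h g d = 0) ∧
        (∀ m : Fin p, ∀ t ∈ Icc ((m : ℕ) * (h / p)) ((m : ℕ) * (h / p) + h / p),
          ‖g.pos m t - q₀‖ ≤ K * h) ∧
        ∀ m : Fin p, PolyBound (l + 1) K (fun s => g.pos m ((m : ℕ) * (h / p) + s)) := by
  have hL := M.L_nonneg
  obtain ⟨Cg, hCg, H⟩ := M.exists_galerkin_bound hR
  obtain ⟨K₁, hK₁, H₁⟩ := exists_formal_solution (P := ℝ) (fun _ _ y => M.f y)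
    (M.f_smooth.comp (contDiff_snd.comp contDiff_snd)) (C := ‖q₀‖ + C₀) M.L_nonneg
    (fun _ _ => M.f_lip) (l - 2)
  obtain ⟨K₂, H₂⟩ := exists_polyBound_of_small (E := EuclideanSpace ℝ (Fin ns)) l (Cg * K₁)
  obtain ⟨K₄, hK₄, H₄⟩ := M.exists_fast_increment_bound hl hR (by omega) hC₀
  set K₀ : ℝ := C₀ + Cg * M.L with hK₀
  have hK₀0 : 0 ≤ K₀ := by positivity
  set K₃ : ℝ := 3 ^ (l + 1) * (K₂ + K₁) with hK₃
  set D : ℝ := |K₃| + K₄ + (‖q₀‖ + K₀) with hD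
  obtain ⟨h₂, K₅, hh₂, hh₂1, H₅⟩ := M.exists_fast_polyBound hl hR D
  have hden : 0 < Cg * M.L + 1 := by positivity
  refine ⟨min h₂ (1 / (Cg * M.L + 1)), K₀ + |K₃| + |K₅|, by positivity,
    (min_le_left _ _).trans hh₂1, by positivity, ?_⟩
  intro p hp h h0 hh q₁ hq
  have hp' : (1 : ℝ) ≤ p := by exact_mod_cast hp
  have hh1 : h ≤ 1 := hh.trans ((min_le_left _ _).trans hh₂1)
  have hhsq : h ^ 2 ≤ h := by rw [sq]; exact mul_le_of_le_one_left h0.le hh1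
  have hsmall : Cg * M.L * h ^ 2 ≤ 1 := by
    have h3 : Cg * M.L * (1 / (Cg * M.L + 1)) ≤ 1 := by
      rw [mul_one_div, div_le_one hden]; linarith
    exact (mul_le_mul_of_nonneg_left (hhsq.trans (hh.trans (min_le_right _ _)))
      (by positivity)).trans h3
  set δ := h / p with hδ
  have hδ0 : 0 < δ := by positivity
  have hpδ : p * δ = h := by rw [hδ]; field_simp
  obtain ⟨Y₀, hY₀p, hY₀0, hY₀1, hY₀2, hY₀b⟩ := exists_linear_curve (n := 2) le_rfl h0 q₀ q₁
  obtain ⟨G, hG1, hG2⟩ := PolyPair.exists_of_isPoly (hY₀p.mono (show 2 ≤ l + 1 by omega)) p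
  obtain ⟨d, hd, horth⟩ := exists_discrete_critical M.κ_pos M.coercive M.comm
    (M.U_smooth.differentiable (by simp)) M.U_bdd M.f_spec hp h0 G
  set g := G + d with hg
  have hGc : G.IsContinuous h := fun m m' _ => by rw [hG2, hG2]
  have hGe : G.HasEndpoints h q₀ q₁ := ⟨⟨by rw [hG1, hY₀0], by rw [hG1, hY₀1]⟩,
    fun m _ => by rw [hG2, hY₀0], fun m _ => by rw [hG2, hY₀1]⟩
  have hgc : g.IsContinuous h := by
    have := hGc.add_smul hd.1 1
    rwa [one_smul] at this
  have hge : g.HasEndpoints h q₀ q₁ := by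
    simpa only [one_smul, smul_zero, add_zero] using hGe.add_smul hd.2 1
  have hsub : ∀ m : Fin p, ∀ t ∈ Icc ((m : ℕ) * δ) ((m : ℕ) * δ + δ), t ∈ Icc 0 h := fun m t ht => by
    have hm : ((m : ℕ) : ℝ) + 1 ≤ p := by exact_mod_cast m.2
    refine ⟨le_trans (by positivity) ht.1, ht.2.trans ?_⟩
    rw [← hpδ]
    nlinarith
  -- Comparison with the straight line, whose residual is the bounded force itself; hence the
  -- Lipschitz constant `0` and `ε = M.L`. This requires no information on `g`.
  have hclose : ∀ m : Fin p, ∀ t ∈ Icc ((m : ℕ) * δ) ((m : ℕ) * δ + δ), ‖g.pos m t - q₀‖ ≤ K₀ * h := by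
    intro m t ht
    have h2 := H p hp h 0 M.L h0 le_rfl hL (by simp) g Y₀ 1 hY₀p hl (by omega) hgc
      (by rw [hY₀0, hY₀1]; exact hge) horth
      (fun m i => by rw [hY₀2, sub_zero, zero_mul, zero_add]; exact M.f_bdd _) m t ht
    have h3 := (hY₀b t (hsub m t ht)).trans hq
    have h4 := norm_add_le (g.pos m t - Y₀ t) (Y₀ t - q₀)
    rw [sub_add_sub_cancel] at h4
    have h5 : Cg * h ^ 2 * M.L ≤ Cg * M.L * h := by
      have := mul_le_mul_of_nonneg_left hhsq (show 0 ≤ Cg * M.L by positivity)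
      linarith
    rw [hK₀]
    linarith
  obtain ⟨Y, hY, hY0, hY1, hYr⟩ := H₁ 0 (by rw [norm_zero]; positivity) h h0 hh1 q₀ q₁ (by linarith)
    (hq.trans (mul_le_mul_of_nonneg_right (by linarith [norm_nonneg q₀]) h0.le))
  have hYclose : ∀ m : Fin p, ∀ t ∈ Icc ((m : ℕ) * δ) ((m : ℕ) * δ + δ),
      ‖g.pos m t - Y t‖ ≤ Cg * K₁ * h ^ l := by
    intro m t ht
    refine (H p hp h M.L (K₁ * h ^ (l - 2)) h0 hL (by positivity) hsmall g Y (l - 2 + 1) hY.isPoly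
      (by omega) (by omega) hgc (by rw [hY0, hY1]; exact hge) horth (fun m i => ?_) m t ht).trans ?_
    · have h2 := hYr _ (hsub m _ (node_mem R h0.le m i))
      have h3 := M.f_lip (g.pos m (node R h m i)) (Y (node R h m i))
      have h4 := norm_add_le (M.f (g.pos m (node R h m i)) - M.f (Y (node R h m i)))
        (M.f (Y (node R h m i)) - deriv (deriv Y) (node R h m i))
      rw [sub_add_sub_cancel] at h4
      linarith
    · have := pow_sub_two_le h0.le hh1 l
      calc Cg * h ^ 2 * (K₁ * h ^ (l - 2)) = Cg * K₁ * (h ^ 2 * h ^ (l - 2)) := by ring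
        _ ≤ _ := by gcongr
  have hYp : PolyBound (l + 1) K₁ Y := hY.mono (by omega)
  have hgp1 : IsPoly (l + 1) (polyCurve g.1) := ⟨_, rfl⟩
  -- The slow part is one polynomial on all of `[0, h]`, so its `O(h ^ l)` distance from `Y` bounds
  -- its coefficients. For a fast piece, known only on length `δ`, the same distance would be of no
  -- use.
  have hslow : PolyBound (l + 1) (K₂ + K₁) (polyCurve g.1) := by
    have h2 : PolyBound (l + 1) K₂ fun t => polyCurve g.1 t - (Y t).1 := by
      refine H₂ h h0 hh1 _ (hgp1.sub hYp.fst.isPoly) fun t ht => ?_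
      obtain ⟨m, hm⟩ := exists_mem_piece hp h0 ht
      exact (norm_fst_le (g.pos m t - Y t)).trans (hYclose m t hm)
    simpa only [sub_add_cancel] using h2.add hYp.fst
  refine ⟨g, hgc, hge, horth, fun m t ht => (hclose m t ht).trans
    (mul_le_mul_of_nonneg_right (by linarith [abs_nonneg K₃, abs_nonneg K₅]) h0.le), fun m => ?_⟩
  have hmδ : (m : ℕ) * δ ∈ Icc 0 h := hsub m _ (left_mem_Icc.2 (by linarith))
  have hmabs : |(m : ℕ) * δ| ≤ 1 := by rw [abs_of_nonneg hmδ.1]; exact hmδ.2.trans hh1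
  have hslow' : PolyBound (l + 1) K₃ fun s => polyCurve g.1 ((m : ℕ) * δ + s) := by
    simpa only [one_mul] using hslow.comp_affine (α := 1) (by simp) hmabs
  have hfast := H₅ p hp h h0 (hh.trans (min_le_left _ _)) g horth m
    (hslow'.weaken (by rw [hD]; linarith [le_abs_self K₃, norm_nonneg q₀]))
    (by
      have h2 := hclose m _ (left_mem_Icc.2 (show (m : ℕ) * δ ≤ (m : ℕ) * δ + δ by linarith))
      have h3 := norm_snd_le (g.pos m ((m : ℕ) * δ))
      have h4 := norm_add_le (g.pos m ((m : ℕ) * δ) - q₀) q₀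
      rw [sub_add_cancel] at h4
      have h5 : K₀ * h ≤ K₀ := mul_le_of_le_one_right hK₀0 hh1
      rw [hD]
      linarith [abs_nonneg K₃])
    ((H₄ p hp h h0 hh1 g q₀ q₁ hq hgc hge horth m).trans (mul_le_mul_of_nonneg_right
      (by rw [hD]; linarith [abs_nonneg K₃, norm_nonneg q₀]) hδ0.le))
  exact (hslow'.weaken (by linarith [le_abs_self K₃, abs_nonneg K₅])).prodMk
    (hfast.weaken (by linarith [le_abs_self K₅, abs_nonneg K₃]))

/-- The quadrature error of the discrete action, for pieces with bounded coefficients. -/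
theorem exists_quadrature_bound {u : ℕ} (hu : R.HasOrder u) (C : ℝ) :
    ∃ K, 0 ≤ K ∧ ∀ p : ℕ, 1 ≤ p → ∀ h : ℝ, 0 < h → h ≤ 1 → ∀ g : PolyPair ns nf l p,
      (∀ m : Fin p, PolyBound (l + 1) C (fun s => g.pos m ((m : ℕ) * (h / p) + s))) →
      |discAction R M.B M.U h g - ∑ m : Fin p,
        ∫ t in ((m : ℕ) * (h / p) : ℝ)..((m : ℕ) * (h / p) + h / p),
          lag M.B M.U (g.pos m t) (deriv (g.pos m) t)| ≤ p * (K * (h / p) ^ (u + 1)) := by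
  -- The Lagrangian along a piece as a smooth family parametrised by the coefficients of that piece,
  -- so that bounded coefficients give a uniform quadrature error.
  have hΨ : ContDiff ℝ ∞ fun z : (Fin (l + 1) → Config ns nf) × ℝ =>
      lag M.B M.U (pval z.1 z.2) (pval (dcoef z.1) z.2) := by
    have hU := M.U_smooth
    have h1 : ContDiff ℝ ∞ fun z : (Fin (l + 1) → Config ns nf) × ℝ => pval z.1 z.2 := by
      unfold pval; fun_prop
    have h2 : ContDiff ℝ ∞ fun z : (Fin (l + 1) → Config ns nf) × ℝ => pval (dcoef z.1) z.2 := by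
      unfold pval dcoef; fun_prop
    unfold lag
    exact (contDiff_const.mul ((M.B.contDiff.comp h2).clm_apply h2)).sub (hU.comp h1)
  obtain ⟨K, hK, H⟩ := hu.exists_error_bound C _ hΨ
  refine ⟨K, hK, fun p hp h h0 h1 g hg => ?_⟩
  have hp' : (1 : ℝ) ≤ p := by exact_mod_cast hp
  set δ := h / p with hδ
  have hδ0 : 0 < δ := by positivity
  have hδ1 : δ ≤ 1 := (div_le_self h0.le hp').trans h1
  rw [discAction, Finset.mul_sum, ← Finset.sum_sub_distrib]
  refine (Finset.abs_sum_le_sum_abs _ _).trans ((Finset.sum_le_card_nsmul _ _ (K * δ ^ (u + 1))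
    fun m _ => ?_).trans_eq (by simp))
  obtain ⟨a, ha, hae⟩ := hg m
  have e1 : ∀ s, g.pos m ((m : ℕ) * δ + s) = pval a s := fun s => congrFun hae s
  have e2 : ∀ s, deriv (g.pos m) ((m : ℕ) * δ + s) = pval (dcoef a) s := fun s => by
    rw [← deriv_comp_const_add, hae, deriv_pval]
  have h2 := H a ha δ hδ0 hδ1
  rw [abs_sub_comm] at h2
  have e3 : ∫ t in ((m : ℕ) * δ : ℝ)..((m : ℕ) * δ + δ), lag M.B M.U (g.pos m t) (deriv (g.pos m) t)
      = ∫ s in (0 : ℝ)..δ, lag M.B M.U (pval a s) (pval (dcoef a) s) := by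
    have := intervalIntegral.integral_comp_add_left (a := 0) (b := δ)
      (fun t => lag M.B M.U (g.pos m t) (deriv (g.pos m) t)) ((m : ℕ) * δ)
    rw [add_zero] at this
    rw [← this]
    simp only [e1, e2]
  rw [e3]
  have e4 : ∀ i, node R h m i = (m : ℕ) * δ + R.c i * δ := fun i => rfl
  simp only [← g.deriv_pos, e4, e1, e2]
  exact h2

end Model

end Multirate

/-! ### From the local model back to the system; approximation of critical curves -/

namespace Multirate

variable {ns nf l p : ℕ} {R : QuadratureRule}

/-- The model `M` describes the system `S` on the closed ball of radius `ρ` around `q₀`. -/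
structure Model.Localizes (M : Model R l ns nf) (S : MultirateSystem ns nf) (q₀ : Config ns nf)
    (ρ : ℝ) : Prop where
  subset : Metric.closedBall q₀ ρ ⊆ S.Qs ×ˢ S.Qf
  lagrangian_eq : ∀ q ∈ Metric.closedBall q₀ ρ, ∀ v, S.lagrangian q v = lag M.B M.U q v

theorem MultirateSystem.exists_model (S : MultirateSystem ns nf) (hl : 1 ≤ l)
    (hdef : R.IsDefinite l) {q₀ : Config ns nf} (hq₀ : q₀ ∈ S.Qs ×ˢ S.Qf) :
    ∃ (M : Model R l ns nf) (ρ : ℝ), 0 < ρ ∧ M.Localizes S q₀ ρ := by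
  obtain ⟨φ, hφ, hkin, hblock⟩ := S.exists_kinetic_functionals
  have hV : ContDiffOn ℝ ∞ (fun q => S.V q + S.W q.2) (S.Qs ×ˢ S.Qf) :=
    S.smooth_V.add (S.smooth_W.comp contDiff_snd.contDiffOn fun q hq => hq.2)
  obtain ⟨ρ, L, U, f, hρ, hL, hsub, hU, hUV, hf, hspec, hlip, hfb, hUb, hT⟩ :=
    exists_local_model hφ (S.isOpen_Qs.prod S.isOpen_Qf) hV hq₀
  obtain ⟨c, hc, hcB⟩ := sumSqForm_coercive hφ
  obtain ⟨κ, hκ, hcoer⟩ := hdef.exists_coercive hl (sumSqForm φ) φ (sumSqForm_apply φ) hφ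
  refine ⟨⟨sumSqForm φ, U, f, L, c, κ, sumSqForm_comm φ, hblock, hc, hcB, hκ, hcoer, hU, hf, hspec,
    hL, hlip, hfb, hUb, hT⟩, ρ, hρ, hsub, fun q hq v => ?_⟩
  change _ = 1 / 2 * sumSqForm φ v v - U q
  rw [MultirateSystem.lagrangian, hkin, hUV q hq]
  ring

theorem fderiv_lag_velocity {E : Type*} [NormedAddCommGroup E] [NormedSpace ℝ E]
    {B : E →L[ℝ] E →L[ℝ] ℝ} (hB : ∀ v w, B v w = B w v) (U : E → ℝ) (q v : E) :
    fderiv ℝ (fun w => lag B U q w) v = B v := by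
  have h := ((B.hasFDerivAt_of_bilinear (hasFDerivAt_id v) (hasFDerivAt_id v)).const_mul
    (1 / 2 : ℝ)).sub_const (U q)
  refine h.fderiv.trans ?_
  ext w
  simp [hB w v]
  ring

namespace Model.Localizes

variable {M : Model R l ns nf} {S : MultirateSystem ns nf} {q₀ : Config ns nf} {ρ h : ℝ}

/-- Solutions of the model equations that stay near `q₀` are critical curves of the system. -/
theorem isCritical (H : M.Localizes S q₀ ρ) (h0 : 0 < h) {x v : ℝ → Config ns nf}
    (hx : ∀ t, HasDerivAt x (v t) t) (hv : ∀ t ∈ Icc 0 h, HasDerivAt v (M.f (x t)) t)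
    (hmem : ∀ t ∈ Icc 0 h, x t ∈ Metric.ball q₀ ρ) :
    S.IsCritical h (x 0) (x h) x ∧
      S.action h x = ∫ t in (0 : ℝ)..h, lag M.B M.U (x t) (v t) := by
  have hvel : ∀ t ∈ Icc 0 h, MultirateSystem.velocity h x t = v t := fun t ht =>
    (hx t).hasDerivWithinAt.derivWithin (uniqueDiffOn_Icc h0 t ht)
  have hmem' : ∀ t ∈ Icc 0 h, x t ∈ Metric.closedBall q₀ ρ := fun t ht =>
    Metric.ball_subset_closedBall (hmem t ht)
  have hsm : ContDiffOn ℝ ∞ x (Icc 0 h) := by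
    have hfs := M.f_smooth
    -- Smoothness by bootstrapping the first order system for position and velocity.
    have := ODE.contDiffOn_enat_Icc_of_hasDerivWithinAt (n := ⊤) (tmin := 0) (tmax := h)
      (f := fun (_ : ℝ) (z : Config ns nf × Config ns nf) => (z.2, M.f z.1)) (u := univ)
      (α := fun t => (x t, v t)) (by
        refine ContDiff.contDiffOn ?_
        simp only [Function.uncurry_def]
        fun_prop)
      (fun t ht => ((hx t).prodMk (hv t ht)).hasDerivWithinAt) (mapsTo_univ _ _)
    exact this.fst
  refine ⟨⟨⟨hsm, fun t ht => H.subset (hmem' t ht), rfl, rfl⟩, fun t ht => ?_⟩, ?_⟩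
  · have h1 : fderiv ℝ (fun y => S.lagrangian y (MultirateSystem.velocity h x t)) (x t)
        = M.B (M.f (x t)) := by
      -- The derivative in the configuration needs agreement of the two Lagrangians on a
      -- neighbourhood, hence the open ball in the hypothesis.
      have e : (fun y => S.lagrangian y (MultirateSystem.velocity h x t)) =ᶠ[𝓝 (x t)]
          fun y => 1 / 2 * M.B (MultirateSystem.velocity h x t) (MultirateSystem.velocity h x t)
            - M.U y := by
        filter_upwards [Metric.isOpen_ball.mem_nhds (hmem t ht)] with y hy
        exact H.lagrangian_eq y (Metric.ball_subset_closedBall hy) _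
      rw [e.fderiv_eq, fderiv_const_sub]
      refine ContinuousLinearMap.ext fun w => ?_
      rw [M.f_spec, _root_.neg_apply]
    rw [h1]
    refine (M.B.hasFDerivAt.comp_hasDerivAt t (hv t ht)).hasDerivWithinAt.congr_of_mem
      (fun s hs => ?_) ht
    rw [funext (H.lagrangian_eq (x s) (hmem' s hs)), fderiv_lag_velocity M.comm, hvel s hs]
    rfl
  · refine intervalIntegral.integral_congr fun t ht => ?_
    rw [uIcc_of_le h0.le] at ht
    simp only [hvel t ht, H.lagrangian_eq _ (hmem' t ht)]

theorem discreteAction_eq (H : M.Localizes S q₀ ρ) {g : PolyPair ns nf l p}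
    (hg : ∀ m i, g.pos m (node R h m i) ∈ Metric.closedBall q₀ ρ) :
    S.discreteAction R h g = discAction R M.B M.U h g := by
  unfold MultirateSystem.discreteAction discAction
  congr 1
  exact Finset.sum_congr rfl fun m _ => Finset.sum_congr rfl fun i _ => by
    rw [← H.lagrangian_eq _ (hg m i)]; rfl

theorem isPolyCurve (H : M.Localizes S q₀ ρ) (hp : 1 ≤ p) (h0 : 0 < h) {a b : Config ns nf}
    {g : PolyPair ns nf l p} (hgc : g.IsContinuous h) (hge : g.HasEndpoints h a b)
    (hg : ∀ m : Fin p, ∀ t ∈ Icc ((m : ℕ) * (h / p)) ((m : ℕ) * (h / p) + h / p),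
      g.pos m t ∈ Metric.closedBall q₀ ρ) : S.IsPolyCurve h a b g := by
  refine ⟨hgc, hge, fun t ht => ?_, fun m t ht => ?_⟩
  · obtain ⟨m, hm⟩ := exists_mem_piece hp h0 ht
    exact (H.subset (hg m t hm)).1
  · rw [add_one_mul] at ht
    exact (H.subset (hg m t ht)).2

/-- Critical points of the model discrete action that stay near `q₀` are discrete critical curves of
the system. -/
theorem isDiscreteCritical (H : M.Localizes S q₀ ρ) (hp : 1 ≤ p) (h0 : 0 < h)
    {a b : Config ns nf} {g : PolyPair ns nf l p} (hgc : g.IsContinuous h)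
    (hge : g.HasEndpoints h a b)
    (horth : ∀ d ∈ PolyPair.tests ns nf l p h, firstVar R M.B M.f h g d = 0)
    (hg : ∀ m : Fin p, ∀ t ∈ Icc ((m : ℕ) * (h / p)) ((m : ℕ) * (h / p) + h / p),
      g.pos m t ∈ Metric.ball q₀ ρ) : S.IsDiscreteCritical R h a b g := by
  refine ⟨H.isPolyCurve hp h0 hgc hge fun m t ht => Metric.ball_subset_closedBall (hg m t ht),
    fun d hdc hde => ?_⟩
  have h1 := hasDerivAt_discAction (R := R) (ΔT := h) M.comm (M.U_smooth.differentiable (by simp))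
    M.f_spec g d
  rw [horth d ⟨hdc, hde⟩, mul_zero] at h1
  refine h1.congr_of_eventuallyEq ?_
  -- Small variations keep all nodes in the open ball, so both discrete actions agree near `ε = 0`
  -- and have the same derivative there.
  have h2 : ∀ m i, ∀ᶠ ε : ℝ in 𝓝 0, (g + ε • d).pos m (node R h m i) ∈ Metric.ball q₀ ρ := by
    intro m i
    have hc : Continuous fun ε : ℝ => (g + ε • d).pos m (node R h m i) :=
      (PolyPair.continuous_pos m _).comp (by fun_prop)
    refine hc.continuousAt.eventually_mem (Metric.isOpen_ball.mem_nhds ?_)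
    rw [zero_smul, add_zero]
    exact hg m _ (node_mem R h0.le m i)
  filter_upwards [eventually_all.2 fun m => eventually_all.2 (h2 m)] with ε hε
  exact H.discreteAction_eq fun m i => Metric.ball_subset_closedBall (hε m i)

end Model.Localizes

/-- Continuous critical curves and polynomials approximating them. -/
theorem Model.exists_approximation (M : Model R l ns nf) (hl : 1 ≤ l) (q₀ : Config ns nf) {C₀ : ℝ}
    (hC₀ : 0 ≤ C₀) :
    ∃ K, 0 ≤ K ∧ ∀ h, 0 < h → h ≤ 1 → 4 * M.L * h ^ 2 ≤ 1 → ∀ q₁, ‖q₁ - q₀‖ ≤ C₀ * h →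
      ∃ x v Y : ℝ → Config ns nf, x 0 = q₀ ∧ x h = q₁ ∧ (∀ t, HasDerivAt x (v t) t) ∧
        Continuous v ∧ (∀ t ∈ Icc 0 h, HasDerivAt v (M.f (x t)) t) ∧ PolyBound (l + 1) K Y ∧
        Y 0 = q₀ ∧ Y h = q₁ ∧ ∀ t ∈ Icc 0 h,
          ‖x t - q₀‖ ≤ K * h ∧ ‖Y t - x t‖ ≤ K * h ^ l ∧ ‖deriv Y t - v t‖ ≤ K * h ^ l := by
  have hfs := M.f_smooth
  have hL := M.L_nonneg
  -- The full degree `l` is allowed here: `Y` serves only as a competitor in the action and is not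
  -- subject to the exactness restriction of the Galerkin estimate.
  obtain ⟨K, hK, HK⟩ := exists_formal_solution (P := ℝ) (E := Config ns nf) (fun _ _ y => M.f y)
    (by fun_prop) (C := ‖q₀‖ + C₀) hL (fun _ _ => M.f_lip) (l - 1)
  refine ⟨C₀ + 2 * M.L + 4 * K, by positivity, fun h h0 hh1 hsmall q₁ hq => ?_⟩
  obtain ⟨x, v, hx0, hxh, hx, hvc, hv⟩ :=
    exists_boundary_value_solution hL hfs.continuous M.f_lip h0 hsmall q₀ q₁
  obtain ⟨Y, hY, hY0, hYh, hYr⟩ := HK 0 (by rw [norm_zero]; positivity) h h0 hh1 q₀ q₁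
    (by linarith) (hq.trans (mul_le_mul_of_nonneg_right (by linarith [norm_nonneg q₀]) h0.le))
  obtain ⟨ℓ, hℓ, hℓ0, hℓh, hℓ2, hℓb⟩ := exists_linear_curve (n := 2) le_rfl h0 q₀ q₁
  have hder : ∀ {n : ℕ} {f : ℝ → Config ns nf}, IsPoly n f → ∀ t, HasDerivAt f (deriv f t) t :=
    fun hf t => (hf.differentiable t).hasDerivAt
  have hhsq : h ^ 2 ≤ h := by nlinarith
  have hlpow : h * h ^ (l - 1) = h ^ l := by rw [← pow_succ', Nat.sub_add_cancel hl]
  have hhl : 0 ≤ h ^ l := by positivity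
  have hYs : IsPoly (l + 1) Y := hY.isPoly.mono (by omega)
  have hxc : Continuous x := continuous_iff_continuousAt.2 fun t => (hx t).continuousAt
  have hYc : Continuous Y := hYs.differentiable.continuous
  obtain ⟨s, hs, hmax⟩ := isCompact_Icc.exists_isMaxOn (nonempty_Icc.2 h0.le)
    (hYc.sub hxc).norm.continuousOn
  -- The largest deviation enters its own bound through the Lipschitz constant; since `4 * M.L * h ^
  -- 2 ≤ 1` it can be absorbed.
  set D := ‖Y s - x s‖ with hD
  have hest := norm_le_of_second_deriv_le (d := fun t => Y t - x t) (d' := fun t => deriv Y t - v t)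
    (d'' := fun t => deriv (deriv Y) t - M.f (x t)) (ε := K * h ^ (l - 1) + M.L * D) h0
    (fun t _ => (hder hYs t).sub (hx t))
    (fun t ht => (hder (hYs.deriv) t).sub (hv t ht))
    (fun t ht => by
      have h1 := hYr t ht
      rw [norm_sub_rev] at h1
      have h2 := M.f_lip (Y t) (x t)
      have h3 : ‖Y t - x t‖ ≤ D := hmax ht
      have h4 := norm_add_le (deriv (deriv Y) t - M.f (Y t)) (M.f (Y t) - M.f (x t))
      rw [sub_add_sub_cancel] at h4
      linarith [mul_le_mul_of_nonneg_left h3 hL])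
    (by simp only [hY0, hx0, sub_self]) (by simp only [hYh, hxh, sub_self])
  have hD0 : 0 ≤ D := norm_nonneg _
  have hDle : D ≤ 2 * h ^ 2 * (K * h ^ (l - 1) + M.L * D) := (hest s hs).2
  have hDD := mul_le_mul_of_nonneg_right hsmall hD0
  have hKh : 0 ≤ K * h ^ (l - 1) := by positivity
  have hLD : M.L * D ≤ K * h ^ (l - 1) := by
    have h1 : D ≤ 4 * h ^ 2 * (K * h ^ (l - 1)) := by nlinarith
    have h2 := mul_le_mul_of_nonneg_left h1 hL
    have h3 := mul_le_mul_of_nonneg_right hsmall hKh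
    nlinarith
  have hsum : 4 * K * h ^ l ≤ (C₀ + 2 * M.L + 4 * K) * h ^ l :=
    mul_le_mul_of_nonneg_right (by linarith) hhl
  refine ⟨x, v, Y, hx0, hxh, hx, hvc, hv, (hY.mono (by omega)).weaken (by linarith), hY0, hYh,
    fun t ht => ⟨?_, ?_, ?_⟩⟩
  · have h1 := (norm_le_of_second_deriv_le (d := fun t => x t - ℓ t)
      (d' := fun t => v t - deriv ℓ t) (d'' := fun t => M.f (x t) - deriv (deriv ℓ) t) (ε := M.L) h0
      (fun t _ => (hx t).sub (hder hℓ t))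
      (fun t ht => (hv t ht).sub (hder hℓ.deriv t))
      (fun t _ => by rw [hℓ2, sub_zero]; exact M.f_bdd _)
      (by simp only [hℓ0, hx0, sub_self]) (by simp only [hℓh, hxh, sub_self]) t ht).2
    have h2 := (hℓb t ht).trans hq
    have h3 := norm_add_le (x t - ℓ t) (ℓ t - q₀)
    rw [sub_add_sub_cancel] at h3
    have h4 := mul_le_mul_of_nonneg_right hhsq hL
    nlinarith [mul_nonneg hK h0.le]
  · have h1 := (hest t ht).2
    have h2 : 2 * h ^ 2 * (K * h ^ (l - 1) + M.L * D) ≤ 2 * h * (2 * (K * h ^ (l - 1))) :=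
      mul_le_mul (by linarith) (by linarith) (by positivity) (by positivity)
    have h3 : 2 * h * (2 * (K * h ^ (l - 1))) = 4 * K * h ^ l := by rw [← hlpow]; ring
    linarith
  · have h1 := (hest t ht).1
    have h2 : 2 * h * (K * h ^ (l - 1) + M.L * D) ≤ 2 * h * (2 * (K * h ^ (l - 1))) :=
      mul_le_mul (by linarith) (by linarith) (by positivity) (by positivity)
    have h3 : 2 * h * (2 * (K * h ^ (l - 1))) = 4 * K * h ^ l := by rw [← hlpow]; ring
    linarith

end Multirate

/-! ### The error estimate -/

namespace Multirate

variable {ns nf l p : ℕ} {R : QuadratureRule}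

theorem exists_norm_sub_le_mul {E : Type*} [NormedAddCommGroup E] [NormedSpace ℝ E] {T : ℝ}
    (hT : 0 < T) {q : ℝ → E} (hq : ContDiffOn ℝ ∞ q (Icc 0 T)) :
    ∃ C, 0 ≤ C ∧ ∀ t ∈ Icc 0 T, ‖q t - q 0‖ ≤ C * t := by
  have hU := uniqueDiffOn_Icc hT
  obtain ⟨C, hC⟩ := isCompact_Icc.exists_bound_of_continuousOn
    (hq.continuousOn_derivWithin hU (by simp))
  have m0 : (0 : ℝ) ∈ Icc 0 T := left_mem_Icc.2 hT.le
  refine ⟨C, (norm_nonneg _).trans (hC 0 m0), fun t ht => ?_⟩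
  have := (convex_Icc (0 : ℝ) T).norm_image_sub_le_of_norm_derivWithin_le
    (hq.differentiableOn (by simp)) hC m0 ht
  rwa [sub_zero, Real.norm_of_nonneg ht.1] at this

theorem sum_integral_pieces (hp : 1 ≤ p) {h : ℝ} {F : ℝ → ℝ} (hF : Continuous F) :
    ∑ m : Fin p, ∫ t in ((m : ℕ) * (h / p) : ℝ)..((m : ℕ) * (h / p) + h / p), F t
      = ∫ t in (0 : ℝ)..h, F t := by
  have hp' : (0 : ℝ) < p := by exact_mod_cast hp
  have := sum_pieces_telescope hp (fun _ t => ∫ s in (0 : ℝ)..t, F s) (δ := h / p) (h := h)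
    (by field_simp) (fun _ _ _ => rfl) (fun _ _ => intervalIntegral.integral_same)
    (fun _ _ => rfl)
  rw [sub_zero] at this
  rw [← this]
  exact Finset.sum_congr rfl fun m _ => (intervalIntegral.integral_interval_sub_left
    (hF.intervalIntegrable _ _) (hF.intervalIntegrable _ _)).symm

theorem PolyBound.polyPair_pieces {Y : ℝ → Config ns nf} {C : ℝ} (hY : PolyBound (l + 1) C Y)
    {h : ℝ} (h0 : 0 < h) (h1 : h ≤ 1) {G : PolyPair ns nf l p} (hG : ∀ m, G.pos m = Y) (m : Fin p) :
    PolyBound (l + 1) (3 ^ (l + 1) * C) (fun s => G.pos m ((m : ℕ) * (h / p) + s)) := by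
  have hm : ((m : ℕ) : ℝ) ≤ p := by exact_mod_cast m.2.le
  have hp' : (0 : ℝ) < p := by exact_mod_cast m.pos
  have hmδ : (m : ℕ) * (h / p) ≤ h := by
    calc (m : ℕ) * (h / p) ≤ p * (h / p) := mul_le_mul_of_nonneg_right hm (by positivity)
      _ = h := by field_simp
  rw [hG]
  simpa only [one_mul] using hY.comp_affine (α := 1) (by simp)
    (by rw [abs_of_nonneg (by positivity)]; linarith)

end Multirate

open Multirate in
theorem mainTheorem2 {ns nf : ℕ} (S : Multirate.MultirateSystem ns nf)
    (R : Multirate.QuadratureRule) (l u : ℕ) (hl : 1 ≤ l) (hu : R.HasOrder u)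
    (hlu : 2 * l ≤ u + 2) (hdef : R.IsDefinite l)
    (T : ℝ) (hT : 0 < T) (q : ℝ → Multirate.Config ns nf)
    (hq : ContDiffOn ℝ ∞ q (Icc 0 T)) (hqQ : ∀ t ∈ Icc 0 T, q t ∈ S.Qs ×ˢ S.Qf) :
    ∃ C : ℝ, ∃ h₀ : ℝ, 0 < C ∧ 0 < h₀ ∧ h₀ ≤ T ∧
      ∀ ΔT : ℝ, 0 < ΔT → ΔT ≤ h₀ → ∀ p : ℕ, 1 ≤ p →
        S.CriticalCurvesMinimise ΔT (q 0) (q ΔT) →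
        S.DiscreteCriticalCurvesMinimise R l p ΔT (q 0) (q ΔT) →
        ∀ Ld LdE : ℝ,
          S.IsDiscreteLagrangian R l p ΔT (q 0) (q ΔT) Ld →
          S.IsExactDiscreteLagrangian ΔT (q 0) (q ΔT) LdE →
          |Ld - LdE| ≤ C * ΔT ^ (2 * l + 1) + (p : ℝ) * (C * (ΔT / p) ^ (u + 1)) := by
  obtain ⟨M, ρ, hρ, H⟩ := S.exists_model hl hdef (hqQ 0 (left_mem_Icc.2 hT.le))
  obtain ⟨C₀, hC₀, hqL⟩ := exists_norm_sub_le_mul hT hq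
  obtain ⟨h₁, K₁, hh₁, hh₁1, hK₁, H₁⟩ :=
    M.exists_regular_discrete_critical hl (hu.exactTo hl hlu) (q 0) hC₀
  obtain ⟨K₂, hK₂, H₂⟩ := M.exists_approximation hl (q 0) hC₀
  obtain ⟨K₃, hK₃, H₃⟩ := M.exists_quadrature_bound hu (K₁ + 3 ^ (l + 1) * K₂)
  have hL := M.L_nonneg
  have hc := M.c_pos
  -- Collects the smallness conditions on `h`: solvability of the boundary value problem, minimality
  -- of its solution, and confinement of all curves to the ball of radius `ρ`.
  set A := 4 * M.L + 8 * (M.L / M.c) + (K₁ + 2 * K₂) / ρ with hA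
  have hA0 : 0 ≤ A := by positivity
  refine ⟨K₃ + (‖M.B‖ + M.L) * K₂ ^ 2 + 1, min T (min h₁ (1 / (A + 1))), by positivity,
    by positivity, min_le_left _ _, ?_⟩
  intro h h0 hh p hp hcrit hdcrit Ld LdE ⟨gL, hgL, hLd⟩ ⟨xL, hxL, hLdE⟩
  have hhT : h ≤ T := hh.trans (min_le_left _ _)
  have hhh₁ : h ≤ h₁ := hh.trans ((min_le_right _ _).trans (min_le_left _ _))
  have hh1 : h ≤ 1 := hhh₁.trans hh₁1
  have hhA : A * h < 1 := by
    have := hh.trans ((min_le_right _ _).trans (min_le_right _ _))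
    rw [le_div_iff₀ (by positivity)] at this
    linarith
  have hp' : (0 : ℝ) < p := by exact_mod_cast hp
  have hhsq : h ^ 2 ≤ h := by nlinarith
  have hhl : h ^ l ≤ h := pow_le_of_le_one h0.le hh1 (by omega)
  have hLc : 0 ≤ M.L / M.c := by positivity
  have hKρ : 0 ≤ (K₁ + 2 * K₂) / ρ := by positivity
  have hmul : ∀ a, 0 ≤ a → a ≤ A → a * h < 1 := fun a _ ha =>
    (mul_le_mul_of_nonneg_right ha h0.le).trans_lt hhA
  have hsq : ∀ a, 0 ≤ a → a ≤ A → a * h ^ 2 ≤ 1 := fun a ha0 ha =>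
    (mul_le_mul_of_nonneg_left hhsq ha0).trans (hmul a ha0 ha).le
  have hrad : (K₁ + 2 * K₂) * h < ρ := by
    have := hmul _ hKρ (by linarith)
    rwa [div_mul_eq_mul_div, div_lt_one hρ] at this
  have hq1 := hqL h ⟨h0.le, hhT⟩
  obtain ⟨g, hgc, hge, horth, hgn, hgb⟩ := H₁ p hp h h0 hhh₁ (q h) hq1
  obtain ⟨x, v, Y, hx0, hxh, hx, hvc, hv, hY, hY0, hYh, hest⟩ :=
    H₂ h h0 hh1 (hsq _ (by positivity) (by linarith)) (q h) hq1
  have hK₁h : 0 ≤ K₁ * h := by positivity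
  have hK₂h : 0 ≤ K₂ * h := by positivity
  have hgball : ∀ m : Fin p, ∀ t ∈ Icc ((m : ℕ) * (h / p)) ((m : ℕ) * (h / p) + h / p),
      g.pos m t ∈ Metric.ball (q 0) ρ := fun m t ht => by
    rw [mem_ball_iff_norm]
    linarith [hgn m t ht]
  have hxball : ∀ t ∈ Icc 0 h, x t ∈ Metric.ball (q 0) ρ := fun t ht => by
    rw [mem_ball_iff_norm]
    linarith [(hest t ht).1]
  have hYball : ∀ t ∈ Icc 0 h, Y t ∈ Metric.closedBall (q 0) ρ := fun t ht => by
    rw [mem_closedBall_iff_norm]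
    have h1 := norm_add_le (Y t - x t) (x t - q 0)
    rw [sub_add_sub_cancel] at h1
    linarith [(hest t ht).1, (hest t ht).2.1, mul_le_mul_of_nonneg_left hhl hK₂]
  obtain ⟨hxc, hxa⟩ := H.isCritical h0 hx hv hxball
  rw [hx0, hxh] at hxc
  have hgcrit := H.isDiscreteCritical hp h0 hgc hge horth hgball
  have hga : S.discreteAction R h g = discAction R M.B M.U h g := H.discreteAction_eq fun m i =>
    Metric.ball_subset_closedBall (hgball m _ (node_mem R h0.le m i))
  obtain ⟨G, hG1, hG2⟩ := PolyPair.exists_of_isPoly hY.isPoly p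
  have hGY : ∀ m, G.pos m = Y := fun m => funext fun t => Prod.ext (hG1 t) (hG2 m t)
  have hsub : ∀ m : Fin p, ∀ t ∈ Icc ((m : ℕ) * (h / p)) ((m : ℕ) * (h / p) + h / p), t ∈ Icc 0 h := by
    intro m t ht
    have hm : ((m : ℕ) : ℝ) + 1 ≤ p := by exact_mod_cast m.2
    have h1 : (((m : ℕ) : ℝ) + 1) * (h / p) ≤ p * (h / p) :=
      mul_le_mul_of_nonneg_right hm (by positivity)
    have h2 : p * (h / p) = h := by field_simp
    exact ⟨le_trans (by positivity) ht.1, ht.2.trans (by linarith)⟩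
  have hGball : ∀ m : Fin p, ∀ t ∈ Icc ((m : ℕ) * (h / p)) ((m : ℕ) * (h / p) + h / p),
      G.pos m t ∈ Metric.closedBall (q 0) ρ := fun m t ht => by
    rw [hGY]; exact hYball t (hsub m t ht)
  have hGp : S.IsPolyCurve h (q 0) (q h) G := H.isPolyCurve hp h0
    (fun m m' _ => by rw [hG2, hG2])
    ⟨⟨by rw [hG1, hY0], by rw [hG1, hYh]⟩, fun m _ => by rw [hG2, hY0],
      fun m _ => by rw [hG2, hYh]⟩ hGball
  have hGa : S.discreteAction R h G = discAction R M.B M.U h G := H.discreteAction_eq fun m i =>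
    hGball m _ (node_mem R h0.le m i)
  -- The given and the constructed critical curve both minimise, and each is a competitor of the
  -- other. The same argument identifies `LdE`.
  have hLd' : Ld = discAction R M.B M.U h g := by
    rw [hLd, ← hga]
    exact le_antisymm (hdcrit gL hgL g hgcrit.1) (hdcrit g hgcrit gL hgL.1)
  have hLdE' : LdE = ∫ t in (0 : ℝ)..h, lag M.B M.U (x t) (v t) := by
    rw [hLdE, ← hxa]
    exact le_antisymm (hcrit xL hxL x hxc.1) (hcrit x hxc xL hxL.1)
  have hmin : Ld ≤ discAction R M.B M.U h G := by
    rw [hLd', ← hga, ← hGa]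
    exact hdcrit g hgcrit G hGp
  have hUc := M.U_smooth.continuous
  have hfc := M.f_smooth.continuous
  -- The assumed minimality among smooth curves does not cover `g`, which is only piecewise smooth;
  -- the comparison lemma for pieces does.
  have hlow := action_le_action_pieces M.comm hc M.B_ge hUc hfc M.f_spec M.U_taylor hL h0
    (hsq _ (by positivity) (by linarith)) hx hvc hv hp (fun m => g.pos m)
    (fun m => (g.isPoly_pos m).differentiable) (fun m => (g.isPoly_pos m).continuous_deriv)
    (hgc.pos_eq) (fun m hm => by rw [hx0]; exact hge.pos_zero m hm)
    (fun m hm => by rw [hxh]; exact hge.pos_last m hm)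
  have hup := action_le_add M.comm hUc hfc M.f_spec M.U_taylor hL h0 hx hvc hv
    hY.isPoly.differentiable hY.isPoly.continuous_deriv (hY0.trans hx0.symm) (hYh.trans hxh.symm)
    (fun t ht => (hest t ht).2.2) (fun t ht => (hest t ht).2.1)
  have h3 : 0 ≤ 3 ^ (l + 1) * K₂ := by positivity
  have hqg := abs_le.1 (H₃ p hp h h0 hh1 g fun m => (hgb m).weaken (by linarith))
  have hqG := abs_le.1 (H₃ p hp h h0 hh1 G fun m =>
    (hY.polyPair_pieces h0 hh1 hGY m).weaken (by linarith))
  simp only [hGY] at hqG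
  rw [sum_integral_pieces hp
    (continuous_lag hUc hY.isPoly.differentiable.continuous hY.isPoly.continuous_deriv)] at hqG
  -- The square of the `O(h ^ l)` deviation times the length of the interval is the source of the
  -- exponent `2l + 1`.
  have hpow : h * ((‖M.B‖ + M.L) * (K₂ * h ^ l) ^ 2) = (‖M.B‖ + M.L) * K₂ ^ 2 * h ^ (2 * l + 1) := by
    ring
  have hBL : 0 ≤ (‖M.B‖ + M.L) * K₂ ^ 2 := by positivity
  have e1 : (‖M.B‖ + M.L) * K₂ ^ 2 * h ^ (2 * l + 1) ≤
      (K₃ + (‖M.B‖ + M.L) * K₂ ^ 2 + 1) * h ^ (2 * l + 1) :=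
    mul_le_mul_of_nonneg_right (by linarith) (by positivity)
  have e2 : (p : ℝ) * (K₃ * (h / p) ^ (u + 1)) ≤
      p * ((K₃ + (‖M.B‖ + M.L) * K₂ ^ 2 + 1) * (h / p) ^ (u + 1)) :=
    mul_le_mul_of_nonneg_left (mul_le_mul_of_nonneg_right (by linarith) (by positivity)) hp'.le
  have e3 : 0 ≤ (‖M.B‖ + M.L) * K₂ ^ 2 * h ^ (2 * l + 1) := by positivity
  rw [hpow] at hup
  rw [abs_le]
  constructor <;> linarith [hqg.1, hqG.2]
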